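/- Let $M\subset\mathbb R^3$ be a compact two-dimensional embedded $C^3$ surface without boundary and let $X=\{x_1,\dots,x_N\}\subset M$. Put $h_{X,M}=\sup_{y\in M}\min_j\|y-x_j\|$ and $q_X=\frac12\min_{i\ne j}\|x_i-x_j\|$. For each $i$ let $t^{(i)}_1,t^{(i)}_2,t^{(i)}_3$ be an orthonormal basis of $\mathbb R^3$ with $t^{(i)}_1,t^{(i)}_2\in T_{x_i}M$, let $K(i)\ni i$ be (the indices of) $k$ nearest neighbours of $x_i$ in $X$ ($x_i$ included), $v^{(i)}_j=(t^{(i)}_1\cdot(x_j-x_i),\,t^{(i)}_2\cdot(x_j-x_i))$, $r_i=\max_{j\in K(i)}\|v_j^{(i)}\|$, and let $R(i)$ be the set of those triangles of a Delaunay triangulation of $\{v^{(i)}_j\}_{j\in K(i)}$ that have $0=v_i^{(i)}$ as a vertex. Let $p_i$ be a polynomial of degree at most $2$ on $\mathbb R^2$ minimizing $\sum_{j\in K(i)}\omega_{ij}\,(p(v^{(i)}_j)-t^{(i)}_3\cdot(x_j-x_i))^2$, where $\omega_{ii}=1$ and $\omega_{ij}=1/k$ for $j\neq i$. Let $z_i$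 be the $C^3$ function on a disc about $0$ of radius larger than $r_i$ with $z_i(0)=0$ whose graph $v\mapsto x_i+v_1t^{(i)}_1+v_2t^{(i)}_2+z_i(v)t_3^{(i)}$ lies in $M$. For a triangle $[0,v_j,v_l]\in R(i)$ and a height function $f_i$, let $\Phi(u)=x_i+w_1t_1^{(i)}+w_2t_2^{(i)}+f_i(w)t_3^{(i)}$, $w=u_1v_j+u_2v_l$, for $u$ in the reference triangle $T=\{u_1,u_2\ge0,\ u_1+u_2\le1\}$, with metric $g_{ab}=\partial_a\Phi\cdot\partial_b\Phi$. On this patch the hat functions $e_i,e_j,e_l$ are $1-u_1-u_2$, $u_1$, $u_2$, the other $e_m$ vanish, and the nodal field $e_mt^{(m)}_\kappa$ ($\kappa=1,2$) is $e_m\sum_q a_q\partial_q\Phi$, where the constants $a=(a_1,a_2)$ are the least-squares coefficients of $t_\kappa^{(m)}$ in the basis $\partial_1\Phi,\partial_2\Phi$ evaluated at the vertex $m$. The $2N\times 2N$ mass and stiffness matrices built from $f=(f_i)$ are $$\mathbf M_{(i,\kappa),(m,\kappa')}=\sum_{R(i)}\int_T\langle e_it^{(i)}_\kappa,e_mt^{(m)}_{\kappa'}\rangle_g\sqrt{\det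 g}\,du,\qquad \mathbf S_{(i,\kappa),(m,\kappa')}=\sum_{R(i)}\int_T\langle \mathrm{grad}_g(e_it^{(i)}_\kappa),\mathrm{grad}_g(e_mt^{(m)}_{\kappa'})\rangle_g\sqrt{\det g}\,du,$$ where $\mathrm{grad}_g(V^a\partial_a)=g^{cb}(\partial_cV^a+V^d\Gamma^a_{dc})\,\partial_a\otimes\partial_b$ (the Bochner case). Let $\mathbf A=\frac12(\mathbf S+\mathbf S^\top)$ and $\mathbf B=\frac12(\mathbf M+\mathbf M^\top)$ for the exact heights $f_i=z_i$, and let $\widehat{\mathbf A},\widehat{\mathbf B}$ be the same matrices for the fitted heights $f_i=p_i$ (the curved mesh). Put $$\varepsilon=\big(\|\widehat{\mathbf A}-\mathbf A\|_2^2+\|\widehat{\mathbf B}-\mathbf B\|_2^2\big)^{1/2},\qquad c(\mathbf A,\mathbf B)=\min_{\|\mathbf x\|=1}\ (\mathbf x^\top\mathbf A\mathbf x)^2+(\mathbf x^\top\mathbf B\mathbf x)^2 .$$ **Lemma.** Let $c_q,c_r\in\mathbb R$. There are $h_0>0$, $k_0\in\mathbb N$, $C_0>0$ and $\kappa_0\ge1$,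 depending only on $M,c_q,c_r$, such that the following holds for all $N$, $k\ge k_0$, all $X$ with $h_{X,M}\le h_0$, $q_X\le h_{X,M}\le c_q\,q_X$ and $r_i^2\le c_r\,h_{X,M}$ for all $i$, and all choices of the objects above. 1. $\kappa_0\,\varepsilon\le C_0\,h_{X,M}$; in particular $\|\mathbf A-\widehat{\mathbf A}\|_2$ and $\|\mathbf B-\widehat{\mathbf B}\|_2$ are $O(h_{X,M})$. 2. Suppose that $\mathbf A$, $\mathbf B$ and $\widehat{\mathbf B}$ are positive definite. Let $a_1\ge\dots\ge a_{2N}$ and $b_1\ge\dots\ge b_{2N}$ be the eigenvalues of $\mathbf A$ and $\mathbf B$, and let $\lambda_{1,N}\ge\dots\ge\lambda_{2N,N}$ and $\widehat\lambda_{1,N}\ge\dots\ge\widehat\lambda_{2N,N}$ be the eigenvalues of the pencils $\mathbf A-\lambda\mathbf B$ and $\widehat{\mathbf A}-\lambda\widehat{\mathbf B}$, all with multiplicity. Let $C$ be any number with $\kappa_0\,\varepsilon\le C\,h_{X,M}$ (for instance $C=C_0$). If $\min_{\ell=1,\dots,2N}(a_\ell^2+b_\ell^2)>C^2h_{X,M}^2$,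 then for every $\ell=1,\dots,2N$ $$|\lambda_{\ell,N}-\widehat\lambda_{\ell,N}|\le\frac{C\,h_{X,M}}{c(\mathbf A,\mathbf B)}\,\big|1+\lambda_{\ell,N}\widehat\lambda_{\ell,N}\big| .$$ -/

import Mathlib

open Metric

/-- The ambient Euclidean space. -/
abbrev E3 : Type := EuclideanSpace ℝ (Fin 3)

/-- The parameter plane (tangent-plane coordinates and reference-triangle coordinates). -/
abbrev E2 : Type := EuclideanSpace ℝ (Fin 2)

/-- `M` is a two-dimensional embedded `C³` submanifold of `ℝ³` without boundary: near each of its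
points it is a regular level set of a `C³` function. -/
def IsC3Surface (M : Set E3) : Prop :=
  ∀ x ∈ M, ∃ (U : Set E3) (F : E3 → ℝ), IsOpen U ∧ x ∈ U ∧ ContDiffOn ℝ 3 F U ∧
    (∀ y ∈ U, fderiv ℝ F y ≠ 0) ∧ M ∩ U = {y ∈ U | F y = 0}

/-! ### Riemannian quantities of a parameterization `Φ : ℝ² → ℝ³` -/

namespace Param

noncomputable section

/-- Partial derivative in the `k`-th coordinate. -/
def pd {F : Type*} [NormedAddCommGroup F] [NormedSpace ℝ F] (k : Fin 2) (f : E2 → F) (u : E2) : F :=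
  fderiv ℝ f u (EuclideanSpace.single k 1)

/-- The induced metric `g_{kl} = ⟨∂_k Φ, ∂_l Φ⟩`. -/
def metric (Φ : E2 → E3) (u : E2) : Matrix (Fin 2) (Fin 2) ℝ :=
  Matrix.of fun k l => inner ℝ (pd k Φ u) (pd l Φ u)

/-- The Christoffel symbols `Γ^i_{pk}` of the induced metric. -/
def christoffel (Φ : E2 → E3) (i p k : Fin 2) (u : E2) : ℝ :=
  (1 / 2) * ∑ m, (metric Φ u)⁻¹ i m *
    (pd k (fun w => metric Φ w m p) u + pd p (fun w => metric Φ w m k) u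
      - pd m (fun w => metric Φ w p k) u)

/-- The gradient of the vector field `V^i ∂_i`, a `(2,0)` tensor field with components
`∑_k g^{kj} (∂_k V^i + V^p Γ^i_{pk})`. -/
def gradVec (Φ : E2 → E3) (V : Fin 2 → E2 → ℝ) (u : E2) : Matrix (Fin 2) (Fin 2) ℝ :=
  Matrix.of fun i j => ∑ k, (metric Φ u)⁻¹ k j *
    (pd k (V i) u + ∑ p, V p u * christoffel Φ i p k u)

/-- The Riemannian inner product of two vector fields. -/
def vecInner (Φ : E2 → E3) (V W : Fin 2 → E2 → ℝ) (u : E2) : ℝ :=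
  ∑ i, ∑ j, V i u * metric Φ u i j * W j u

/-- The Riemannian inner product `tr (a g bᵀ g)` of two `(2,0)` tensors. -/
def tensorInner (Φ : E2 → E3) (u : E2) (a b : Matrix (Fin 2) (Fin 2) ℝ) : ℝ :=
  (a * metric Φ u * b.transpose * metric Φ u).trace

/-- The Riemannian area density. -/
def density (Φ : E2 → E3) (u : E2) : ℝ := Real.sqrt (metric Φ u).det

/-- Least-squares coefficients of an ambient vector `τ` in the coordinate basis
`∂₁Φ, ∂₂Φ` at the parameter `w`, i.e. `(RᵀR)⁻¹ Rᵀ τ` with `R = [∂₁Φ(w), ∂₂Φ(w)]`. -/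
def lsCoeff (Φ : E2 → E3) (w : E2) (τ : E3) : Fin 2 → ℝ :=
  (metric Φ w)⁻¹.mulVec fun q => inner ℝ (pd q Φ w) τ

/-- The reference triangle. -/
def refTriangle : Set E2 := {u | 0 ≤ u 0 ∧ 0 ≤ u 1 ∧ u 0 + u 1 ≤ 1}

end

end Param

/-! ### Delaunay triangulations and least squares -/

/-- `𝒯` is (the set of triangles of) a Delaunay triangulation of the planar points
`v j`, `j ∈ K`. -/
structure IsDelaunay {ι : Type*} [DecidableEq ι] (v : ι → E2) (K : Finset ι)
    (𝒯 : Finset (Finset ι)) : Prop where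
  subset : ∀ s ∈ 𝒯, s ⊆ K
  card : ∀ s ∈ 𝒯, s.card = 3
  nondegenerate : ∀ s ∈ 𝒯, AffineIndependent ℝ (fun j : s => v j)
  cover : (⋃ s ∈ 𝒯, convexHull ℝ (v '' (s : Set ι))) = convexHull ℝ (v '' (K : Set ι))
  faces : ∀ s ∈ 𝒯, ∀ s' ∈ 𝒯, convexHull ℝ (v '' (s : Set ι)) ∩ convexHull ℝ (v '' (s' : Set ι))
    = convexHull ℝ (v '' ((s ∩ s' : Finset ι) : Set ι))
  emptyCircle : ∀ s ∈ 𝒯, ∃ (c : E2) (ρ : ℝ), (∀ j ∈ s, dist (v j) c = ρ) ∧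
    ∀ j ∈ K, ρ ≤ dist (v j) c

/-- The quadratic polynomial with the given coefficients. -/
noncomputable def quadPoly (c : Fin 6 → ℝ) (v : E2) : ℝ :=
  c 0 * v 0 ^ 2 + c 1 * v 1 ^ 2 + c 2 * (v 0 * v 1) + c 3 * v 0 + c 4 * v 1 + c 5

/-- The least-squares weight: `1` at the base point and `1/k` at the other neighbours. -/
noncomputable def lsWeight (k : ℕ) (s : ℝ) : ℝ := if s = 0 then 1 else 1 / (k : ℝ)

/-! ### The local curved mesh of a point cloud -/

/-- Tangent-plane coordinates, in the frame `t`, of the point `y` relative to the base point `x`. -/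
noncomputable def tangentCoord (t : OrthonormalBasis (Fin 3) ℝ E3) (x y : E3) : E2 :=
  !₂[inner ℝ (t 0) (y - x), inner ℝ (t 1) (y - x)]

/-- The graph parameterization `v ↦ x + v₁ t₁ + v₂ t₂ + f(v) t₃`. -/
noncomputable def graphMap (t : OrthonormalBasis (Fin 3) ℝ E3) (x : E3) (f : E2 → ℝ) (v : E2) :
    E3 :=
  x + v 0 • t 0 + v 1 • t 1 + f v • t 2

/-- A point cloud of `N` points on the surface `M`, together with everything that is constructed
from it: adapted orthonormal frames, `k` nearest neighbours, Delaunay triangulations of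
the projected neighbours, quadratic weighted least-squares fits, and the exact local graph charts
of `M`. Ties (equidistant neighbours, cocircular points) may be broken in any way. -/
structure CurvedMesh (M : Set E3) (N k : ℕ) where
  /-- the sample points -/
  x : Fin N → E3
  x_mem : ∀ i, x i ∈ M
  /-- orthonormal frames; the first two vectors are tangent to `M`, the third is normal -/
  t : Fin N → OrthonormalBasis (Fin 3) ℝ E3
  t_tangent : ∀ i, t i 0 ∈ tangentConeAt ℝ M (x i) ∧ t i 1 ∈ tangentConeAt ℝ M (x i)
  /-- the `k` nearest neighbours, the point itself included -/
  K : Fin N → Finset (Fin N)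
  self_mem : ∀ i, i ∈ K i
  K_card : ∀ i, (K i).card = k
  K_nearest : ∀ i, ∀ a ∈ K i, ∀ b ∉ K i, dist (x i) (x a) ≤ dist (x i) (x b)
  /-- the triangles of a Delaunay triangulation of the projected neighbours -/
  tri : Fin N → Finset (Finset (Fin N))
  tri_delaunay : ∀ i, IsDelaunay (fun j => tangentCoord (t i) (x i) (x j)) (K i) (tri i)
  /-- coefficients of the quadratic weighted least-squares fit of the normal components -/
  coef : Fin N → Fin 6 → ℝ
  coef_min : ∀ i, ∀ c : Fin 6 → ℝ,
    ∑ j ∈ K i, lsWeight k ‖x i - x j‖ *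
        (quadPoly (coef i) (tangentCoord (t i) (x i) (x j)) - inner ℝ (t i 2) (x j - x i)) ^ 2
      ≤ ∑ j ∈ K i, lsWeight k ‖x i - x j‖ *
        (quadPoly c (tangentCoord (t i) (x i) (x j)) - inner ℝ (t i 2) (x j - x i)) ^ 2
  /-- the height functions of the exact local graph charts of `M` -/
  z : Fin N → E2 → ℝ
  z_zero : ∀ i, z i 0 = 0
  z_chart : ∀ i, ∃ ρ : ℝ, (∀ j ∈ K i, ‖tangentCoord (t i) (x i) (x j)‖ < ρ) ∧
    ContDiffOn ℝ 3 (z i) (ball 0 ρ) ∧ ∀ v ∈ ball (0 : E2) ρ, graphMap (t i) (x i) (z i) v ∈ M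

namespace CurvedMesh

noncomputable section

variable {M : Set E3} {N k : ℕ} (X : CurvedMesh M N k)

/-- The fill distance `sup_{y ∈ M} min_j ‖y - x_j‖`. -/
def fill : ℝ := sSup ((fun y => infDist y (Set.range X.x)) '' M)

/-- The separation distance `½ min_{i ≠ j} ‖x_i - x_j‖`. -/
def sep : ℝ := (1 / 2) * sInf {d | ∃ i j, i ≠ j ∧ d = ‖X.x i - X.x j‖}

/-- The projection of `x_j` to the tangent plane at `x_i`. -/
def v (i j : Fin N) : E2 := tangentCoord (X.t i) (X.x i) (X.x j)

/-- The radius of the projected neighbourhood of `x_i`. -/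
def rad (i : Fin N) : ℝ := (X.K i).sup' ⟨i, X.self_mem i⟩ fun j => ‖X.v i j‖

/-- The first ring at `x_i`: the triangles `[0, v_j, v_l]` of the triangulation with vertex `x_i`,
each listed once, with `j < l`. -/
def ring (i : Fin N) : Finset (Fin N × Fin N) :=
  Finset.univ.filter fun p => p.1 < p.2 ∧ ({i, p.1, p.2} : Finset (Fin N)) ∈ X.tri i

/-- The patch over the triangle `[0, v_j, v_l]` of the graph of the height function `f i`,
parameterized by the reference triangle. -/
def patch (f : Fin N → E2 → ℝ) (i : Fin N) (p : Fin N × Fin N) (u : E2) : E3 :=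
  graphMap (X.t i) (X.x i) (f i) (u 0 • X.v i p.1 + u 1 • X.v i p.2)

/-- The hat function of node `m` on the triangle with vertices `i, p.1, p.2`. -/
def hat (i : Fin N) (p : Fin N × Fin N) (m : Fin N) (u : E2) : ℝ :=
  if m = i then 1 - u 0 - u 1 else if m = p.1 then u 0 else if m = p.2 then u 1 else 0

/-- The parameter of the vertex `m` of the triangle with vertices `i, p.1, p.2`. -/
def vertexParam (i : Fin N) (p : Fin N × Fin N) (m : Fin N) : E2 :=
  if m = i then 0 else if m = p.1 then EuclideanSpace.single 0 1
  else if m = p.2 then EuclideanSpace.single 1 1 else 0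

/-- Components, in the coordinates of the patch, of the nodal vector field `e_m t_κ^{(m)}`:
the hat function times the coefficients of `t_κ^{(m)}` in the coordinate basis at the node. -/
def nodalField (f : Fin N → E2 → ℝ) (i : Fin N) (p : Fin N × Fin N) (m : Fin N) (κ : Fin 2) :
    Fin 2 → E2 → ℝ :=
  fun q u => hat i p m u *
    Param.lsCoeff (X.patch f i p) (vertexParam i p m) (X.t m (Fin.castSucc κ)) q

/-- The mass matrix built from the patches of the height functions `f`. -/
def massMatrix (f : Fin N → E2 → ℝ) : Matrix (Fin N × Fin 2) (Fin N × Fin 2) ℝ :=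
  Matrix.of fun a b => ∑ p ∈ X.ring a.1, ∫ u in Param.refTriangle,
    Param.vecInner (X.patch f a.1 p)
      (X.nodalField f a.1 p a.1 a.2) (X.nodalField f a.1 p b.1 b.2) u
    * Param.density (X.patch f a.1 p) u

/-- The Bochner stiffness matrix built from the patches of the height functions `f`. -/
def stiffnessMatrix (f : Fin N → E2 → ℝ) : Matrix (Fin N × Fin 2) (Fin N × Fin 2) ℝ :=
  Matrix.of fun a b => ∑ p ∈ X.ring a.1, ∫ u in Param.refTriangle,
    Param.tensorInner (X.patch f a.1 p) u
      (Param.gradVec (X.patch f a.1 p) (X.nodalField f a.1 p a.1 a.2) u)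
      (Param.gradVec (X.patch f a.1 p) (X.nodalField f a.1 p b.1 b.2) u)
    * Param.density (X.patch f a.1 p) u

/-- Symmetrized stiffness matrix of the exact charts. -/
def A : Matrix (Fin N × Fin 2) (Fin N × Fin 2) ℝ :=
  (1 / 2 : ℝ) • (X.stiffnessMatrix X.z + (X.stiffnessMatrix X.z).transpose)

/-- Symmetrized mass matrix of the exact charts. -/
def B : Matrix (Fin N × Fin 2) (Fin N × Fin 2) ℝ :=
  (1 / 2 : ℝ) • (X.massMatrix X.z + (X.massMatrix X.z).transpose)

/-- The fitted quadratic height functions. -/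
def fit (i : Fin N) : E2 → ℝ := quadPoly (X.coef i)

/-- Symmetrized stiffness matrix of the curved mesh. -/
def Ahat : Matrix (Fin N × Fin 2) (Fin N × Fin 2) ℝ :=
  (1 / 2 : ℝ) • (X.stiffnessMatrix X.fit + (X.stiffnessMatrix X.fit).transpose)

/-- Symmetrized mass matrix of the curved mesh. -/
def Bhat : Matrix (Fin N × Fin 2) (Fin N × Fin 2) ℝ :=
  (1 / 2 : ℝ) • (X.massMatrix X.fit + (X.massMatrix X.fit).transpose)

end

end CurvedMesh

/-! ### Symmetric-definite pencils -/

/-- The spectral norm of a square matrix. -/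
noncomputable def specNorm {n : Type*} [Fintype n] [DecidableEq n] (A : Matrix n n ℝ) : ℝ :=
  ‖Matrix.toEuclideanCLM (n := n) (𝕜 := ℝ) A‖

/-- The size `(‖Â - A‖₂² + ‖B̂ - B‖₂²)^{1/2}` of the perturbation of the pencil `A - λ B`. -/
noncomputable def pencilDist {n : Type*} [Fintype n] [DecidableEq n] (A B A' B' : Matrix n n ℝ) :
    ℝ :=
  Real.sqrt (specNorm (A' - A) ^ 2 + specNorm (B' - B) ^ 2)

/-- The number `min_{‖x‖ = 1} (xᵀ A x)² + (xᵀ B x)²`. -/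
noncomputable def crawford {n : Type*} [Fintype n] (A B : Matrix n n ℝ) : ℝ :=
  sInf ((fun x : EuclideanSpace ℝ n =>
    (x.ofLp ⬝ᵥ A.mulVec x.ofLp) ^ 2 + (x.ofLp ⬝ᵥ B.mulVec x.ofLp) ^ 2) '' sphere 0 1)

/-- `μ` lists the eigenvalues of the pencil `A - λ B` in non-increasing order, with multiplicity:
there is a basis of generalized eigenvectors `A w_ℓ = μ_ℓ B w_ℓ`. With `B = 1`, these are the
ordinary eigenvalues of `A`. -/
def IsPencilSpectrum {N : ℕ} (A B : Matrix (Fin N × Fin 2) (Fin N × Fin 2) ℝ)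
    (μ : Fin (2 * N) → ℝ) : Prop :=
  Antitone μ ∧ ∃ w : Fin (2 * N) → Fin N × Fin 2 → ℝ,
    LinearIndependent ℝ w ∧ ∀ l, A.mulVec (w l) = μ l • B.mulVec (w l)

/-! Write `h` for the fill distance. The exact and the fitted pencil both lie within `O(h)` of one
flat pencil, and a perturbation of size `ε` turns the generalized eigenvalues of a definite pencil,
viewed as slopes, by an angle controlled by `ε` and the Crawford number.

Matrices. The fit is never compared with the exact height: each patch is compared with the flat
triangle in the tangent plane. Triangles of the first ring have size `h`, and both heights have
gradient `O(√h)` and bounded Hessian. The metric of a graph is the flat one, of order `h²`, plus a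
product of two edge slopes `O(h^{3/2})`, so its relative error is `O(h)`. The least-squares
coefficients have the same relative error, since an edge slope there meets the normal component of a
nearly tangent vector. These errors propagate through inverses, roots, products and integrals
(`Close`, `element_integrals_close`). Each row has boundedly many nonzero entries, so a Schur test
gives the spectral norm (`specNorm_le_of_sparse`).

Geometry. Bounds for the exact height come from implicit differentiation of a defining function
(`IsLocalDefining.height_bounds`). For the fit, the zero polynomial is a competitor whose residuals
are `O(D²)`, with `D` the radius of the neighbourhood; on quasi-uniform points the mean square
controls the coefficients (`quadSize_le_of_sum_sq_le`), so the gradient is `O(D)` near the origin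
and the Hessian `O(1)`. The bound `r_i² ≤ c_r h` makes `D = O(√h)`. Large `k` makes `D` a large
multiple of `h`, so projected points are `h`-dense near the origin; empty circles are then small
(`IsFine.ring_circumcenter`), and with separation the triangles are nondegenerate
(`IsFine.le_det_ring`).

Eigenvalues. A dimension count yields a unit vector `x` whose Rayleigh quotients in the two pencils
bracket the two `ℓ`-th eigenvalues (`IsPencilSpectrum.exists_test_vector`). The point `(xᵀBx, xᵀAx)`
has distance at least `√c` from the origin, where `c` is the Crawford number, and crosses the line
of slope `λ̂` when moved by at most `ε`. Hence the sine of its angle to that line is at most `ε/√c`,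
and passing to tangents gives the factor `ε/√(c - ε²)`. Bounded entries give `c ≤ κ² - 1`, and the
gap gives `κ²ε² < c`; together they replace this factor by `κε/c`. -/

/-! ### Symmetric pencils and Rayleigh quotients on spans of eigenvectors. -/

section Pencil

variable {n ι : Type*} [Fintype n] [Fintype ι]

/-- Generalized eigenvectors of a symmetric pencil for distinct eigenvalues are `B`-orthogonal. -/
lemma pencil_orthogonal {A B : Matrix n n ℝ} (hA : A.transpose = A) (hB : B.transpose = B)
    {x y : n → ℝ} {μ ν : ℝ} (hx : A.mulVec x = μ • B.mulVec x) (hy : A.mulVec y = ν • B.mulVec y)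
    (h : μ ≠ ν) : x ⬝ᵥ B.mulVec y = 0 := by
  have sym : ∀ {C : Matrix n n ℝ}, C.transpose = C → ∀ u v : n → ℝ,
      u ⬝ᵥ C.mulVec v = v ⬝ᵥ C.mulVec u := by
    intro C hC u v
    rw [Matrix.dotProduct_mulVec, ← Matrix.mulVec_transpose, hC, dotProduct_comm]
  have h1 := sym hA x y
  rw [hx, hy, dotProduct_smul, dotProduct_smul, sym hB y x] at h1
  have h2 : (ν - μ) * (x ⬝ᵥ B.mulVec y) = 0 := by
    simp only [smul_eq_mul] at h1
    linarith
  rcases mul_eq_zero.1 h2 with h3 | h3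
  · exact absurd (sub_eq_zero.1 h3).symm h
  · exact h3

lemma quadForm_sum (B : Matrix n n ℝ) (w : ι → n → ℝ) (c : ι → ℝ) :
    (∑ l, c l • w l) ⬝ᵥ B.mulVec (∑ l, c l • w l)
      = ∑ l, ∑ m, c l * c m * (w l ⬝ᵥ B.mulVec (w m)) := by
  rw [Matrix.mulVec_sum, sum_dotProduct]
  refine Finset.sum_congr rfl fun l _ => ?_
  rw [dotProduct_sum]
  refine Finset.sum_congr rfl fun m _ => ?_
  rw [Matrix.mulVec_smul, dotProduct_smul, smul_dotProduct]
  simp only [smul_eq_mul]; ring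

lemma quadForm_pencil_sum {A B : Matrix n n ℝ} {w : ι → n → ℝ} {μ : ι → ℝ}
    (hw : ∀ l, A.mulVec (w l) = μ l • B.mulVec (w l)) (c : ι → ℝ) :
    (∑ l, c l • w l) ⬝ᵥ A.mulVec (∑ l, c l • w l)
      = ∑ l, ∑ m, c l * c m * (μ m * (w l ⬝ᵥ B.mulVec (w m))) := by
  rw [quadForm_sum]
  simp only [hw, dotProduct_smul, smul_eq_mul]

/-- On the span of generalized eigenvectors with eigenvalues `≤ s`, the Rayleigh quotient of the
pencil is `≤ s`. -/
lemma pencil_form_le {A B : Matrix n n ℝ} (hA : A.transpose = A) (hB : B.transpose = B)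
    (hB0 : ∀ x : n → ℝ, 0 ≤ x ⬝ᵥ B.mulVec x) {w : ι → n → ℝ} {μ : ι → ℝ}
    (hw : ∀ l, A.mulVec (w l) = μ l • B.mulVec (w l)) {s : ℝ} (hs : ∀ l, μ l ≤ s)
    {x : n → ℝ} (hx : x ∈ Submodule.span ℝ (Set.range w)) :
    x ⬝ᵥ A.mulVec x ≤ s * (x ⬝ᵥ B.mulVec x) := by
  obtain ⟨c, rfl⟩ := (Submodule.mem_span_range_iff_exists_fun ℝ).1 hx
  -- The `w l` need not be `B`-orthogonal within one eigenvalue. Distinct eigenvalues decouple, so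
  -- `s B - A` at `∑ c l • w l` equals `B` at the vector with coefficients rescaled by `√(s - μ l)`.
  have key := hB0 (∑ l, (Real.sqrt (s - μ l) * c l) • w l)
  rw [quadForm_sum] at key
  rw [quadForm_pencil_sum hw, quadForm_sum, ← sub_nonneg, Finset.mul_sum, ← Finset.sum_sub_distrib]
  convert key using 2 with l
  rw [Finset.mul_sum, ← Finset.sum_sub_distrib]
  refine Finset.sum_congr rfl fun m _ => ?_
  by_cases h : μ l = μ m
  · have : Real.sqrt (s - μ l) * Real.sqrt (s - μ m) = s - μ m := by
      rw [h, Real.mul_self_sqrt (sub_nonneg.2 (hs m))]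
    linear_combination (-c l * c m * (w l ⬝ᵥ B.mulVec (w m))) * this
  · rw [pencil_orthogonal hA hB (hw l) (hw m) h]; ring

lemma le_pencil_form {A B : Matrix n n ℝ} (hA : A.transpose = A) (hB : B.transpose = B)
    (hB0 : ∀ x : n → ℝ, 0 ≤ x ⬝ᵥ B.mulVec x) {w : ι → n → ℝ} {μ : ι → ℝ}
    (hw : ∀ l, A.mulVec (w l) = μ l • B.mulVec (w l)) {s : ℝ} (hs : ∀ l, s ≤ μ l)
    {x : n → ℝ} (hx : x ∈ Submodule.span ℝ (Set.range w)) :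
    s * (x ⬝ᵥ B.mulVec x) ≤ x ⬝ᵥ A.mulVec x := by
  have h := pencil_form_le (A := -A) (μ := fun l => -μ l) (s := -s)
    (by rw [Matrix.transpose_neg, hA]) hB hB0
    (fun l => by rw [Matrix.neg_mulVec, hw, neg_smul]) (fun l => neg_le_neg (hs l)) hx
  rw [Matrix.neg_mulVec, dotProduct_neg] at h
  linarith

/-- Two families whose sizes add up to more than the dimension have intersecting spans. -/
lemma exists_ne_zero_mem_span_inter {κ : Type*} [Fintype κ] {w : ι → n → ℝ} {w' : κ → n → ℝ}
    (hw : LinearIndependent ℝ w) (hw' : LinearIndependent ℝ w')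
    (h : Fintype.card n < Fintype.card ι + Fintype.card κ) :
    ∃ x : n → ℝ, x ≠ 0 ∧ x ∈ Submodule.span ℝ (Set.range w) ∧
      x ∈ Submodule.span ℝ (Set.range w') := by
  by_contra! hc
  have hd : Disjoint (Submodule.span ℝ (Set.range w)) (Submodule.span ℝ (Set.range w')) := by
    rw [Submodule.disjoint_def]
    intro x hx hx'
    by_contra h0
    exact hc x h0 hx hx'
  have := Submodule.finrank_add_finrank_le_of_disjoint hd
  rw [finrank_span_eq_card hw, finrank_span_eq_card hw', Module.finrank_fintype_fun_eq_card] at this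
  omega

end Pencil

/-! ### Spectral norm and Schur test. -/

section SpecNorm

variable {n : Type*} [Fintype n] [DecidableEq n]

lemma abs_quadForm_le_specNorm (E : Matrix n n ℝ) (x : EuclideanSpace ℝ n) :
    |x.ofLp ⬝ᵥ E.mulVec x.ofLp| ≤ specNorm E * ‖x‖ ^ 2 := by
  have h1 : x.ofLp ⬝ᵥ E.mulVec x.ofLp
      = inner ℝ x (Matrix.toEuclideanCLM (n := n) (𝕜 := ℝ) E x) := by
    rw [PiLp.inner_apply]
    simp only [dotProduct, Matrix.ofLp_toEuclideanCLM]
    refine Finset.sum_congr rfl fun i _ => ?_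
    simp [mul_comm]
  rw [h1]
  calc _ ≤ ‖x‖ * ‖Matrix.toEuclideanCLM (n := n) (𝕜 := ℝ) E x‖ := abs_real_inner_le_norm _ _
    _ ≤ ‖x‖ * (specNorm E * ‖x‖) := by
      gcongr; exact ContinuousLinearMap.le_opNorm _ _
    _ = _ := by ring

lemma specNorm_nonneg (E : Matrix n n ℝ) : 0 ≤ specNorm E := norm_nonneg _

/-- Schur test: a matrix whose entries are at most `δ` and vanish off a symmetric relation with at
most `r` relatives per index has spectral norm at most `r δ`. -/
lemma specNorm_le_of_sparse (E : Matrix n n ℝ) (near : n → n → Prop) [DecidableRel near]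
    (hsymm : ∀ a b, near a b → near b a) {δ r : ℝ} (hδ : 0 ≤ δ) (hr : 0 ≤ r)
    (hcard : ∀ a, ((Finset.univ.filter (near a)).card : ℝ) ≤ r)
    (hE : ∀ a b, |E a b| ≤ δ) (hE0 : ∀ a b, ¬ near a b → E a b = 0) :
    specNorm E ≤ r * δ := by
  refine ContinuousLinearMap.opNorm_le_bound _ (by positivity) fun x => ?_
  refine abs_le_of_sq_le_sq' ?_ (by positivity) |>.2
  rw [EuclideanSpace.norm_sq_eq, mul_pow, EuclideanSpace.norm_sq_eq]
  simp only [Matrix.ofLp_toEuclideanCLM, Real.norm_eq_abs, sq_abs]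
  -- Cauchy–Schwarz over the at most `r` relatives in a row; after exchanging the sums, symmetry of
  -- the relation bounds the columns by the same `r`.
  have hrow : ∀ a, (E.mulVec x.ofLp a) ^ 2
      ≤ r * δ ^ 2 * ∑ b, if near a b then x.ofLp b ^ 2 else 0 := by
    intro a
    have h1 : E.mulVec x.ofLp a = ∑ b ∈ Finset.univ.filter (near a), E a b * x.ofLp b := by
      rw [Finset.sum_filter]
      refine Finset.sum_congr rfl fun b _ => ?_
      split_ifs with h
      · rfl
      · exact mul_eq_zero_of_left (hE0 a b h) _
    rw [h1, ← Finset.sum_filter]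
    calc _ ≤ ((Finset.univ.filter (near a)).card : ℝ)
          * ∑ b ∈ Finset.univ.filter (near a), (E a b * x.ofLp b) ^ 2 := sq_sum_le_card_mul_sum_sq
      _ ≤ r * ∑ b ∈ Finset.univ.filter (near a), δ ^ 2 * x.ofLp b ^ 2 := by
        gcongr with b
        · exact hcard a
        · rw [mul_pow]
          exact mul_le_mul_of_nonneg_right
            (sq_le_sq' (neg_le_of_abs_le (hE a b)) (le_of_abs_le (hE a b))) (sq_nonneg _)
      _ = _ := by rw [← Finset.mul_sum]; ring
  calc _ ≤ ∑ a, r * δ ^ 2 * ∑ b, (if near a b then x.ofLp b ^ 2 else 0) :=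
        Finset.sum_le_sum fun a _ => hrow a
    _ = r * δ ^ 2 * ∑ b, ∑ a, (if near a b then x.ofLp b ^ 2 else 0) := by
        rw [← Finset.mul_sum, Finset.sum_comm]
    _ ≤ r * δ ^ 2 * ∑ b, r * x.ofLp b ^ 2 := by
        gcongr with b
        rw [← Finset.sum_filter, Finset.sum_const, nsmul_eq_mul]
        gcongr
        refine le_trans ?_ (hcard b)
        exact_mod_cast Finset.card_le_card fun a ha => by
          simp only [Finset.mem_filter, Finset.mem_univ, true_and] at ha ⊢
          exact hsymm _ _ ha
    _ = _ := by rw [← Finset.mul_sum]; ring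

end SpecNorm

/-! ### Plane geometry of slopes. -/

section Angle

/-- If the generalized eigenvalue of a point `(β, α)` of the open first quadrant at distance at
least `γ` from the origin moves across `ν` by a perturbation of size at most `ε`, it moves by an
angle of sine at most `ε / γ`. -/
lemma angle_bound {α β α' β' ν ε γ : ℝ} (hβ : 0 < β) (hα : 0 < α) (hβ' : 0 < β')
    (hε : 0 ≤ ε) (hεγ : ε < γ) (hdist : (α' - α) ^ 2 + (β' - β) ^ 2 ≤ ε ^ 2)
    (hγ : γ ^ 2 ≤ α ^ 2 + β ^ 2)
    (hcross : (α < ν * β ∧ ν * β' ≤ α' ∧ 0 < ν) ∨ (ν * β < α ∧ α' ≤ ν * β')) :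
    0 < β + ν * α ∧ |α - ν * β| * Real.sqrt (γ ^ 2 - ε ^ 2) ≤ ε * (β + ν * α) := by
  have hγε : 0 < γ ^ 2 - ε ^ 2 := by nlinarith
  have hpos : 0 < β + ν * α := by
    -- In the second case `ν` may be negative. If `β + ν α ≤ 0`, the two points have nonpositive
    -- inner product, which is impossible when they are closer than the norm of the first.
    rcases hcross with ⟨-, -, h⟩ | ⟨h1, h2⟩
    · positivity
    · by_contra hneg
      push Not at hneg
      have h3 : β * β' + α * α' ≤ 0 := by nlinarith
      nlinarith [sq_nonneg α', sq_nonneg β']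
  refine ⟨hpos, ?_⟩
  -- The two points lie on opposite sides of the line of slope `ν`, so the first is within `ε` of
  -- that line.
  have hd : (α - ν * β) ^ 2 ≤ ε ^ 2 * (1 + ν ^ 2) := by
    have h1 : (α - ν * β) ^ 2 ≤ ((α' - α) - ν * (β' - β)) ^ 2 := by
      rcases hcross with ⟨h1, h2, -⟩ | ⟨h1, h2⟩ <;> nlinarith
    have h2 : ((α' - α) - ν * (β' - β)) ^ 2 ≤ ((α' - α) ^ 2 + (β' - β) ^ 2) * (1 + ν ^ 2) := by
      nlinarith [sq_nonneg (ν * (α' - α) + (β' - β))]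
    nlinarith [sq_nonneg ν]
  -- Pythagoras for the components across and along the line turns the sine bound into a tangent
  -- bound.
  have hid : (α - ν * β) ^ 2 + (β + ν * α) ^ 2 = (1 + ν ^ 2) * (α ^ 2 + β ^ 2) := by ring
  refine abs_le_of_sq_le_sq' ?_ (by positivity) |>.2
  rw [mul_pow, sq_abs, Real.sq_sqrt hγε.le, mul_pow]
  nlinarith [sq_nonneg ν, sq_nonneg ε, mul_le_mul_of_nonneg_left hγ (by positivity : 0 ≤ (1 + ν ^ 2) * ε ^ 2)]

/-- The tangent of the angle to a fixed direction is monotone. -/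
lemma angle_mono {α β ν s t : ℝ} (hβ : 0 < β) (hα : 0 < α) (hs : 0 < s)
    (hpos : 0 < β + ν * α) (hb : |α - ν * β| ≤ t * (β + ν * α))
    (h : (s < ν ∧ α ≤ s * β) ∨ (ν < s ∧ s * β ≤ α)) : |s - ν| ≤ t * |1 + s * ν| := by
  have hpos' : 0 < 1 + s * ν := by
    rcases h with ⟨h1, -⟩ | ⟨h1, h2⟩
    · have : 0 < ν := hs.trans h1
      positivity
    · rcases le_or_gt 0 ν with h0 | h0
      · positivity
      · nlinarith
  rw [abs_of_pos hpos']
  -- `s` lies between the slope `α / β` and `ν`, and `|s - ν| / (1 + s ν)` is the tangent of the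
  -- angle between slopes `s` and `ν`.
  have key : |s - ν| * (β + ν * α) ≤ |α - ν * β| * (1 + s * ν) := by
    rcases h with ⟨h1, h2⟩ | ⟨h1, h2⟩
    · rw [abs_of_neg (by linarith), abs_of_neg (by nlinarith)]
      nlinarith [sq_nonneg ν]
    · rw [abs_of_pos (by linarith), abs_of_pos (by nlinarith)]
      nlinarith [sq_nonneg ν]
  refine le_of_mul_le_mul_right ?_ hpos
  calc _ ≤ _ := key
    _ ≤ t * (β + ν * α) * (1 + s * ν) := by gcongr
    _ = _ := by ring

end Angle

/-! ### Perturbation of definite pencils. -/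

section Perturbation

variable {N : ℕ}

/-- Courant–Fischer by counting: the eigenvectors of index at least `l` of one pencil and at most
`l` of the other number `2N + 1` in total, so their spans meet. -/
lemma IsPencilSpectrum.exists_test_vector {A B A' B' : Matrix (Fin N × Fin 2) (Fin N × Fin 2) ℝ}
    (hA : A.transpose = A) (hB : B.transpose = B) (hA' : A'.transpose = A')
    (hB' : B'.transpose = B') (hB0 : ∀ x, 0 ≤ x ⬝ᵥ B.mulVec x) (hB0' : ∀ x, 0 ≤ x ⬝ᵥ B'.mulVec x)
    {lam lam' : Fin (2 * N) → ℝ} (h : IsPencilSpectrum A B lam) (h' : IsPencilSpectrum A' B' lam')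
    (l : Fin (2 * N)) :
    ∃ x : EuclideanSpace ℝ (Fin N × Fin 2), ‖x‖ = 1 ∧
      x.ofLp ⬝ᵥ A.mulVec x.ofLp ≤ lam l * (x.ofLp ⬝ᵥ B.mulVec x.ofLp) ∧
      lam' l * (x.ofLp ⬝ᵥ B'.mulVec x.ofLp) ≤ x.ofLp ⬝ᵥ A'.mulVec x.ofLp := by
  obtain ⟨hanti, w, hw, hwe⟩ := h
  obtain ⟨hanti', w', hw', hwe'⟩ := h'
  obtain ⟨x, hx0, hx1, hx2⟩ := exists_ne_zero_mem_span_inter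
    (w := fun m : {m : Fin (2 * N) // m ∈ Finset.Ici l} => w m)
    (w' := fun m : {m : Fin (2 * N) // m ∈ Finset.Iic l} => w' m)
    (hw.comp _ Subtype.val_injective) (hw'.comp _ Subtype.val_injective) (by
      simp only [Fintype.card_prod, Fintype.card_fin, Fintype.card_coe, Fin.card_Ici, Fin.card_Iic]
      omega)
  have hne : (WithLp.toLp 2 x : EuclideanSpace ℝ (Fin N × Fin 2)) ≠ 0 := by
    intro h0
    exact hx0 (congrArg WithLp.ofLp h0)
  refine ⟨‖(WithLp.toLp 2 x : EuclideanSpace ℝ (Fin N × Fin 2))‖⁻¹ • WithLp.toLp 2 x,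
    ?_, ?_, ?_⟩
  · rw [norm_smul, norm_inv, norm_norm, inv_mul_cancel₀ (norm_ne_zero_iff.2 hne)]
  · exact pencil_form_le (w := fun m : {m : Fin (2 * N) // m ∈ Finset.Ici l} => w m)
      (μ := fun m => lam m) hA hB hB0 (fun m => hwe m) (fun m => hanti (Finset.mem_Ici.1 m.2))
      (Submodule.smul_mem _ _ hx1)
  · exact le_pencil_form (w := fun m : {m : Fin (2 * N) // m ∈ Finset.Iic l} => w' m)
      (μ := fun m => lam' m) hA' hB' hB0' (fun m => hwe' m)
      (fun m => hanti' (Finset.mem_Iic.1 m.2)) (Submodule.smul_mem _ _ hx2)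

lemma crawford_le {n : Type*} [Fintype n] (A B : Matrix n n ℝ) {x : EuclideanSpace ℝ n}
    (hx : ‖x‖ = 1) : crawford A B
      ≤ (x.ofLp ⬝ᵥ A.mulVec x.ofLp) ^ 2 + (x.ofLp ⬝ᵥ B.mulVec x.ofLp) ^ 2 := by
  refine csInf_le ⟨0, ?_⟩ ⟨x, by simpa using hx, rfl⟩
  rintro _ ⟨y, -, rfl⟩
  positivity

/-- Bounds the displacement of the planar point `(xᵀBx, xᵀAx)` under the perturbation. -/
lemma quadForm_sub_sq_le_pencilDist {n : Type*} [Fintype n] [DecidableEq n]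
    (A B A' B' : Matrix n n ℝ) {x : EuclideanSpace ℝ n} (hx : ‖x‖ = 1) :
    (x.ofLp ⬝ᵥ A'.mulVec x.ofLp - x.ofLp ⬝ᵥ A.mulVec x.ofLp) ^ 2
      + (x.ofLp ⬝ᵥ B'.mulVec x.ofLp - x.ofLp ⬝ᵥ B.mulVec x.ofLp) ^ 2
      ≤ pencilDist A B A' B' ^ 2 := by
  rw [pencilDist, Real.sq_sqrt (by positivity)]
  have h : ∀ E E' : Matrix n n ℝ, (x.ofLp ⬝ᵥ E'.mulVec x.ofLp - x.ofLp ⬝ᵥ E.mulVec x.ofLp) ^ 2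
      ≤ specNorm (E' - E) ^ 2 := by
    intro E E'
    have := abs_quadForm_le_specNorm (E' - E) x
    rw [hx, one_pow, mul_one, Matrix.sub_mulVec, dotProduct_sub] at this
    exact sq_le_sq' (neg_le_of_abs_le this) (le_of_abs_le this)
  exact add_le_add (h _ _) (h _ _)

/-- Perturbation bound for the eigenvalues of definite pencils. -/
lemma pencil_perturbation {A B A' B' : Matrix (Fin N × Fin 2) (Fin N × Fin 2) ℝ}
    (hA : A.PosDef) (hB : B.PosDef) (hA' : A'.transpose = A') (hB' : B'.PosDef)
    {lam lam' : Fin (2 * N) → ℝ} (h : IsPencilSpectrum A B lam) (h' : IsPencilSpectrum A' B' lam')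
    (hgap : pencilDist A B A' B' ^ 2 < crawford A B) (l : Fin (2 * N)) :
    |lam l - lam' l| ≤ pencilDist A B A' B'
      / Real.sqrt (crawford A B - pencilDist A B A' B' ^ 2) * |1 + lam l * lam' l| := by
  set ε := pencilDist A B A' B' with hε
  have hε0 : 0 ≤ ε := Real.sqrt_nonneg _
  have hs : 0 < Real.sqrt (crawford A B - ε ^ 2) := Real.sqrt_pos.2 (sub_pos.2 hgap)
  have hc0 : 0 ≤ crawford A B := (sq_nonneg _).trans hgap.le
  have symm : ∀ {C : Matrix (Fin N × Fin 2) (Fin N × Fin 2) ℝ}, C.PosDef → C.transpose = C :=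
    fun hC => by simpa using hC.1.eq
  have pos : ∀ {C : Matrix (Fin N × Fin 2) (Fin N × Fin 2) ℝ}, C.PosDef → ∀ x ≠ 0,
      0 < x ⬝ᵥ C.mulVec x := fun hC x hx => by simpa using hC.dotProduct_mulVec_pos hx
  have nonneg : ∀ {C : Matrix (Fin N × Fin 2) (Fin N × Fin 2) ℝ}, C.PosDef → ∀ x,
      0 ≤ x ⬝ᵥ C.mulVec x := fun hC x => by
    rcases eq_or_ne x 0 with rfl | hx
    · simp
    · exact (pos hC x hx).le
  have ne : ∀ {x : EuclideanSpace ℝ (Fin N × Fin 2)}, ‖x‖ = 1 → x.ofLp ≠ 0 := by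
    rintro x hx h0
    have : x = 0 := by ext i; exact congrFun h0 i
    simp [this] at hx
  -- Testing the pencil against itself gives a vector with positive Rayleigh quotient at most `lam
  -- l`.
  have lampos : 0 < lam l := by
    obtain ⟨x, hx, h1, -⟩ := h.exists_test_vector (symm hA) (symm hB) (symm hA) (symm hB)
      (nonneg hB) (nonneg hB) h l
    have := pos hA _ (ne hx)
    exact pos_of_mul_pos_left (this.trans_le h1) (nonneg hB _)
  have hsq : Real.sqrt (crawford A B) ^ 2 = crawford A B := Real.sq_sqrt hc0
  have hlt : ε < Real.sqrt (crawford A B) := Real.lt_sqrt_of_sq_lt hgap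
  -- The two orders of the eigenvalues differ only in the direction in which the point crosses the
  -- line of slope `lam' l`. No sign of `lam' l` is available in the second, since `A'` is only
  -- symmetric.
  have concl : ∀ {x : EuclideanSpace ℝ (Fin N × Fin 2)}, ‖x‖ = 1 →
      ((lam l < lam' l ∧ x.ofLp ⬝ᵥ A.mulVec x.ofLp ≤ lam l * (x.ofLp ⬝ᵥ B.mulVec x.ofLp) ∧
        lam' l * (x.ofLp ⬝ᵥ B'.mulVec x.ofLp) ≤ x.ofLp ⬝ᵥ A'.mulVec x.ofLp) ∨
      (lam' l < lam l ∧ lam l * (x.ofLp ⬝ᵥ B.mulVec x.ofLp) ≤ x.ofLp ⬝ᵥ A.mulVec x.ofLp ∧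
        x.ofLp ⬝ᵥ A'.mulVec x.ofLp ≤ lam' l * (x.ofLp ⬝ᵥ B'.mulVec x.ofLp))) →
      |lam l - lam' l| ≤ ε / Real.sqrt (crawford A B - ε ^ 2) * |1 + lam l * lam' l| := by
    intro x hx hcase
    have hα := pos hA _ (ne hx)
    have hβ := pos hB _ (ne hx)
    have hβ' := pos hB' _ (ne hx)
    have hang := angle_bound (ν := lam' l) hβ hα hβ' hε0 hlt
      (quadForm_sub_sq_le_pencilDist A B A' B' hx) (hsq.le.trans (crawford_le A B hx)) (by
        rcases hcase with ⟨h1, h2, h3⟩ | ⟨h1, h2, h3⟩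
        · exact Or.inl ⟨h2.trans_lt (by gcongr), h3, lampos.trans h1⟩
        · exact Or.inr ⟨lt_of_lt_of_le (by gcongr) h2, h3⟩)
    rw [hsq] at hang
    refine angle_mono hβ hα lampos hang.1 ?_ ?_
    · rw [div_mul_eq_mul_div, le_div_iff₀ hs]
      exact hang.2
    · rcases hcase with ⟨h1, h2, h3⟩ | ⟨h1, h2, h3⟩
      · exact Or.inl ⟨h1, h2⟩
      · exact Or.inr ⟨h1, h2⟩
  rcases lt_trichotomy (lam l) (lam' l) with hlt | heq | hlt
  · obtain ⟨x, hx, h1, h2⟩ := h.exists_test_vector (symm hA) (symm hB) hA' (symm hB')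
      (nonneg hB) (nonneg hB') h' l
    exact concl hx (Or.inl ⟨hlt, h1, h2⟩)
  · rw [heq, sub_self, abs_zero]
    positivity
  · obtain ⟨x, hx, h1, h2⟩ := h'.exists_test_vector hA' (symm hB') (symm hA) (symm hB)
      (nonneg hB') (nonneg hB) h l
    exact concl hx (Or.inr ⟨hlt, h2, h1⟩)

/-- The Crawford number is bounded below by the smallest eigenvalues of the two matrices. -/
lemma lt_crawford {A B : Matrix (Fin N × Fin 2) (Fin N × Fin 2) ℝ} (hA : A.PosDef) (hB : B.PosDef)
    {a b : Fin (2 * N) → ℝ} (ha : IsPencilSpectrum A 1 a) (hb : IsPencilSpectrum B 1 b)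
    (l : Fin (2 * N)) {s : ℝ} (hs : ∀ l, s < a l ^ 2 + b l ^ 2) : s < crawford A B := by
  have hN : 0 < 2 * N := l.pos
  -- The last index carries the smallest eigenvalue of both matrices; the gap is used only there.
  set m : Fin (2 * N) := ⟨2 * N - 1, by omega⟩ with hm
  have hmax : ∀ l : Fin (2 * N), l ≤ m := fun l => by
    rw [Fin.le_def]; simp only [hm]; omega
  have one0 : ∀ x : Fin N × Fin 2 → ℝ, 0 ≤ x ⬝ᵥ (1 : Matrix _ _ ℝ).mulVec x := fun x => by
    rw [Matrix.one_mulVec]; exact Finset.sum_nonneg fun i _ => mul_self_nonneg _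
  have key : ∀ {C : Matrix (Fin N × Fin 2) (Fin N × Fin 2) ℝ} {c : Fin (2 * N) → ℝ}, C.PosDef →
      IsPencilSpectrum C 1 c → 0 ≤ c m ∧ ∀ x : EuclideanSpace ℝ (Fin N × Fin 2), ‖x‖ = 1 →
        c m ≤ x.ofLp ⬝ᵥ C.mulVec x.ofLp := by
    intro C c hC hc
    have hCt : C.transpose = C := by simpa using hC.1.eq
    have hnn : ∀ x : EuclideanSpace ℝ (Fin N × Fin 2), ‖x‖ = 1 →
        x.ofLp ⬝ᵥ (1 : Matrix _ _ ℝ).mulVec x.ofLp = 1 := fun x hx => by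
      rw [Matrix.one_mulVec]
      have := EuclideanSpace.norm_sq_eq x
      rw [hx, one_pow] at this
      rw [this, dotProduct]
      exact Finset.sum_congr rfl fun i _ => by rw [Real.norm_eq_abs, sq_abs, sq]
    constructor
    · obtain ⟨x, hx, h1, -⟩ := hc.exists_test_vector hCt Matrix.transpose_one hCt
        Matrix.transpose_one one0 one0 hc m
      rw [hnn x hx, mul_one] at h1
      refine le_trans ?_ h1
      simpa using hC.posSemidef.dotProduct_mulVec_nonneg x.ofLp
    · intro x hx
      obtain ⟨hanti, w, hw, hwe⟩ := hc
      have htop : Submodule.span ℝ (Set.range w) = ⊤ :=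
        hw.span_eq_top_of_card_eq_finrank' (by simp [mul_comm])
      have := le_pencil_form hCt Matrix.transpose_one one0 hwe (fun l => hanti (hmax l))
        (x := x.ofLp) (by rw [htop]; trivial)
      rwa [hnn x hx, mul_one] at this
  obtain ⟨ha0, ha1⟩ := key hA ha
  obtain ⟨hb0, hb1⟩ := key hB hb
  refine (hs m).trans_le (le_csInf ?_ ?_)
  · have : Nonempty (Fin N × Fin 2) := ⟨(⟨0, by omega⟩, 0)⟩
    exact Set.Nonempty.image _ (NormedSpace.sphere_nonempty.2 zero_le_one)
  · rintro _ ⟨x, hx, rfl⟩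
    have hx' : ‖x‖ = 1 := by simpa using hx
    have := ha1 x hx'
    have := hb1 x hx'
    dsimp only
    gcongr

/-- The final form of the eigenvalue bound. -/
lemma pencil_perturbation_of_gap {A B A' B' : Matrix (Fin N × Fin 2) (Fin N × Fin 2) ℝ}
    (hA : A.PosDef) (hB : B.PosDef) (hA' : A'.transpose = A') (hB' : B'.PosDef)
    {a b lam lam' : Fin (2 * N) → ℝ} (ha : IsPencilSpectrum A 1 a) (hb : IsPencilSpectrum B 1 b)
    (h : IsPencilSpectrum A B lam) (h' : IsPencilSpectrum A' B' lam') {κ η : ℝ} (hκ : 1 ≤ κ)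
    (hcraw : crawford A B ≤ κ ^ 2 - 1) (hη : κ * pencilDist A B A' B' ≤ η)
    (hgap : ∀ l, η ^ 2 < a l ^ 2 + b l ^ 2) (l : Fin (2 * N)) :
    |lam l - lam' l| ≤ η / crawford A B * |1 + lam l * lam' l| := by
  set ε := pencilDist A B A' B' with hε
  have hε0 : 0 ≤ ε := Real.sqrt_nonneg _
  have hη2 : η ^ 2 < crawford A B := lt_crawford hA hB ha hb l hgap
  set γ := crawford A B
  have hκε : κ ^ 2 * ε ^ 2 < γ := by
    rw [← mul_pow]
    exact (pow_le_pow_left₀ (by positivity) hη 2).trans_lt hη2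
  have hεγ : ε ^ 2 < γ := lt_of_le_of_lt (by nlinarith [sq_nonneg ε]) hκε
  have hγ : 0 < γ := (sq_nonneg _).trans_lt hεγ
  have hs : 0 < Real.sqrt (γ - ε ^ 2) := Real.sqrt_pos.2 (sub_pos.2 hεγ)
  refine (pencil_perturbation hA hB hA' hB' h h' hεγ l).trans ?_
  refine mul_le_mul_of_nonneg_right ?_ (abs_nonneg _)
  rw [div_le_div_iff₀ hs hγ]
  -- After squaring: `γ ≤ κ² - 1` gives `κ² γ ≥ γ² + γ`, and `κ² ε² < γ` absorbs the remaining term.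
  have h1 : γ ≤ κ * Real.sqrt (γ - ε ^ 2) := by
    refine abs_le_of_sq_le_sq' ?_ (by positivity) |>.2
    rw [mul_pow, Real.sq_sqrt (sub_pos.2 hεγ).le]
    nlinarith
  calc ε * γ ≤ ε * (κ * Real.sqrt (γ - ε ^ 2)) := by gcongr
    _ = κ * ε * Real.sqrt (γ - ε ^ 2) := by ring
    _ ≤ _ := by gcongr

end Perturbation

/-! ### Propagation of relative errors of size `h`. -/

section CloseCalculus

open Asymptotics Filter

variable {ι : Type*} {l : Filter ι} {h : ι → ℝ}

/-- `f` and `f₀` have order `h ^ a` and differ by `O(h ^ (a + 1))`. -/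
structure Close (l : Filter ι) (h : ι → ℝ) (a : ℤ) (f f₀ : ι → ℝ) : Prop where
  left : f =O[l] fun x => h x ^ a
  right : f₀ =O[l] fun x => h x ^ a
  sub : (fun x => f x - f₀ x) =O[l] fun x => h x ^ (a + 1)

/-- The scale `h` takes values in `(0, 1]`. -/
def IsScale (l : Filter ι) (h : ι → ℝ) : Prop := ∀ᶠ x in l, 0 < h x ∧ h x ≤ 1

lemma IsScale.zpow_isBigO (hh : IsScale l h) {a b : ℤ} (hab : b ≤ a) :
    (fun x => h x ^ a) =O[l] fun x => h x ^ b := by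
  refine IsBigO.of_bound 1 (hh.mono fun x hx => ?_)
  rw [one_mul, Real.norm_of_nonneg (zpow_nonneg hx.1.le _),
    Real.norm_of_nonneg (zpow_nonneg hx.1.le _)]
  exact zpow_le_zpow_right_of_le_one₀ hx.1 hx.2 hab

lemma IsScale.zpow_add (hh : IsScale l h) (a b : ℤ) :
    (fun x => h x ^ a * h x ^ b) =ᶠ[l] fun x => h x ^ (a + b) :=
  hh.mono fun _ hx => (zpow_add₀ hx.1.ne' a b).symm

lemma IsScale.mul (hh : IsScale l h) {a b : ℤ} {f g : ι → ℝ}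
    (hf : f =O[l] fun x => h x ^ a) (hg : g =O[l] fun x => h x ^ b) :
    (fun x => f x * g x) =O[l] fun x => h x ^ (a + b) :=
  (hf.mul hg).trans_eventuallyEq (hh.zpow_add a b)

namespace Close

variable {a b : ℤ} {f f₀ g g₀ : ι → ℝ}

lemma refl (hf : f =O[l] fun x => h x ^ a) : Close l h a f f :=
  ⟨hf, hf, by simpa using isBigO_zero _ _⟩

/-- For derivatives of the flat metric, which vanish identically. -/
lemma zero_right (hh : IsScale l h) (hf : f =O[l] fun x => h x ^ (a + 1)) :
    Close l h a f fun _ => 0 :=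
  ⟨hf.trans (hh.zpow_isBigO (by omega)), isBigO_zero _ _, by simpa using hf⟩

lemma zero : Close l h a (fun _ => (0 : ℝ)) fun _ => 0 :=
  ⟨isBigO_zero _ _, isBigO_zero _ _, by simpa using isBigO_zero _ _⟩

lemma mk' (hh : IsScale l h) (h0 : f₀ =O[l] fun x => h x ^ a)
    (hs : (fun x => f x - f₀ x) =O[l] fun x => h x ^ (a + 1)) : Close l h a f f₀ := by
  refine ⟨?_, h0, hs⟩
  have := (hs.trans (hh.zpow_isBigO (by omega : a ≤ a + 1))).add h0
  simpa using this

lemma add (hf : Close l h a f f₀) (hg : Close l h a g g₀) :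
    Close l h a (fun x => f x + g x) fun x => f₀ x + g₀ x :=
  ⟨hf.left.add hg.left, hf.right.add hg.right,
    (hf.sub.add hg.sub).congr_left fun x => by ring⟩

lemma neg (hf : Close l h a f f₀) : Close l h a (fun x => - f x) fun x => - f₀ x :=
  ⟨hf.left.neg_left, hf.right.neg_left, hf.sub.neg_left.congr_left fun x => by ring⟩

lemma subtract (hf : Close l h a f f₀) (hg : Close l h a g g₀) :
    Close l h a (fun x => f x - g x) fun x => f₀ x - g₀ x := by
  simpa only [sub_eq_add_neg] using hf.add hg.neg

lemma mul (hh : IsScale l h) (hf : Close l h a f f₀) (hg : Close l h b g g₀) :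
    Close l h (a + b) (fun x => f x * g x) fun x => f₀ x * g₀ x := by
  refine ⟨hh.mul hf.left hg.left, hh.mul hf.right hg.right, ?_⟩
  have h1 := hh.mul hf.sub hg.left
  have h2 := hh.mul hf.right hg.sub
  rw [show a + 1 + b = a + b + 1 by ring] at h1
  rw [← add_assoc] at h2
  exact (h1.add h2).congr_left fun x => by ring

lemma const_mul (c : ℝ) (hf : Close l h a f f₀) :
    Close l h a (fun x => c * f x) fun x => c * f₀ x :=
  ⟨hf.left.const_mul_left c, hf.right.const_mul_left c,
    (hf.sub.const_mul_left c).congr_left fun x => by ring⟩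

lemma sum {κ : Type*} (s : Finset κ) {F F₀ : κ → ι → ℝ} (hF : ∀ k, Close l h a (F k) (F₀ k)) :
    Close l h a (fun x => ∑ k ∈ s, F k x) fun x => ∑ k ∈ s, F₀ k x := by
  classical
  induction s using Finset.induction_on with
  | empty => simpa using zero
  | insert k s hk ih => simpa only [Finset.sum_insert hk] using (hF k).add ih

/-- The difference of the reciprocals is `-(f - f₀) f⁻¹ f₀⁻¹`, and the lower bounds give each
reciprocal order `-a`. -/
lemma inv (hh : IsScale l h) (hf : Close l h a f f₀) (h1 : (fun x => h x ^ a) =O[l] f)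
    (h2 : (fun x => h x ^ a) =O[l] f₀) : Close l h (-a) (fun x => (f x)⁻¹) fun x => (f₀ x)⁻¹ := by
  have hz : ∀ᶠ x in l, h x ^ a ≠ 0 := hh.mono fun x hx => (zpow_pos hx.1 a).ne'
  have ne : ∀ {g : ι → ℝ}, (fun x => h x ^ a) =O[l] g → ∀ᶠ x in l, g x ≠ 0 := by
    intro g hg
    filter_upwards [hg.eq_zero_imp, hz] with x h3 h4 h5
    exact h4 (h3 h5)
  have inv' : ∀ {g : ι → ℝ}, (fun x => h x ^ a) =O[l] g →
      (fun x => (g x)⁻¹) =O[l] fun x => h x ^ (-a) := by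
    intro g hg
    have := hg.inv_rev (hz.mono fun x hx h0 => absurd h0 hx)
    simpa only [zpow_neg] using this
  refine ⟨inv' h1, inv' h2, ?_⟩
  have h3 := hh.mul (hh.mul hf.sub.neg_left (inv' h1)) (inv' h2)
  rw [show a + 1 + -a + -a = -a + 1 by ring] at h3
  refine h3.congr' ?_ EventuallyEq.rfl
  filter_upwards [ne h1, ne h2] with x hx1 hx2
  field_simp
  ring

/-- `√f - √f₀` is `f - f₀` divided by `√f + √f₀ ≥ √f₀`, so a lower bound on `f₀` alone suffices. -/
lemma sqrt (hh : IsScale l h) (hf : Close l h (a + a) f f₀) (h0 : ∀ᶠ x in l, 0 ≤ f x)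
    (h0' : ∀ᶠ x in l, 0 ≤ f₀ x) (h2 : (fun x => h x ^ (a + a)) =O[l] f₀) :
    Close l h a (fun x => Real.sqrt (f x)) fun x => Real.sqrt (f₀ x) := by
  have up : f₀ =O[l] (fun x => h x ^ (a + a)) →
      (fun x => Real.sqrt (f₀ x)) =O[l] fun x => h x ^ a := by
    intro hg
    obtain ⟨C, hC, hb⟩ := hg.exists_pos
    refine IsBigO.of_bound (Real.sqrt C) ?_
    filter_upwards [hb.bound, hh, h0'] with x h3 h4 h5
    have hp := zpow_pos h4.1 a
    rw [Real.norm_of_nonneg (Real.sqrt_nonneg _), Real.norm_of_nonneg hp.le]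
    rw [zpow_add₀ h4.1.ne', Real.norm_of_nonneg h5, Real.norm_of_nonneg (by positivity)] at h3
    calc _ ≤ Real.sqrt (C * (h x ^ a * h x ^ a)) := Real.sqrt_le_sqrt h3
      _ = _ := by rw [Real.sqrt_mul hC.le, Real.sqrt_mul_self hp.le]
  refine mk' hh (up hf.right) ?_
  obtain ⟨C, hC, hb⟩ := h2.exists_pos
  obtain ⟨C', hC', hb'⟩ := hf.sub.exists_pos
  refine IsBigO.of_bound (C' * Real.sqrt C) ?_
  filter_upwards [hb.bound, hb'.bound, hh, h0', h0] with x h3 h3' h4 h5 h5'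
  have hp := zpow_pos h4.1 a
  rw [zpow_add₀ h4.1.ne', zpow_one, Real.norm_of_nonneg (mul_pos hp h4.1).le]
  rw [zpow_add₀ h4.1.ne', Real.norm_of_nonneg h5, Real.norm_of_nonneg (by positivity)] at h3
  rw [zpow_add₀ h4.1.ne', zpow_add₀ h4.1.ne', zpow_one,
    Real.norm_of_nonneg (mul_pos (mul_pos hp hp) h4.1).le] at h3'
  have h6 : h x ^ a ≤ Real.sqrt C * Real.sqrt (f₀ x) := by
    rw [← Real.sqrt_mul hC.le]
    exact Real.le_sqrt_of_sq_le (by rw [sq]; exact h3)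
  have hpos : 0 < Real.sqrt (f₀ x) := by
    by_contra hn
    have : Real.sqrt (f₀ x) = 0 := le_antisymm (not_lt.1 hn) (Real.sqrt_nonneg _)
    rw [this, mul_zero] at h6
    linarith
  have h7 : ‖Real.sqrt (f x) - Real.sqrt (f₀ x)‖ * Real.sqrt (f₀ x) ≤ ‖f x - f₀ x‖ := by
    have : f x - f₀ x
        = (Real.sqrt (f x) - Real.sqrt (f₀ x)) * (Real.sqrt (f x) + Real.sqrt (f₀ x)) := by
      ring_nf; rw [Real.sq_sqrt h5, Real.sq_sqrt h5']
    rw [this, norm_mul, Real.norm_of_nonneg (by positivity : 0 ≤ √(f x) + √(f₀ x))]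
    gcongr
    linarith [Real.sqrt_nonneg (f x)]
  refine le_of_mul_le_mul_right ?_ hpos
  calc _ ≤ _ := h7
    _ ≤ _ := h3'
    _ = C' * h x ^ a * h x * h x ^ a := by ring
    _ ≤ C' * h x ^ a * h x * (Real.sqrt C * Real.sqrt (f₀ x)) := by
      have := h4.1
      gcongr
    _ = _ := by ring

end Close

/-- Entrywise closeness of the metric together with the scaling of its determinant. -/
structure MetricClose (l : Filter ι) (h : ι → ℝ) (G G₀ : ι → Matrix (Fin 2) (Fin 2) ℝ) : Prop where
  entry : ∀ k m, Close l h 2 (fun x => G x k m) fun x => G₀ x k m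
  det_nonneg : ∀ᶠ x in l, 0 ≤ (G x).det
  det_nonneg' : ∀ᶠ x in l, 0 ≤ (G₀ x).det
  det_lower : (fun x => h x ^ (4 : ℤ)) =O[l] fun x => (G x).det
  det_lower' : (fun x => h x ^ (4 : ℤ)) =O[l] fun x => (G₀ x).det

namespace MetricClose

variable {G G₀ : ι → Matrix (Fin 2) (Fin 2) ℝ}

lemma det (hh : IsScale l h) (hG : MetricClose l h G G₀) :
    Close l h 4 (fun x => (G x).det) fun x => (G₀ x).det := by
  simp only [Matrix.det_fin_two]
  exact ((hG.entry 0 0).mul hh (hG.entry 1 1)).subtract ((hG.entry 0 1).mul hh (hG.entry 1 0))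

/-- Adjugate over determinant, of orders `2` and `4`. -/
lemma inv (hh : IsScale l h) (hG : MetricClose l h G G₀) (k m : Fin 2) :
    Close l h (-2) (fun x => (G x)⁻¹ k m) fun x => (G₀ x)⁻¹ k m := by
  have hd := (hG.det hh).inv hh hG.det_lower hG.det_lower'
  have hadj : ∀ k m, Close l h 2 (fun x => (G x).adjugate k m) fun x => (G₀ x).adjugate k m := by
    intro k m
    simp only [Matrix.adjugate_fin_two]
    fin_cases k <;> fin_cases m
    · exact hG.entry 1 1
    · exact (hG.entry 0 1).neg
    · exact (hG.entry 1 0).neg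
    · exact hG.entry 0 0
  simp only [Matrix.inv_def, Ring.inverse_eq_inv', Matrix.smul_apply, smul_eq_mul]
  exact hd.mul hh (hadj k m)

lemma sqrt_det (hh : IsScale l h) (hG : MetricClose l h G G₀) :
    Close l h 2 (fun x => Real.sqrt (G x).det) fun x => Real.sqrt (G₀ x).det :=
  Close.sqrt hh (hG.det hh) hG.det_nonneg hG.det_nonneg' hG.det_lower'

end MetricClose

/-! ### Closeness of the Riemannian quantities -/

variable {Φ Φ₀ : ι → E2 → E3} {u : ι → E2} {V V₀ W W₀ : ι → Fin 2 → E2 → ℝ}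

/-- The parameters live on a triangle of unit size, so differentiation does not lower the order `2`
of the metric; it cancels the order `-2` of the inverse. -/
lemma christoffel_close (hh : IsScale l h)
    (hG : MetricClose l h (fun x => Param.metric (Φ x) (u x)) fun x => Param.metric (Φ₀ x) (u x))
    (hdG : ∀ m k n, Close l h 2 (fun x => Param.pd m (fun w => Param.metric (Φ x) w k n) (u x))
      fun x => Param.pd m (fun w => Param.metric (Φ₀ x) w k n) (u x)) (i p k : Fin 2) :
    Close l h 0 (fun x => Param.christoffel (Φ x) i p k (u x))
      fun x => Param.christoffel (Φ₀ x) i p k (u x) := by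
  unfold Param.christoffel
  exact (Close.sum _ fun m => (hG.inv hh i m).mul hh
    (((hdG k m p).add (hdG p m k)).subtract (hdG m p k))).const_mul _

lemma gradVec_close (hh : IsScale l h)
    (hG : MetricClose l h (fun x => Param.metric (Φ x) (u x)) fun x => Param.metric (Φ₀ x) (u x))
    (hdG : ∀ m k n, Close l h 2 (fun x => Param.pd m (fun w => Param.metric (Φ x) w k n) (u x))
      fun x => Param.pd m (fun w => Param.metric (Φ₀ x) w k n) (u x))
    (hV : ∀ q, Close l h (-1) (fun x => V x q (u x)) fun x => V₀ x q (u x))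
    (hdV : ∀ k q, Close l h (-1) (fun x => Param.pd k (V x q) (u x))
      fun x => Param.pd k (V₀ x q) (u x)) (i j : Fin 2) :
    Close l h (-3) (fun x => Param.gradVec (Φ x) (V x) (u x) i j)
      fun x => Param.gradVec (Φ₀ x) (V₀ x) (u x) i j := by
  simp only [Param.gradVec, Matrix.of_apply]
  exact Close.sum _ fun k => (hG.inv hh k j).mul hh ((hdV k i).add
    (Close.sum _ fun p => (hV p).mul hh (christoffel_close hh hG hdG i p k)))

/-- The orders add up to `-3 + 2 - 3 + 2 + 2 = 0`: the Dirichlet energy is scale invariant in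
dimension two. -/
lemma stiffness_integrand_close (hh : IsScale l h)
    (hG : MetricClose l h (fun x => Param.metric (Φ x) (u x)) fun x => Param.metric (Φ₀ x) (u x))
    (hdG : ∀ m k n, Close l h 2 (fun x => Param.pd m (fun w => Param.metric (Φ x) w k n) (u x))
      fun x => Param.pd m (fun w => Param.metric (Φ₀ x) w k n) (u x))
    (hV : ∀ q, Close l h (-1) (fun x => V x q (u x)) fun x => V₀ x q (u x))
    (hdV : ∀ k q, Close l h (-1) (fun x => Param.pd k (V x q) (u x))
      fun x => Param.pd k (V₀ x q) (u x))
    (hW : ∀ q, Close l h (-1) (fun x => W x q (u x)) fun x => W₀ x q (u x))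
    (hdW : ∀ k q, Close l h (-1) (fun x => Param.pd k (W x q) (u x))
      fun x => Param.pd k (W₀ x q) (u x)) :
    Close l h 0
      (fun x => Param.tensorInner (Φ x) (u x) (Param.gradVec (Φ x) (V x) (u x))
        (Param.gradVec (Φ x) (W x) (u x)) * Param.density (Φ x) (u x))
      (fun x => Param.tensorInner (Φ₀ x) (u x) (Param.gradVec (Φ₀ x) (V₀ x) (u x))
        (Param.gradVec (Φ₀ x) (W₀ x) (u x)) * Param.density (Φ₀ x) (u x)) := by
  have hA := gradVec_close hh hG hdG hV hdV
  have hB := gradVec_close hh hG hdG hW hdW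
  simp only [Param.tensorInner, Param.density, Matrix.trace, Matrix.diag_apply, Matrix.mul_apply,
    Matrix.transpose_apply]
  exact (Close.sum _ fun i => Close.sum _ fun j => (Close.sum _ fun k => (Close.sum _ fun m =>
    (hA i m).mul hh (hG.entry m k)).mul hh (hB j k)).mul hh (hG.entry j i)).mul hh (hG.sqrt_det hh)

lemma mass_integrand_close (hh : IsScale l h)
    (hG : MetricClose l h (fun x => Param.metric (Φ x) (u x)) fun x => Param.metric (Φ₀ x) (u x))
    (hV : ∀ q, Close l h (-1) (fun x => V x q (u x)) fun x => V₀ x q (u x))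
    (hW : ∀ q, Close l h (-1) (fun x => W x q (u x)) fun x => W₀ x q (u x)) :
    Close l h 2
      (fun x => Param.vecInner (Φ x) (V x) (W x) (u x) * Param.density (Φ x) (u x))
      (fun x => Param.vecInner (Φ₀ x) (V₀ x) (W₀ x) (u x) * Param.density (Φ₀ x) (u x)) := by
  simp only [Param.vecInner, Param.density]
  exact (Close.sum _ fun i => Close.sum _ fun j =>
    ((hV i).mul hh (hG.entry i j)).mul hh (hW j)).mul hh (hG.sqrt_det hh)

lemma lsCoeff_close (hh : IsScale l h) {w : ι → E2} {τ : ι → E3}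
    (hG : MetricClose l h (fun x => Param.metric (Φ x) (w x)) fun x => Param.metric (Φ₀ x) (w x))
    (hτ : ∀ q, Close l h 1 (fun x => inner ℝ (Param.pd q (Φ x) (w x)) (τ x))
      fun x => inner ℝ (Param.pd q (Φ₀ x) (w x)) (τ x)) (q : Fin 2) :
    Close l h (-1) (fun x => Param.lsCoeff (Φ x) (w x) (τ x) q)
      fun x => Param.lsCoeff (Φ₀ x) (w x) (τ x) q := by
  simp only [Param.lsCoeff, Matrix.mulVec, dotProduct]
  exact Close.sum _ fun p => (hG.inv hh q p).mul hh (hτ p)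

end CloseCalculus

/-! ### Graph patches over one triangle, against the flat patch. -/

section Element

open Asymptotics Filter Param

/-- The linear map `u ↦ u₀ J₀ + u₁ J₁`. -/
noncomputable def edgeMap (J : Fin 2 → E2) : E2 →L[ℝ] E2 :=
  (EuclideanSpace.proj 0 : E2 →L[ℝ] ℝ).smulRight (J 0)
    + (EuclideanSpace.proj 1 : E2 →L[ℝ] ℝ).smulRight (J 1)

lemma edgeMap_apply (J : Fin 2 → E2) (u : E2) : edgeMap J u = u 0 • J 0 + u 1 • J 1 := rfl

lemma edgeMap_single (J : Fin 2 → E2) (k : Fin 2) :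
    edgeMap J (EuclideanSpace.single k 1) = J k := by
  fin_cases k <;> simp [edgeMap_apply]

/-- The patch of a graph over the triangle with vertices `0, J₀, J₁`. -/
noncomputable def elementMap (t : OrthonormalBasis (Fin 3) ℝ E3) (x : E3) (f : E2 → ℝ)
    (J : Fin 2 → E2) (u : E2) : E3 := graphMap t x f (edgeMap J u)

variable (t : OrthonormalBasis (Fin 3) ℝ E3) (x : E3)

lemma hasFDerivAt_graphMap {f : E2 → ℝ} {f' : E2 →L[ℝ] ℝ} {v : E2} (hf : HasFDerivAt f f' v) :
    HasFDerivAt (graphMap t x f) ((EuclideanSpace.proj 0 : E2 →L[ℝ] ℝ).smulRight (t 0)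
      + (EuclideanSpace.proj 1 : E2 →L[ℝ] ℝ).smulRight (t 1) + f'.smulRight (t 2)) v := by
  unfold graphMap
  have h0 : HasFDerivAt (fun v : E2 => v 0) (EuclideanSpace.proj 0 : E2 →L[ℝ] ℝ) v :=
    (EuclideanSpace.proj 0 : E2 →L[ℝ] ℝ).hasFDerivAt
  have h1 : HasFDerivAt (fun v : E2 => v 1) (EuclideanSpace.proj 1 : E2 →L[ℝ] ℝ) v :=
    (EuclideanSpace.proj 1 : E2 →L[ℝ] ℝ).hasFDerivAt
  exact (((h0.smul_const (t 0)).const_add x).add (h1.smul_const (t 1))).add (hf.smul_const (t 2))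

lemma pd_elementMap {f : E2 → ℝ} {J : Fin 2 → E2} {u : E2}
    (hf : DifferentiableAt ℝ f (edgeMap J u)) (k : Fin 2) :
    pd k (elementMap t x f J) u
      = J k 0 • t 0 + J k 1 • t 1 + fderiv ℝ f (edgeMap J u) (J k) • t 2 := by
  have h := (hasFDerivAt_graphMap t x hf.hasFDerivAt).comp u (edgeMap J).hasFDerivAt
  unfold pd
  rw [show elementMap t x f J = graphMap t x f ∘ edgeMap J from rfl, h.fderiv]
  simp only [ContinuousLinearMap.comp_apply, edgeMap_single]
  rfl

lemma inner_frame (a b c a' b' c' : ℝ) :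
    inner ℝ (a • t 0 + b • t 1 + c • t 2) (a' • t 0 + b' • t 1 + c' • t 2)
      = a * a' + b * b' + c * c' := by
  have h := orthonormal_iff_ite.1 t.orthonormal
  simp only [inner_add_left, inner_add_right, real_inner_smul_left, real_inner_smul_right, h]
  simp
  ring

lemma metric_elementMap {f : E2 → ℝ} {J : Fin 2 → E2} {u : E2}
    (hf : DifferentiableAt ℝ f (edgeMap J u)) (k n : Fin 2) :
    metric (elementMap t x f J) u k n = J k 0 * J n 0 + J k 1 * J n 1
      + fderiv ℝ f (edgeMap J u) (J k) * fderiv ℝ f (edgeMap J u) (J n) := by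
  rw [metric, Matrix.of_apply, pd_elementMap t x hf, pd_elementMap t x hf, inner_frame]

lemma pd_metric_elementMap {f : E2 → ℝ} {J : Fin 2 → E2} {u : E2}
    (hf : ContDiffAt ℝ 2 f (edgeMap J u)) (m k n : Fin 2) :
    pd m (fun w => metric (elementMap t x f J) w k n) u
      = fderiv ℝ (fderiv ℝ f) (edgeMap J u) (J m) (J k) * fderiv ℝ f (edgeMap J u) (J n)
        + fderiv ℝ f (edgeMap J u) (J k) * fderiv ℝ (fderiv ℝ f) (edgeMap J u) (J m) (J n) := by
  have hev : (fun w => metric (elementMap t x f J) w k n) =ᶠ[nhds u] fun w =>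
      J k 0 * J n 0 + J k 1 * J n 1
        + fderiv ℝ f (edgeMap J w) (J k) * fderiv ℝ f (edgeMap J w) (J n) := by
    have h1 := (edgeMap J).continuous.continuousAt.eventually (hf.eventually (by simp))
    filter_upwards [h1] with w hw
    exact metric_elementMap t x (hw.differentiableAt (by simp)) k n
  have hd : HasFDerivAt (fderiv ℝ f) (fderiv ℝ (fderiv ℝ f) (edgeMap J u)) (edgeMap J u) :=
    ((hf.fderiv_right (m := 1) (by norm_num)).differentiableAt (by simp)).hasFDerivAt
  have hd' := hd.comp u (edgeMap J).hasFDerivAt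
  have happ : ∀ v : E2, HasFDerivAt (fun w => fderiv ℝ f (edgeMap J w) v)
      ((ContinuousLinearMap.apply ℝ ℝ v).comp
        ((fderiv ℝ (fderiv ℝ f) (edgeMap J u)).comp (edgeMap J))) u := fun v =>
    (ContinuousLinearMap.apply ℝ ℝ v).hasFDerivAt.comp u hd'
  have hfin := ((happ (J k)).fun_mul (happ (J n))).const_add (J k 0 * J n 0 + J k 1 * J n 1)
  unfold pd
  rw [hev.fderiv_eq, hfin.fderiv]
  simp [edgeMap_single]
  ring

/-- The data of a triangle and a height function on it, with a length scale `h`. -/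
structure ElementData where
  t : OrthonormalBasis (Fin 3) ℝ E3
  x : E3
  f : E2 → ℝ
  J : Fin 2 → E2
  h : ℝ

namespace ElementData

/-- The curved patch. -/
noncomputable def map (d : ElementData) : E2 → E3 := elementMap d.t d.x d.f d.J

/-- The flat patch in the tangent plane. -/
noncomputable def flat (d : ElementData) : E2 → E3 := elementMap d.t d.x (fun _ => 0) d.J

/-- Shape regularity of the triangle at scale `h` and flatness of the graph. -/
structure Admissible (K c : ℝ) (d : ElementData) : Prop where
  h_pos : 0 < d.h
  h_le : d.h ≤ 1
  edge_le : ∀ k, ‖d.J k‖ ≤ K * d.h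
  le_det : c * d.h ^ 4 ≤ (d.J 0 0 * d.J 1 1 - d.J 0 1 * d.J 1 0) ^ 2
  contDiffAt : ∀ u ∈ refTriangle, ContDiffAt ℝ 2 d.f (edgeMap d.J u)
  grad_le : ∀ u ∈ refTriangle, ‖fderiv ℝ d.f (edgeMap d.J u)‖ ≤ K * Real.sqrt d.h
  hess_le : ∀ u ∈ refTriangle, ‖fderiv ℝ (fderiv ℝ d.f) (edgeMap d.J u)‖ ≤ K

end ElementData

/-- A hat function `e`, an ambient vector `τ` and the vertex `w` to which it is attached. -/
structure NodalData where
  e : E2 → ℝ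
  w : E2
  τ : E3

namespace NodalData

/-- Components of the nodal vector field on the patch `Φ`. -/
noncomputable def field (n : NodalData) (Φ : E2 → E3) : Fin 2 → E2 → ℝ :=
  fun q u => n.e u * lsCoeff Φ n.w n.τ q

/-- Bounds for the hat function, and near-tangency of the ambient vector. -/
structure Admissible (K : ℝ) (d : ElementData) (n : NodalData) : Prop where
  mem : n.w ∈ refTriangle
  norm_le : ‖n.τ‖ ≤ 1
  normal_le : |inner ℝ (d.t 2) n.τ| ≤ K * Real.sqrt d.h
  measurable : Measurable n.e
  differentiableAt : ∀ u ∈ refTriangle, DifferentiableAt ℝ n.e u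
  abs_le : ∀ u ∈ refTriangle, |n.e u| ≤ 1
  pd_le : ∀ u ∈ refTriangle, ∀ k, |pd k n.e u| ≤ 1

lemma pd_field {n : NodalData} {u : E2} (hn : DifferentiableAt ℝ n.e u) (Φ : E2 → E3)
    (k q : Fin 2) : pd k (n.field Φ q) u = pd k n.e u * lsCoeff Φ n.w n.τ q := by
  unfold pd field
  rw [(hn.hasFDerivAt.mul_const _).fderiv]
  simp [mul_comm]

lemma measurable_field {n : NodalData} (hn : Measurable n.e) (Φ : E2 → E3) (q : Fin 2) :
    Measurable (n.field Φ q) := hn.mul_const _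

end NodalData

/-- On a principal filter `O` means one bound on the whole set; this makes the constants depend only
on the class of data. -/
lemma isBigO_principal_zpow {ι : Type*} {S : Set ι} {h f : ι → ℝ} (hh : ∀ x ∈ S, 0 < h x) {a : ℤ}
    (C : ℝ) (hf : ∀ x ∈ S, |f x| ≤ C * h x ^ a) : f =O[𝓟 S] fun x => h x ^ a :=
  isBigO_principal.2 ⟨C, fun x hx => by
    rw [Real.norm_of_nonneg (zpow_nonneg (hh x hx).le a)]; exact hf x hx⟩

section Families

variable {ι : Type*} {S : Set ι} {d : ι → ElementData} {K c : ℝ}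

lemma isScale_of_admissible (hd : ∀ y ∈ S, (d y).Admissible K c) :
    IsScale (𝓟 S) fun y => (d y).h :=
  eventually_principal.2 fun y hy => ⟨(hd y hy).h_pos, (hd y hy).h_le⟩

namespace ElementData.Admissible

variable {d : ElementData}

lemma grad_edge_le (hd : d.Admissible K c) (hK : 0 ≤ K) {u : E2} (hu : u ∈ refTriangle)
    (k : Fin 2) : |fderiv ℝ d.f (edgeMap d.J u) (d.J k)| ≤ K ^ 2 * (Real.sqrt d.h * d.h) := by
  have h0 := hd.h_pos.le
  calc _ ≤ ‖fderiv ℝ d.f (edgeMap d.J u)‖ * ‖d.J k‖ := ContinuousLinearMap.le_opNorm _ _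
    _ ≤ (K * Real.sqrt d.h) * (K * d.h) := by
      gcongr
      exacts [hd.grad_le u hu, hd.edge_le k]
    _ = _ := by ring

lemma hess_edge_le (hd : d.Admissible K c) (hK : 0 ≤ K) {u : E2} (hu : u ∈ refTriangle)
    (m k : Fin 2) : |fderiv ℝ (fderiv ℝ d.f) (edgeMap d.J u) (d.J m) (d.J k)|
      ≤ K ^ 3 * d.h ^ 2 := by
  have h0 := hd.h_pos.le
  calc _ ≤ ‖fderiv ℝ (fderiv ℝ d.f) (edgeMap d.J u)‖ * ‖d.J m‖ * ‖d.J k‖ :=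
        ContinuousLinearMap.le_opNorm₂ _ _ _
    _ ≤ K * (K * d.h) * (K * d.h) := by
      gcongr
      exacts [hd.hess_le u hu, hd.edge_le m, hd.edge_le k]
    _ = _ := by ring

lemma abs_edge_le (hd : d.Admissible K c) (k i : Fin 2) : |d.J k i| ≤ K * d.h :=
  (PiLp.norm_apply_le (d.J k) i).trans (hd.edge_le k)

lemma metric_flat (d : ElementData) (u : E2) (k n : Fin 2) :
    metric d.flat u k n = d.J k 0 * d.J n 0 + d.J k 1 * d.J n 1 := by
  rw [ElementData.flat, metric_elementMap _ _ (by fun_prop)]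
  simp

lemma metric_map (hd : d.Admissible K c) {u : E2} (hu : u ∈ refTriangle) (k n : Fin 2) :
    metric d.map u k n = d.J k 0 * d.J n 0 + d.J k 1 * d.J n 1
      + fderiv ℝ d.f (edgeMap d.J u) (d.J k) * fderiv ℝ d.f (edgeMap d.J u) (d.J n) :=
  metric_elementMap _ _ ((hd.contDiffAt u hu).differentiableAt (by simp)) _ _

lemma le_det_flat (hd : d.Admissible K c) (u : E2) : c * d.h ^ 4 ≤ (metric d.flat u).det := by
  rw [Matrix.det_fin_two]
  simp only [metric_flat]
  linear_combination hd.le_det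

/-- The slope terms add two squares to the flat determinant: a graph has at least the area of its
projection. -/
lemma le_det_map (hd : d.Admissible K c) {u : E2} (hu : u ∈ refTriangle) :
    c * d.h ^ 4 ≤ (metric d.map u).det := by
  rw [Matrix.det_fin_two]
  simp only [hd.metric_map hu]
  set p := fderiv ℝ d.f (edgeMap d.J u) (d.J 0)
  set q := fderiv ℝ d.f (edgeMap d.J u) (d.J 1)
  linear_combination hd.le_det + sq_nonneg (d.J 0 0 * q - p * d.J 1 0)
    + sq_nonneg (d.J 0 1 * q - p * d.J 1 1)

end ElementData.Admissible

open ElementData.Admissible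

/-- The correction is a product of two edge slopes, each `O(h^{3/2})`; their two factors `√h`
combine to the full `h` gained over the order `h²`. -/
lemma metricClose_of_admissible (hd : ∀ y ∈ S, (d y).Admissible K c) (hK : 0 ≤ K) (hc : 0 < c)
    {u : ι → E2} (hu : ∀ y ∈ S, u y ∈ refTriangle) :
    MetricClose (𝓟 S) (fun y => (d y).h) (fun y => metric (d y).map (u y))
      fun y => metric (d y).flat (u y) := by
  have hpos : ∀ y ∈ S, 0 < (d y).h := fun y hy => (hd y hy).h_pos
  have low : ∀ {F : ι → ℝ}, (∀ y ∈ S, c * (d y).h ^ 4 ≤ F y) →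
      (fun y => (d y).h ^ (4 : ℤ)) =O[𝓟 S] F := by
    intro F hF
    refine isBigO_principal.2 ⟨c⁻¹, fun y hy => ?_⟩
    have h1 := hF y hy
    have h2 := pow_pos (hpos y hy) 4
    rw [show (d y).h ^ (4 : ℤ) = (d y).h ^ 4 from zpow_natCast _ 4, Real.norm_of_nonneg h2.le,
      Real.norm_of_nonneg ((by positivity : 0 ≤ c * (d y).h ^ 4).trans h1), ← div_eq_inv_mul,
      le_div_iff₀ hc]
    linarith
  have nonneg : ∀ {F : ι → ℝ}, (∀ y ∈ S, c * (d y).h ^ 4 ≤ F y) → ∀ᶠ y in 𝓟 S, 0 ≤ F y :=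
    fun hF => eventually_principal.2 fun y hy =>
      (by have := hpos y hy; positivity : 0 ≤ c * (d y).h ^ 4).trans (hF y hy)
  refine ⟨fun k m => Close.mk' (isScale_of_admissible hd) ?_ ?_,
    nonneg fun y hy => (hd y hy).le_det_map (hu y hy), nonneg fun y hy => (hd y hy).le_det_flat _,
    low fun y hy => (hd y hy).le_det_map (hu y hy), low fun y hy => (hd y hy).le_det_flat _⟩
  · refine isBigO_principal_zpow hpos (2 * K ^ 2) fun y hy => ?_
    have h0 := (hpos y hy).le
    have hprod : ∀ i, |(d y).J k i * (d y).J m i| ≤ (K * (d y).h) * (K * (d y).h) := fun i => by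
      rw [abs_mul]
      gcongr
      exacts [(hd y hy).abs_edge_le k i, (hd y hy).abs_edge_le m i]
    rw [metric_flat, show (d y).h ^ (2 : ℤ) = (d y).h ^ 2 from zpow_natCast _ 2]
    refine (abs_add_le _ _).trans ((add_le_add (hprod 0) (hprod 1)).trans_eq (by ring))
  · refine isBigO_principal_zpow hpos (K ^ 4) fun y hy => ?_
    have h0 := (hpos y hy).le
    rw [(hd y hy).metric_map (hu y hy), metric_flat, add_sub_cancel_left, abs_mul,
      show (d y).h ^ (2 + 1 : ℤ) = (d y).h ^ 3 from zpow_natCast _ 3]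
    calc _ ≤ (K ^ 2 * (Real.sqrt (d y).h * (d y).h)) * (K ^ 2 * (Real.sqrt (d y).h * (d y).h)) := by
          gcongr
          exacts [(hd y hy).grad_edge_le hK (hu y hy) k, (hd y hy).grad_edge_le hK (hu y hy) m]
      _ = K ^ 4 * (Real.sqrt (d y).h * Real.sqrt (d y).h) * (d y).h ^ 2 := by ring
      _ = _ := by rw [Real.mul_self_sqrt h0]; ring

/-- The flat metric is constant. The other derivative is a sum of second edge derivatives `O(h²)`
times edge slopes, for which `O(h)` is enough here. -/
lemma pd_metric_close_of_admissible (hd : ∀ y ∈ S, (d y).Admissible K c) (hK : 0 ≤ K)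
    {u : ι → E2} (hu : ∀ y ∈ S, u y ∈ refTriangle) (m k n : Fin 2) :
    Close (𝓟 S) (fun y => (d y).h) 2 (fun y => pd m (fun w => metric (d y).map w k n) (u y))
      fun y => pd m (fun w => metric (d y).flat w k n) (u y) := by
  have hflat : (fun y => pd m (fun w => metric (d y).flat w k n) (u y)) = fun _ => 0 := by
    funext y
    simp only [metric_flat, pd]
    simp
  rw [hflat]
  refine Close.zero_right (isScale_of_admissible hd) ?_
  refine isBigO_principal_zpow (fun y hy => (hd y hy).h_pos) (2 * K ^ 5) fun y hy => ?_
  have h0 := (hd y hy).h_pos.le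
  have h1 : Real.sqrt (d y).h ≤ 1 := Real.sqrt_le_one.2 (hd y hy).h_le
  rw [ElementData.map, pd_metric_elementMap _ _ ((hd y hy).contDiffAt _ (hu y hy)),
    show (d y).h ^ (2 + 1 : ℤ) = (d y).h ^ 3 from zpow_natCast _ 3]
  have hprod : ∀ i j, |fderiv ℝ (fderiv ℝ (d y).f) (edgeMap (d y).J (u y)) ((d y).J m) ((d y).J i)
      * fderiv ℝ (d y).f (edgeMap (d y).J (u y)) ((d y).J j)| ≤ K ^ 5 * (d y).h ^ 3 := by
    intro i j
    rw [abs_mul]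
    calc _ ≤ (K ^ 3 * (d y).h ^ 2) * (K ^ 2 * (1 * (d y).h)) := by
          gcongr
          · exact (hd y hy).hess_edge_le hK (hu y hy) m i
          · exact ((hd y hy).grad_edge_le hK (hu y hy) j).trans (by gcongr)
      _ = _ := by ring
  refine (abs_add_le _ _).trans ?_
  rw [mul_comm (fderiv ℝ (d y).f _ _)]
  linarith [hprod k n, hprod n k]

/-- The two tangent vectors differ only in the normal direction, by an edge slope `O(h^{3/2})`, and
`τ` has normal component `O(√h)`. -/
lemma inner_pd_close_of_admissible (hd : ∀ y ∈ S, (d y).Admissible K c) (hK : 0 ≤ K)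
    {n : ι → NodalData} (hn : ∀ y ∈ S, (n y).Admissible K (d y)) (q : Fin 2) :
    Close (𝓟 S) (fun y => (d y).h) 1 (fun y => inner ℝ (pd q (d y).map (n y).w) (n y).τ)
      fun y => inner ℝ (pd q (d y).flat (n y).w) (n y).τ := by
  have hpos : ∀ y ∈ S, 0 < (d y).h := fun y hy => (hd y hy).h_pos
  have hflat : ∀ y, pd q (d y).flat (n y).w = (d y).J q 0 • (d y).t 0 + (d y).J q 1 • (d y).t 1 := by
    intro y
    rw [ElementData.flat, pd_elementMap _ _ (by fun_prop)]
    simp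
  refine Close.mk' (isScale_of_admissible hd) ?_ ?_
  · refine isBigO_principal_zpow hpos (2 * K) fun y hy => ?_
    have h0 := (hpos y hy).le
    have hunit : ∀ i, |inner ℝ ((d y).t i) (n y).τ| ≤ 1 := fun i =>
      (abs_real_inner_le_norm _ _).trans (by
        rw [(d y).t.orthonormal.1 i, one_mul]; exact (hn y hy).norm_le)
    have hprod : ∀ i j, |(d y).J q i * inner ℝ ((d y).t j) (n y).τ| ≤ (K * (d y).h) * 1 :=
      fun i j => by
        rw [abs_mul]
        gcongr
        exacts [(hd y hy).abs_edge_le q i, hunit j]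
    rw [hflat, inner_add_left, real_inner_smul_left, real_inner_smul_left, zpow_one]
    exact (abs_add_le _ _).trans ((add_le_add (hprod 0 0) (hprod 1 1)).trans_eq (by ring))
  · refine isBigO_principal_zpow hpos (K ^ 3) fun y hy => ?_
    have h0 := (hpos y hy).le
    rw [hflat, ElementData.map, pd_elementMap _ _
      (((hd y hy).contDiffAt _ (hn y hy).mem).differentiableAt (by simp)), inner_add_left,
      add_sub_cancel_left, real_inner_smul_left, abs_mul,
      show (d y).h ^ (1 + 1 : ℤ) = (d y).h ^ 2 from zpow_natCast _ 2]
    calc _ ≤ (K ^ 2 * (Real.sqrt (d y).h * (d y).h)) * (K * Real.sqrt (d y).h) := by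
          gcongr
          exacts [(hd y hy).grad_edge_le hK (hn y hy).mem q, (hn y hy).normal_le]
      _ = K ^ 3 * (Real.sqrt (d y).h * Real.sqrt (d y).h) * (d y).h := by ring
      _ = _ := by rw [Real.mul_self_sqrt h0]; ring

lemma field_close_of_admissible (hd : ∀ y ∈ S, (d y).Admissible K c) (hK : 0 ≤ K) (hc : 0 < c)
    {n : ι → NodalData} (hn : ∀ y ∈ S, (n y).Admissible K (d y)) {u : ι → E2}
    (hu : ∀ y ∈ S, u y ∈ refTriangle) :
    (∀ q, Close (𝓟 S) (fun y => (d y).h) (-1) (fun y => (n y).field (d y).map q (u y))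
      fun y => (n y).field (d y).flat q (u y)) ∧
    ∀ k q, Close (𝓟 S) (fun y => (d y).h) (-1) (fun y => pd k ((n y).field (d y).map q) (u y))
      fun y => pd k ((n y).field (d y).flat q) (u y) := by
  have hh := isScale_of_admissible hd
  have hls := fun q => lsCoeff_close hh
    (metricClose_of_admissible hd hK hc fun y hy => (hn y hy).mem)
    (fun q => inner_pd_close_of_admissible hd hK hn q) q
  have one : ∀ {F : ι → ℝ}, (∀ y ∈ S, |F y| ≤ 1) → Close (𝓟 S) (fun y => (d y).h) 0 F F :=
    fun hF => Close.refl (isBigO_principal_zpow (fun y hy => (hd y hy).h_pos) 1 fun y hy => by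
      simpa using hF y hy)
  constructor
  · intro q
    exact (one fun y hy => (hn y hy).abs_le _ (hu y hy)).mul hh (hls q)
  · intro k q
    have h := (one fun y hy => (hn y hy).pd_le _ (hu y hy) k).mul hh (hls q)
    have e : ∀ {F G F' G' : ι → ℝ} {a : ℤ}, (∀ y ∈ S, F y = F' y) → (∀ y ∈ S, G y = G' y) →
        Close (𝓟 S) (fun y => (d y).h) a F G → Close (𝓟 S) (fun y => (d y).h) a F' G' := by
      intro F G F' G' a h1 h2 hc
      have h1' : F =ᶠ[𝓟 S] F' := eventually_principal.2 h1
      have h2' : G =ᶠ[𝓟 S] G' := eventually_principal.2 h2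
      exact ⟨hc.left.congr' h1' .rfl, hc.right.congr' h2' .rfl, hc.sub.congr' (h1'.sub h2') .rfl⟩
    exact e (fun y hy => (NodalData.pd_field ((hn y hy).differentiableAt _ (hu y hy)) _ k q).symm)
      (fun y hy => (NodalData.pd_field ((hn y hy).differentiableAt _ (hu y hy)) _ k q).symm) h

end Families

end Element

/-! ### Integrals over the reference triangle. -/

section ElementIntegrals

open Asymptotics Filter Param MeasureTheory

lemma isClosed_refTriangle : IsClosed refTriangle := by
  have h : ∀ i, Continuous fun u : E2 => u i := fun i => by fun_prop
  exact (isClosed_le continuous_const (h 0)).inter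
    ((isClosed_le continuous_const (h 1)).inter (isClosed_le ((h 0).add (h 1)) continuous_const))

lemma norm_le_of_mem_refTriangle {u : E2} (hu : u ∈ refTriangle) : ‖u‖ ≤ 1 := by
  obtain ⟨h0, h1, h2⟩ := hu
  refine abs_le_of_sq_le_sq' ?_ zero_le_one |>.2
  rw [EuclideanSpace.norm_sq_eq, Fin.sum_univ_two]
  simp only [Real.norm_eq_abs, sq_abs]
  nlinarith [mul_nonneg h0 h1]

lemma volume_refTriangle_lt_top : volume refTriangle < ⊤ :=
  (measure_mono fun _ hu => mem_closedBall_zero_iff.2 (norm_le_of_mem_refTriangle hu)).trans_lt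
    measure_closedBall_lt_top

/-- No differentiability is needed. The integrands are thus measurable on the whole plane although
the exact heights are smooth only on a disc. -/
lemma measurable_pd {f : E2 → E3} (k : Fin 2) : Measurable (pd k f) :=
  measurable_fderiv_apply_const ℝ f _

lemma measurable_pd_real {f : E2 → ℝ} (k : Fin 2) : Measurable (pd k f) :=
  measurable_fderiv_apply_const ℝ f _

lemma measurable_metric (Φ : E2 → E3) (k n : Fin 2) : Measurable fun u => metric Φ u k n := by
  simp only [metric, Matrix.of_apply]
  exact (measurable_pd k).inner (measurable_pd n)

lemma measurable_metric_det (Φ : E2 → E3) : Measurable fun u => (metric Φ u).det := by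
  simp only [Matrix.det_fin_two]
  exact ((measurable_metric Φ 0 0).mul (measurable_metric Φ 1 1)).sub
    ((measurable_metric Φ 0 1).mul (measurable_metric Φ 1 0))

lemma measurable_metric_inv (Φ : E2 → E3) (k n : Fin 2) :
    Measurable fun u => (metric Φ u)⁻¹ k n := by
  simp only [Matrix.inv_def, Ring.inverse_eq_inv', Matrix.smul_apply, smul_eq_mul,
    Matrix.adjugate_fin_two]
  refine (measurable_metric_det Φ).inv.mul ?_
  fin_cases k <;> fin_cases n
  · exact measurable_metric Φ 1 1
  · exact (measurable_metric Φ 0 1).neg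
  · exact (measurable_metric Φ 1 0).neg
  · exact measurable_metric Φ 0 0

lemma measurable_christoffel (Φ : E2 → E3) (i p k : Fin 2) : Measurable (christoffel Φ i p k) := by
  unfold christoffel
  exact (Finset.measurable_sum _ fun m _ => (measurable_metric_inv Φ i m).mul
    (((measurable_pd_real k).add (measurable_pd_real p)).sub (measurable_pd_real m))).const_mul _

lemma measurable_gradVec (Φ : E2 → E3) {V : Fin 2 → E2 → ℝ} (hV : ∀ q, Measurable (V q))
    (i j : Fin 2) : Measurable fun u => gradVec Φ V u i j := by
  simp only [gradVec, Matrix.of_apply]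
  exact Finset.measurable_sum _ fun k _ => (measurable_metric_inv Φ k j).mul
    ((measurable_pd_real k).add
      (Finset.measurable_sum _ fun p _ => (hV p).mul (measurable_christoffel Φ i p k)))

lemma measurable_density (Φ : E2 → E3) : Measurable (density Φ) :=
  (measurable_metric_det Φ).sqrt

lemma measurable_stiffness_integrand (Φ : E2 → E3) {V W : Fin 2 → E2 → ℝ}
    (hV : ∀ q, Measurable (V q)) (hW : ∀ q, Measurable (W q)) :
    Measurable fun u => tensorInner Φ u (gradVec Φ V u) (gradVec Φ W u) * density Φ u := by
  simp only [tensorInner, Matrix.trace, Matrix.diag_apply, Matrix.mul_apply, Matrix.transpose_apply]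
  exact (Finset.measurable_sum _ fun i _ => Finset.measurable_sum _ fun j _ =>
    (Finset.measurable_sum _ fun k _ => (Finset.measurable_sum _ fun m _ =>
      (measurable_gradVec Φ hV i m).mul (measurable_metric Φ m k)).mul
        (measurable_gradVec Φ hW j k)).mul (measurable_metric Φ j i)).mul (measurable_density Φ)

lemma measurable_mass_integrand (Φ : E2 → E3) {V W : Fin 2 → E2 → ℝ}
    (hV : ∀ q, Measurable (V q)) (hW : ∀ q, Measurable (W q)) :
    Measurable fun u => vecInner Φ V W u * density Φ u := by
  simp only [vecInner]
  exact (Finset.measurable_sum _ fun i _ => Finset.measurable_sum _ fun j _ =>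
    ((hV i).mul (measurable_metric Φ i j)).mul (hW j)).mul (measurable_density Φ)

/-- The stiffness density of two nodal fields on a patch. -/
noncomputable def stiffnessIntegrand (Φ : E2 → E3) (n n' : NodalData) (u : E2) : ℝ :=
  tensorInner Φ u (gradVec Φ (n.field Φ) u) (gradVec Φ (n'.field Φ) u) * density Φ u

/-- The mass density of two nodal fields on a patch. -/
noncomputable def massIntegrand (Φ : E2 → E3) (n n' : NodalData) (u : E2) : ℝ :=
  vecInner Φ (n.field Φ) (n'.field Φ) u * density Φ u

/-- The stiffness integral of two nodal fields over a patch. -/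
noncomputable def stiffnessIntegral (Φ : E2 → E3) (n n' : NodalData) : ℝ :=
  ∫ u in refTriangle, stiffnessIntegrand Φ n n' u

/-- The mass integral of two nodal fields over a patch. -/
noncomputable def massIntegral (Φ : E2 → E3) (n n' : NodalData) : ℝ :=
  ∫ u in refTriangle, massIntegrand Φ n n' u

lemma abs_setIntegral_refTriangle_le {F : E2 → ℝ} {C : ℝ} (hF : ∀ u ∈ refTriangle, |F u| ≤ C) :
    |∫ u in refTriangle, F u| ≤ C * volume.real refTriangle :=
  norm_setIntegral_le_of_norm_le_const (f := F) volume_refTriangle_lt_top hF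

lemma integrableOn_refTriangle {F : E2 → ℝ} (hm : Measurable F) {C : ℝ}
    (hF : ∀ u ∈ refTriangle, |F u| ≤ C) : IntegrableOn F refTriangle :=
  Measure.integrableOn_of_bounded volume_refTriangle_lt_top.ne hm.aestronglyMeasurable
    (ae_restrict_of_forall_mem isClosed_refTriangle.measurableSet hF)

/-- An admissible element with two nodal fields and a parameter in the reference triangle. -/
def admissibleSet (K c : ℝ) : Set (ElementData × NodalData × NodalData × E2) :=
  {y | y.1.Admissible K c ∧ y.2.1.Admissible K y.1 ∧ y.2.2.1.Admissible K y.1 ∧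
    y.2.2.2 ∈ refTriangle}

/-- Turns the estimate over the class of admissible data into one constant. Measurability makes both
integrands integrable, so the integrals may be subtracted. -/
lemma integral_close {K c : ℝ} {F F₀ : ElementData → NodalData → NodalData → E2 → ℝ}
    (hF : Close (𝓟 (admissibleSet K c)) (fun y => y.1.h) 0
      (fun y => F y.1 y.2.1 y.2.2.1 y.2.2.2) fun y => F₀ y.1 y.2.1 y.2.2.1 y.2.2.2)
    (hm : ∀ d n n', n.Admissible K d → n'.Admissible K d →
      Measurable (F d n n') ∧ Measurable (F₀ d n n')) :
    ∃ C, 0 ≤ C ∧ ∀ d n n', d.Admissible K c → n.Admissible K d → n'.Admissible K d →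
      |(∫ u in refTriangle, F d n n' u) - ∫ u in refTriangle, F₀ d n n' u| ≤ C * d.h ∧
      |∫ u in refTriangle, F d n n' u| ≤ C := by
  obtain ⟨C₁, h₁⟩ := isBigO_principal.1 hF.left
  obtain ⟨C₂, h₂⟩ := isBigO_principal.1 hF.right
  obtain ⟨C₃, h₃⟩ := isBigO_principal.1 hF.sub
  simp only [zpow_zero, norm_one, mul_one, zero_add, zpow_one] at h₁ h₂ h₃
  refine ⟨max |C₁| |C₃| * volume.real refTriangle, by positivity, fun d n n' hd hn hn' => ?_⟩
  have hv : 0 ≤ volume.real refTriangle := measureReal_nonneg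
  have b₁ : ∀ u ∈ refTriangle, |F d n n' u| ≤ C₁ := fun u hu => h₁ (d, n, n', u) ⟨hd, hn, hn', hu⟩
  have b₂ : ∀ u ∈ refTriangle, |F₀ d n n' u| ≤ C₂ := fun u hu => h₂ (d, n, n', u) ⟨hd, hn, hn', hu⟩
  obtain ⟨m₁, m₂⟩ := hm d n n' hn hn'
  constructor
  · rw [← integral_sub (integrableOn_refTriangle m₁ b₁) (integrableOn_refTriangle m₂ b₂)]
    have h := abs_setIntegral_refTriangle_le (C := C₃ * d.h) (F := fun u =>
      F d n n' u - F₀ d n n' u) fun u hu => by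
        have := h₃ (d, n, n', u) ⟨hd, hn, hn', hu⟩
        rwa [Real.norm_of_nonneg hd.h_pos.le] at this
    have h0 := hd.h_pos
    calc _ ≤ _ := h
      _ = C₃ * volume.real refTriangle * d.h := by ring
      _ ≤ _ := by
        gcongr
        exact (le_abs_self _).trans (le_max_right _ _)
  · refine (abs_setIntegral_refTriangle_le b₁).trans ?_
    gcongr
    exact (le_abs_self _).trans (le_max_left _ _)

lemma Close.mono {ι : Type*} {l : Filter ι} {h : ι → ℝ} {a b : ℤ} {f f₀ : ι → ℝ}
    (hf : Close l h a f f₀) (hh : IsScale l h) (hab : b ≤ a) : Close l h b f f₀ :=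
  ⟨hf.left.trans (hh.zpow_isBigO hab), hf.right.trans (hh.zpow_isBigO hab),
    hf.sub.trans (hh.zpow_isBigO (by omega))⟩

lemma element_integrands_close {K c : ℝ} (hK : 0 ≤ K) (hc : 0 < c) :
    Close (𝓟 (admissibleSet K c)) (fun y => y.1.h) 0
      (fun y => stiffnessIntegrand y.1.map y.2.1 y.2.2.1 y.2.2.2)
      (fun y => stiffnessIntegrand y.1.flat y.2.1 y.2.2.1 y.2.2.2) ∧
    Close (𝓟 (admissibleSet K c)) (fun y => y.1.h) 0
      (fun y => massIntegrand y.1.map y.2.1 y.2.2.1 y.2.2.2)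
      fun y => massIntegrand y.1.flat y.2.1 y.2.2.1 y.2.2.2 := by
  have hd : ∀ y ∈ admissibleSet K c, y.1.Admissible K c := fun y hy => hy.1
  have hu : ∀ y ∈ admissibleSet K c, y.2.2.2 ∈ refTriangle := fun y hy => hy.2.2.2
  have hh := isScale_of_admissible hd
  have hG := metricClose_of_admissible hd hK hc hu
  have hV := field_close_of_admissible (n := fun y => y.2.1) hd hK hc (fun y hy => hy.2.1) hu
  have hW := field_close_of_admissible (n := fun y => y.2.2.1) hd hK hc (fun y hy => hy.2.2.1) hu
  -- The mass integrand even has order `2`; order `0` is enough and treats both matrices alike.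
  exact ⟨stiffness_integrand_close hh hG (pd_metric_close_of_admissible hd hK hu)
    hV.1 hV.2 hW.1 hW.2, (mass_integrand_close hh hG hV.1 hW.1).mono hh (by norm_num)⟩

/-- The element integrals over a curved patch are bounded and `O(h)`-close to the flat ones. -/
lemma element_integrals_close {K c : ℝ} (hK : 0 ≤ K) (hc : 0 < c) :
    ∃ C, 0 ≤ C ∧ ∀ d n n', d.Admissible K c → n.Admissible K d → n'.Admissible K d →
      (|stiffnessIntegral d.map n n' - stiffnessIntegral d.flat n n'| ≤ C * d.h ∧
        |stiffnessIntegral d.map n n'| ≤ C) ∧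
      (|massIntegral d.map n n' - massIntegral d.flat n n'| ≤ C * d.h ∧
        |massIntegral d.map n n'| ≤ C) := by
  have mS : ∀ d n n', n.Admissible K d → n'.Admissible K d → ∀ Φ,
      Measurable (stiffnessIntegrand Φ n n') := fun d n n' hn hn' Φ =>
    measurable_stiffness_integrand _ (NodalData.measurable_field hn.measurable _)
      (NodalData.measurable_field hn'.measurable _)
  have mM : ∀ d n n', n.Admissible K d → n'.Admissible K d → ∀ Φ,
      Measurable (massIntegrand Φ n n') := fun d n n' hn hn' Φ =>
    measurable_mass_integrand _ (NodalData.measurable_field hn.measurable _)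
      (NodalData.measurable_field hn'.measurable _)
  obtain ⟨C₁, h₁, H₁⟩ := integral_close
    (F := fun d => stiffnessIntegrand d.map)
    (F₀ := fun d => stiffnessIntegrand d.flat) (element_integrands_close hK hc).1
    fun d n n' hn hn' => ⟨mS d n n' hn hn' _, mS d n n' hn hn' _⟩
  obtain ⟨C₂, h₂, H₂⟩ := integral_close
    (F := fun d => massIntegrand d.map)
    (F₀ := fun d => massIntegrand d.flat) (element_integrands_close hK hc).2
    fun d n n' hn hn' => ⟨mM d n n' hn hn' _, mM d n n' hn hn' _⟩
  refine ⟨max C₁ C₂, le_max_of_le_left h₁, fun d n n' hd hn hn' => ?_⟩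
  have h0 := hd.h_pos.le
  obtain ⟨a1, a2⟩ := H₁ d n n' hd hn hn'
  obtain ⟨b1, b2⟩ := H₂ d n n' hd hn hn'
  exact ⟨⟨a1.trans (mul_le_mul_of_nonneg_right (le_max_left _ _) h0), a2.trans (le_max_left _ _)⟩,
    b1.trans (mul_le_mul_of_nonneg_right (le_max_right _ _) h0), b2.trans (le_max_right _ _)⟩

end ElementIntegrals

/-! ### Local geometry of a compact surface. -/

section Surface

open Set Filter Topology

/-- `F` is a defining function of `M` on the ball of radius `δ` about `x`, normalized at `x`, whose
derivative is `L`-Lipschitz. -/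
structure IsLocalDefining (M : Set E3) (δ L : ℝ) (x : E3) (F : E3 → ℝ) : Prop where
  differentiableAt : ∀ y ∈ ball x δ, DifferentiableAt ℝ F y
  mem_iff : ∀ y ∈ ball x δ, y ∈ M ↔ F y = 0
  norm_fderiv : ‖fderiv ℝ F x‖ = 1
  lipschitz : ∀ y ∈ ball x δ, ∀ y' ∈ ball x δ, ‖fderiv ℝ F y - fderiv ℝ F y'‖ ≤ L * ‖y - y'‖

lemma IsLocalDefining.mono {M : Set E3} {δ δ' L L' : ℝ} {x : E3} {F : E3 → ℝ}
    (hF : IsLocalDefining M δ L x F) (hδ : δ' ≤ δ) (hL : L ≤ L') : IsLocalDefining M δ' L' x F where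
  differentiableAt y hy := hF.differentiableAt y (ball_subset_ball hδ hy)
  mem_iff y hy := hF.mem_iff y (ball_subset_ball hδ hy)
  norm_fderiv := hF.norm_fderiv
  lipschitz y hy y' hy' := (hF.lipschitz y (ball_subset_ball hδ hy) y'
    (ball_subset_ball hδ hy')).trans (by gcongr)

/-- Divide a defining function by the norm of its derivative at `x`. Near `x₀` that norm exceeds
half its value at `x₀`, so one Lipschitz constant serves all `x`. -/
lemma IsC3Surface.exists_localDefining_nhds {M : Set E3} (hM : IsC3Surface M) {x₀ : E3}
    (hx₀ : x₀ ∈ M) : ∃ r > 0, ∃ L ≥ 1, ∀ x ∈ ball x₀ r, x ∈ M → ∃ F, IsLocalDefining M r L x F := by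
  obtain ⟨U, F, hU, hxU, hF, hF', hMU⟩ := hM x₀ hx₀
  have hFat : ∀ y ∈ U, ContDiffAt ℝ 3 F y := fun y hy => hF.contDiffAt (hU.mem_nhds hy)
  have hdF : ContDiffAt ℝ 1 (fderiv ℝ F) x₀ :=
    (hFat x₀ hxU).fderiv_right (m := 1) (by norm_num)
  obtain ⟨K, T, hT, hK⟩ := hdF.exists_lipschitzOnWith
  set c := ‖fderiv ℝ F x₀‖ with hc
  have hc0 : 0 < c := norm_pos_iff.2 (hF' x₀ hxU)
  have hev : ∀ᶠ y in 𝓝 x₀, c / 2 < ‖fderiv ℝ F y‖ :=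
    hdF.continuousAt.norm.eventually (lt_mem_nhds (by linarith : c / 2 < ‖fderiv ℝ F x₀‖))
  obtain ⟨r, hr, hball⟩ := Metric.mem_nhds_iff.1 (inter_mem (inter_mem (hU.mem_nhds hxU) hT) hev)
  refine ⟨r / 2, by positivity, max 1 ((c / 2)⁻¹ * K), le_max_left _ _, fun x hx hxM => ?_⟩
  have hsub : ball x (r / 2) ⊆ ball x₀ r := by
    refine ball_subset_ball' ?_
    have := mem_ball.1 hx
    linarith
  have hxr : x ∈ ball x₀ r := hsub (mem_ball_self (by positivity))
  have hcx : c / 2 < ‖fderiv ℝ F x‖ := (hball hxr).2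
  have hpos : 0 < ‖fderiv ℝ F x‖ := by linarith
  have hd : ∀ y ∈ ball x (r / 2), DifferentiableAt ℝ F y := fun y hy =>
    (hFat y (hball (hsub hy)).1.1).differentiableAt (by simp)
  have hfd : ∀ y ∈ ball x (r / 2), fderiv ℝ (‖fderiv ℝ F x‖⁻¹ • F) y
      = ‖fderiv ℝ F x‖⁻¹ • fderiv ℝ F y := fun y hy => fderiv_const_smul (hd y hy) _
  refine ⟨‖fderiv ℝ F x‖⁻¹ • F, fun y hy => (hd y hy).const_smul _, fun y hy => ?_, ?_,
    fun y hy y' hy' => ?_⟩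
  · have hyU : y ∈ U := (hball (hsub hy)).1.1
    have h1 : y ∈ M ↔ F y = 0 := by
      have := Set.ext_iff.1 hMU y
      simpa [hyU] using this
    rw [h1]
    simp [hpos.ne']
  · rw [hfd x (mem_ball_self (by positivity)), norm_smul, norm_inv, norm_norm,
      inv_mul_cancel₀ hpos.ne']
  · rw [hfd y hy, hfd y' hy', ← smul_sub, norm_smul, norm_inv, norm_norm]
    calc _ ≤ (c / 2)⁻¹ * (K * ‖y - y'‖) := by
          gcongr
          exact hK.norm_sub_le (hball (hsub hy)).1.2 (hball (hsub hy')).1.2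
      _ = ((c / 2)⁻¹ * K) * ‖y - y'‖ := by ring
      _ ≤ _ := by gcongr; exact le_max_right _ _

/-- Uniform local defining functions of a compact surface. -/
lemma IsC3Surface.exists_uniform_localDefining {M : Set E3} (hM : IsC3Surface M)
    (hMc : IsCompact M) : ∃ δ > 0, ∃ L ≥ 1, L * δ ≤ 1 / 4 ∧
      ∀ x ∈ M, ∃ F, IsLocalDefining M δ L x F := by
  have key : ∃ δ > 0, ∃ L ≥ 1, ∀ x ∈ M, x ∈ M → ∃ F, IsLocalDefining M δ L x F := by
    refine hMc.induction_on (p := fun S => ∃ δ > 0, ∃ L ≥ 1, ∀ x ∈ S, x ∈ M →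
      ∃ F, IsLocalDefining M δ L x F) ⟨1, one_pos, 1, le_rfl, by simp⟩ ?_ ?_ ?_
    · rintro S S' hS ⟨δ, hδ, L, hL, h⟩
      exact ⟨δ, hδ, L, hL, fun x hx => h x (hS hx)⟩
    · rintro S S' ⟨δ, hδ, L, hL, h⟩ ⟨δ', hδ', L', hL', h'⟩
      refine ⟨min δ δ', lt_min hδ hδ', max L L', le_max_of_le_left hL, ?_⟩
      rintro x (hx | hx) hxM
      · obtain ⟨F, hF⟩ := h x hx hxM
        exact ⟨F, hF.mono (min_le_left _ _) (le_max_left _ _)⟩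
      · obtain ⟨F, hF⟩ := h' x hx hxM
        exact ⟨F, hF.mono (min_le_right _ _) (le_max_right _ _)⟩
    · intro x hx
      obtain ⟨r, hr, L, hL, h⟩ := hM.exists_localDefining_nhds hx
      exact ⟨ball x r, mem_nhdsWithin_of_mem_nhds (ball_mem_nhds x hr), r, hr, L, hL, h⟩
  obtain ⟨δ, hδ, L, hL, h⟩ := key
  have hL0 : 0 < L := by linarith
  -- After this shrinking the derivative differs from its unit value at the centre by at most `1/4`
  -- throughout the ball.
  refine ⟨min δ (1 / (4 * L)), by positivity, L, hL, ?_, fun x hx => ?_⟩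
  · calc L * min δ (1 / (4 * L)) ≤ L * (1 / (4 * L)) := by gcongr; exact min_le_right _ _
      _ = 1 / 4 := by field_simp
  · obtain ⟨F, hF⟩ := h x hx hx
    exact ⟨F, hF.mono (min_le_left _ _) le_rfl⟩

section Frame

variable (t : OrthonormalBasis (Fin 3) ℝ E3)

lemma norm_sq_frame (v : E3) :
    ‖v‖ ^ 2 = inner ℝ (t 0) v ^ 2 + inner ℝ (t 1) v ^ 2 + inner ℝ (t 2) v ^ 2 := by
  rw [← t.sum_sq_norm_inner_right v, Fin.sum_univ_three]
  simp only [Real.norm_eq_abs, sq_abs]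

lemma norm_sq_E2 (v : E2) : ‖v‖ ^ 2 = v 0 ^ 2 + v 1 ^ 2 := by
  rw [EuclideanSpace.norm_sq_eq, Fin.sum_univ_two]
  simp only [Real.norm_eq_abs, sq_abs]

lemma norm_sq_tangentCoord_sub (x y y' : E3) :
    ‖tangentCoord t x y - tangentCoord t x y'‖ ^ 2 + inner ℝ (t 2) (y - y') ^ 2
      = ‖y - y'‖ ^ 2 := by
  rw [norm_sq_frame t, norm_sq_E2]
  simp [tangentCoord, inner_sub_right]

lemma tangentCoord_self (x : E3) : tangentCoord t x x = 0 := by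
  ext i; fin_cases i <;> simp [tangentCoord]

lemma norm_tangentCoord_sub_le (x y y' : E3) :
    ‖tangentCoord t x y - tangentCoord t x y'‖ ≤ ‖y - y'‖ := by
  refine abs_le_of_sq_le_sq' ?_ (norm_nonneg _) |>.2
  have := norm_sq_tangentCoord_sub t x y y'
  nlinarith [sq_nonneg (inner ℝ (t 2) (y - y'))]

lemma norm_tangentCoord_le (x y : E3) : ‖tangentCoord t x y‖ ≤ ‖y - x‖ := by
  simpa [tangentCoord_self] using norm_tangentCoord_sub_le t x y x

lemma tangentCoord_graphMap (x : E3) (f : E2 → ℝ) (v : E2) :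
    tangentCoord t x (graphMap t x f v) = v := by
  have h := orthonormal_iff_ite.1 t.orthonormal
  ext i
  fin_cases i <;>
    simp [tangentCoord, graphMap, add_assoc, inner_add_right, real_inner_smul_right, h]

end Frame

namespace IsLocalDefining

variable {M : Set E3} {δ L : ℝ} {x : E3} {F : E3 → ℝ}

/-- `F` vanishes on `M`, so both its derivative and `0` are derivatives within `M`; such derivatives
agree on the tangent cone. -/
lemma fderiv_tangent_eq_zero (hF : IsLocalDefining M δ L x F) {y : E3} (hy : y ∈ ball x δ)
    (hyM : y ∈ M) {τ : E3} (hτ : τ ∈ tangentConeAt ℝ M y) : fderiv ℝ F y τ = 0 := by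
  have h1 : HasFDerivWithinAt F (fderiv ℝ F y) M y :=
    (hF.differentiableAt y hy).hasFDerivAt.hasFDerivWithinAt
  have h2 : HasFDerivWithinAt F (0 : E3 →L[ℝ] ℝ) M y := by
    refine (hasFDerivWithinAt_const (0 : ℝ) y M).congr_of_eventuallyEq ?_
      ((hF.mem_iff y hy).1 hyM)
    filter_upwards [self_mem_nhdsWithin, mem_nhdsWithin_of_mem_nhds (isOpen_ball.mem_nhds hy)]
      with w hwM hw
    exact (hF.mem_iff w hw).1 hwM
  exact h1.unique_on h2 hτ

variable {t : OrthonormalBasis (Fin 3) ℝ E3}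

/-- `t` is adapted to `M` at `x`. -/
def _root_.IsAdapted (M : Set E3) (x : E3) (t : OrthonormalBasis (Fin 3) ℝ E3) : Prop :=
  t 0 ∈ tangentConeAt ℝ M x ∧ t 1 ∈ tangentConeAt ℝ M x

lemma fderiv_eq (hF : IsLocalDefining M δ L x F) (hδ : 0 < δ) (hx : x ∈ M) (ht : IsAdapted M x t)
    (v : E3) : fderiv ℝ F x v = inner ℝ (t 2) v * fderiv ℝ F x (t 2) := by
  have hx' : x ∈ ball x δ := mem_ball_self hδ
  conv_lhs => rw [← t.sum_repr' v]
  rw [Fin.sum_univ_three, map_add, map_add, map_smul, map_smul, map_smul,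
    hF.fderiv_tangent_eq_zero hx' hx ht.1, hF.fderiv_tangent_eq_zero hx' hx ht.2]
  simp

lemma abs_fderiv_normal (hF : IsLocalDefining M δ L x F) (hδ : 0 < δ) (hx : x ∈ M)
    (ht : IsAdapted M x t) : |fderiv ℝ F x (t 2)| = 1 := by
  have h1 : ‖t 2‖ = 1 := t.orthonormal.1 2
  refine le_antisymm ?_ ?_
  · have := (fderiv ℝ F x).le_opNorm (t 2)
    rwa [hF.norm_fderiv, h1, one_mul, Real.norm_eq_abs] at this
  · rw [← hF.norm_fderiv]
    refine ContinuousLinearMap.opNorm_le_bound _ (abs_nonneg _) fun v => ?_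
    rw [hF.fderiv_eq hδ hx ht, norm_mul, mul_comm, Real.norm_eq_abs]
    gcongr
    exact (abs_real_inner_le_norm _ _).trans_eq (by rw [h1, one_mul])

lemma abs_fderiv_eq (hF : IsLocalDefining M δ L x F) (hδ : 0 < δ) (hx : x ∈ M)
    (ht : IsAdapted M x t) (v : E3) : |fderiv ℝ F x v| = |inner ℝ (t 2) v| := by
  rw [hF.fderiv_eq hδ hx ht, abs_mul, hF.abs_fderiv_normal hδ hx ht, mul_one]

/-- Mean value inequality for `F` minus its linear part at `x`, whose derivative is at most `L r` on
`s`. -/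
lemma mean_value (hF : IsLocalDefining M δ L x F) (hL : 0 ≤ L) {r : ℝ} {s : Set E3}
    (hs : Convex ℝ s) (hsδ : s ⊆ ball x δ) (hsr : s ⊆ closedBall x r) (hx : x ∈ s) {y y' : E3}
    (hy : y ∈ s) (hy' : y' ∈ s) :
    |F y - F y' - fderiv ℝ F x (y - y')| ≤ L * r * ‖y - y'‖ :=
  hs.norm_image_sub_le_of_norm_hasFDerivWithin_le' (f' := fderiv ℝ F)
    (fun w hw => (hF.differentiableAt w (hsδ hw)).hasFDerivAt.hasFDerivWithinAt)
    (fun w hw => (hF.lipschitz w (hsδ hw) x (hsδ hx)).trans (by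
      gcongr; exact mem_closedBall_iff_norm.1 (hsr hw))) hy' hy

lemma abs_normal_sub_le (hF : IsLocalDefining M δ L x F) (hL : 0 ≤ L) (hδ : 0 < δ) (hx : x ∈ M)
    (ht : IsAdapted M x t) {y y' : E3} (hy : y ∈ ball x δ) (hyM : y ∈ M) (hy' : y' ∈ ball x δ)
    (hyM' : y' ∈ M) : |inner ℝ (t 2) (y - y')| ≤ L * δ * ‖y - y'‖ := by
  have := hF.mean_value hL (convex_ball x δ) Subset.rfl ball_subset_closedBall
    (mem_ball_self hδ) hy hy'
  rwa [(hF.mem_iff y hy).1 hyM, (hF.mem_iff y' hy').1 hyM', sub_zero, zero_sub, abs_neg,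
    hF.abs_fderiv_eq hδ hx ht] at this

/-- Points of the surface deviate quadratically from the tangent plane. -/
lemma abs_normal_le (hF : IsLocalDefining M δ L x F) (hL : 0 ≤ L) (hδ : 0 < δ) (hx : x ∈ M)
    (ht : IsAdapted M x t) {y : E3} (hy : y ∈ ball x δ) (hyM : y ∈ M) :
    |inner ℝ (t 2) (y - x)| ≤ L * ‖y - x‖ ^ 2 := by
  have hsub : closedBall x ‖y - x‖ ⊆ ball x δ := closedBall_subset_ball (mem_ball_iff_norm.1 hy)
  have := hF.mean_value hL (convex_closedBall x ‖y - x‖) hsub Subset.rfl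
    (mem_closedBall_self (norm_nonneg _)) (mem_closedBall_iff_norm.2 le_rfl)
    (mem_closedBall_self (norm_nonneg _))
  rw [(hF.mem_iff y hy).1 hyM, (hF.mem_iff x (mem_ball_self hδ)).1 hx, sub_zero, zero_sub, abs_neg,
    hF.abs_fderiv_eq hδ hx ht] at this
  linarith

/-- The projection to the tangent plane is bi-Lipschitz near `x`. -/
lemma norm_sub_le (hF : IsLocalDefining M δ L x F) (hL : 0 ≤ L) (hδ : 0 < δ) (hLδ : L * δ ≤ 1 / 4)
    (hx : x ∈ M) (ht : IsAdapted M x t) {y y' : E3} (hy : y ∈ ball x δ) (hyM : y ∈ M)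
    (hy' : y' ∈ ball x δ) (hyM' : y' ∈ M) :
    ‖y - y'‖ ≤ 2 * ‖tangentCoord t x y - tangentCoord t x y'‖ := by
  have h1 := hF.abs_normal_sub_le hL hδ hx ht hy hyM hy' hyM'
  have h2 : |inner ℝ (t 2) (y - y')| ≤ 1 / 4 * ‖y - y'‖ := h1.trans (by gcongr)
  have h3 := norm_sq_tangentCoord_sub t x y y'
  rw [← sq_abs (inner ℝ (t 2) (y - y'))] at h3
  have h4 := pow_le_pow_left₀ (abs_nonneg _) h2 2
  refine abs_le_of_sq_le_sq' ?_ (by positivity) |>.2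
  nlinarith [sq_nonneg ‖y - y'‖]

/-- The tangent planes vary Lipschitz continuously. -/
lemma abs_normal_tangent_le (hF : IsLocalDefining M δ L x F) (hδ : 0 < δ)
    (hx : x ∈ M) (ht : IsAdapted M x t) {y : E3} (hy : y ∈ ball x δ) (hyM : y ∈ M) {τ : E3}
    (hτ : τ ∈ tangentConeAt ℝ M y) (hτ1 : ‖τ‖ ≤ 1) (hL : 0 ≤ L) :
    |inner ℝ (t 2) τ| ≤ L * ‖y - x‖ := by
  rw [← hF.abs_fderiv_eq hδ hx ht]
  have h1 : fderiv ℝ F x τ = (fderiv ℝ F x - fderiv ℝ F y) τ := by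
    rw [_root_.sub_apply, hF.fderiv_tangent_eq_zero hy hyM hτ, sub_zero]
  rw [h1]
  calc _ ≤ ‖fderiv ℝ F x - fderiv ℝ F y‖ * ‖τ‖ := ContinuousLinearMap.le_opNorm _ _
    _ ≤ (L * ‖x - y‖) * 1 := by
      gcongr
      exact hF.lipschitz x (mem_ball_self hδ) y hy
    _ = _ := by rw [mul_one, norm_sub_rev]

/-- The surface has points at every small distance from each of its points. -/
lemma exists_mem_dist_eq (hF : IsLocalDefining M δ L x F) (hL : 0 ≤ L) (hLδ : L * δ ≤ 1 / 4)
    (hx : x ∈ M) (ht : IsAdapted M x t) {s : ℝ} (hs : 0 < s) (hsδ : s < δ) :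
    ∃ y ∈ M, dist y x = s := by
  have hδ : 0 < δ := hs.trans hsδ
  have h1 : ‖t 2‖ = 1 := t.orthonormal.1 2
  have hmem : ∀ σ : ℝ, |σ| = 1 → x + (s * σ) • t 2 ∈ sphere x s := fun σ hσ => by
    rw [mem_sphere_iff_norm, add_sub_cancel_left, norm_smul, h1, mul_one, norm_mul,
      Real.norm_of_nonneg hs.le, Real.norm_eq_abs, hσ, mul_one]
  have hsub : closedBall x s ⊆ ball x δ := closedBall_subset_ball hsδ
  have hval : ∀ σ : ℝ, |σ| = 1 →
      |F (x + (s * σ) • t 2) - s * σ * fderiv ℝ F x (t 2)| ≤ s / 4 := by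
    intro σ hσ
    have := hF.mean_value hL (convex_closedBall x s) hsub Subset.rfl
      (mem_closedBall_self hs.le) (sphere_subset_closedBall (hmem σ hσ)) (mem_closedBall_self hs.le)
    rw [(hF.mem_iff x (mem_ball_self hδ)).1 hx, sub_zero,
      mem_sphere_iff_norm.1 (hmem σ hσ), add_sub_cancel_left, map_smul, smul_eq_mul] at this
    refine this.trans ?_
    have : L * s ≤ 1 / 4 := le_trans (by gcongr) hLδ
    nlinarith
  have hν := hF.abs_fderiv_normal hδ hx ht
  have hν2 : fderiv ℝ F x (t 2) * fderiv ℝ F x (t 2) = 1 := by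
    rw [← abs_mul_abs_self, hν, one_mul]
  set ν := fderiv ℝ F x (t 2)
  -- At the two poles `F` is within `s / 4` of `s` and `-s`, so it changes sign on the sphere, which
  -- is connected in dimension three.
  have hp := abs_le.1 (hval ν hν)
  have hm := abs_le.1 (hval (-ν) (by rwa [abs_neg]))
  have hpos : 0 ≤ F (x + (s * ν) • t 2) := by nlinarith [hp.1]
  have hneg : F (x + (s * -ν) • t 2) ≤ 0 := by nlinarith [hm.2]
  have hcont : ContinuousOn F (sphere x s) := fun y hy =>
    (hF.differentiableAt y (hsub (sphere_subset_closedBall hy))).continuousAt.continuousWithinAt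
  have hrank : 1 < Module.rank ℝ E3 := by
    rw [← Module.finrank_eq_rank, finrank_euclideanSpace_fin]
    norm_num
  obtain ⟨y, hy, hy0⟩ := (isPreconnected_sphere hrank x s).intermediate_value
    (hmem (-ν) (by rwa [abs_neg])) (hmem ν hν) hcont ⟨hneg, hpos⟩
  exact ⟨y, (hF.mem_iff y (hsub (sphere_subset_closedBall hy))).2 hy0, hy⟩

section Graph

variable {z : E2 → ℝ} {ρ : ℝ}

lemma continuousOn_graphMap (hz : ContinuousOn z (ball 0 ρ)) :
    ContinuousOn (graphMap t x z) (ball 0 ρ) := by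
  have h : ∀ i, Continuous fun u : E2 => u i := fun i => by fun_prop
  exact (((continuous_const.add ((h 0).smul continuous_const)).add
    ((h 1).smul continuous_const)).continuousOn).add (hz.smul continuousOn_const)

/-- Excludes that the chart leaves for a remote sheet of `M`. Along the ray to `v`, while the graph
stays in the ball of radius `δ`, the bi-Lipschitz bound keeps it within `2‖v‖ < δ / 2`; by
continuity the distance never attains `3 δ / 4`. -/
lemma norm_graphMap_sub_le (hF : IsLocalDefining M δ L x F) (hL : 0 ≤ L) (hδ : 0 < δ)
    (hLδ : L * δ ≤ 1 / 4) (hx : x ∈ M) (ht : IsAdapted M x t) (hz0 : z 0 = 0)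
    (hz : ContinuousOn z (ball 0 ρ)) (hzM : ∀ v ∈ ball (0 : E2) ρ, graphMap t x z v ∈ M)
    {v : E2} (hv : v ∈ ball (0 : E2) ρ) (hvδ : ‖v‖ < δ / 4) :
    ‖graphMap t x z v - x‖ ≤ 2 * ‖v‖ := by
  have hseg : ∀ s ∈ Icc (0 : ℝ) 1, s • v ∈ ball (0 : E2) ρ := fun s hs => by
    rw [mem_ball_zero_iff] at hv ⊢
    rw [norm_smul, Real.norm_of_nonneg hs.1]
    nlinarith [norm_nonneg v, hs.2]
  have hclose : ∀ s ∈ Icc (0 : ℝ) 1, ‖graphMap t x z (s • v) - x‖ < δ →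
      ‖graphMap t x z (s • v) - x‖ ≤ 2 * ‖v‖ := fun s hs hlt => by
    have := hF.norm_sub_le hL hδ hLδ hx ht (mem_ball_iff_norm.2 hlt) (hzM _ (hseg s hs))
      (mem_ball_self hδ) hx
    rw [tangentCoord_graphMap, tangentCoord_self, sub_zero, norm_smul, Real.norm_of_nonneg hs.1]
      at this
    nlinarith [norm_nonneg v, hs.2]
  have hg0 : graphMap t x z ((0 : ℝ) • v) = x := by simp [graphMap, hz0]
  have hcont : ContinuousOn (fun s : ℝ => ‖graphMap t x z (s • v) - x‖) (Icc 0 1) :=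
    (((continuousOn_graphMap hz).comp (continuous_id.smul continuous_const).continuousOn
      hseg).sub continuousOn_const).norm
  rw [← one_smul ℝ v] at hvδ ⊢
  have h1 : (1 : ℝ) ∈ Icc (0 : ℝ) 1 := right_mem_Icc.2 zero_le_one
  rw [one_smul] at hvδ
  rw [norm_smul, norm_one, one_mul]
  refine hclose 1 h1 ?_
  by_contra! hge
  obtain ⟨s, hs, hs'⟩ := intermediate_value_Icc zero_le_one hcont
    (show 3 * δ / 4 ∈ Icc _ _ from ⟨by rw [hg0, sub_self, norm_zero]; positivity, by linarith⟩)
  dsimp only at hs'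
  have := hclose s hs (by rw [hs']; linarith)
  linarith

/-- Implicit differentiation of `F ∘ graphMap = 0`. -/
lemma fderiv_height (hF : IsLocalDefining M δ L x F) {v : E2} (hv : v ∈ ball (0 : E2) ρ)
    (hz : DifferentiableAt ℝ z v) (hzM : ∀ v ∈ ball (0 : E2) ρ, graphMap t x z v ∈ M)
    (hgv : graphMap t x z v ∈ ball x δ) (w : E2) :
    fderiv ℝ F (graphMap t x z v) (w 0 • t 0 + w 1 • t 1)
      + fderiv ℝ z v w * fderiv ℝ F (graphMap t x z v) (t 2) = 0 := by
  have hg := hasFDerivAt_graphMap t x hz.hasFDerivAt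
  have hcomp := (hF.differentiableAt _ hgv).hasFDerivAt.comp v hg
  have hzero : (F ∘ graphMap t x z) =ᶠ[𝓝 v] fun _ => (0 : ℝ) := by
    filter_upwards [isOpen_ball.mem_nhds hv, hg.continuousAt (isOpen_ball.mem_nhds hgv)] with w hw hw'
    exact (hF.mem_iff _ hw').1 (hzM w hw)
  have h0 : fderiv ℝ (F ∘ graphMap t x z) v = 0 := by
    rw [hzero.fderiv_eq]; simp
  rw [hcomp.fderiv] at h0
  have := congrArg (fun T : E2 →L[ℝ] ℝ => T w) h0
  simp only [ContinuousLinearMap.comp_apply, _root_.add_apply,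
    ContinuousLinearMap.smulRight_apply, _root_.zero_apply] at this
  rw [map_add, map_smul _ (fderiv ℝ z v w), smul_eq_mul] at this
  exact this

/-- Bounds for the first two derivatives of the height function of a surface. -/
lemma height_bounds (hF : IsLocalDefining M δ L x F) (hL : 0 ≤ L) (hδ : 0 < δ)
    (hLδ : L * δ ≤ 1 / 4) (hx : x ∈ M) (ht : IsAdapted M x t) (hz0 : z 0 = 0)
    (hz : ContDiffOn ℝ 3 z (ball 0 ρ)) (hzM : ∀ v ∈ ball (0 : E2) ρ, graphMap t x z v ∈ M)
    {v : E2} (hv : v ∈ ball (0 : E2) ρ) (hvδ : ‖v‖ < δ / 4) :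
    ‖fderiv ℝ z v‖ ≤ 4 * L * ‖v‖ ∧ ‖fderiv ℝ (fderiv ℝ z) v‖ ≤ 4 * L := by
  have hd : ∀ v ∈ ball (0 : E2) ρ, DifferentiableAt ℝ z v := fun v hv =>
    (hz.contDiffAt (isOpen_ball.mem_nhds hv)).differentiableAt (by simp)
  have hgr : ∀ v ∈ ball (0 : E2) ρ, ‖v‖ < δ / 4 → ‖graphMap t x z v - x‖ ≤ 2 * ‖v‖ :=
    fun v hv hvδ => hF.norm_graphMap_sub_le hL hδ hLδ hx ht hz0 hz.continuousOn hzM hv hvδ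
  have hgb : ∀ v ∈ ball (0 : E2) ρ, ‖v‖ < δ / 4 → graphMap t x z v ∈ ball x δ :=
    fun v hv hvδ => mem_ball_iff_norm.2 ((hgr v hv hvδ).trans_lt (by linarith))
  -- The normal derivative is `±1` at `x` and varies by at most `1/4`, so the implicit equation can
  -- be solved for the slope.
  have hnu : ∀ y ∈ ball x δ, 3 / 4 ≤ |fderiv ℝ F y (t 2)| := fun y hy => by
    have h1 : |(fderiv ℝ F x - fderiv ℝ F y) (t 2)| ≤ L * ‖x - y‖ := by
      refine ((fderiv ℝ F x - fderiv ℝ F y).le_opNorm (t 2)).trans ?_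
      rw [t.orthonormal.1 2, mul_one]
      exact hF.lipschitz x (mem_ball_self hδ) y hy
    have h2 : L * ‖x - y‖ ≤ 1 / 4 := le_trans (by
      gcongr; rw [norm_sub_rev]; exact (mem_ball_iff_norm.1 hy).le) hLδ
    rw [_root_.sub_apply] at h1
    have h3 := abs_sub_abs_le_abs_sub (fderiv ℝ F x (t 2)) (fderiv ℝ F y (t 2))
    rw [hF.abs_fderiv_normal hδ hx ht] at h3
    linarith
  have hwnorm : ∀ w : E2, ‖w 0 • t 0 + w 1 • t 1‖ ≤ ‖w‖ := fun w => by
    refine abs_le_of_sq_le_sq' ?_ (norm_nonneg _) |>.2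
    have := inner_frame t (w 0) (w 1) 0 (w 0) (w 1) 0
    rw [zero_smul, add_zero, real_inner_self_eq_norm_sq] at this
    rw [this, norm_sq_E2]
    linarith
  have hgrad : ∀ v ∈ ball (0 : E2) ρ, ‖v‖ < δ / 4 → ‖fderiv ℝ z v‖ ≤ 4 * L * ‖v‖ := by
    intro v hv hvδ
    refine ContinuousLinearMap.opNorm_le_bound _ (by positivity) fun w => ?_
    have h1 := hF.fderiv_height hv (hd v hv) hzM (hgb v hv hvδ) w
    have h2 := hnu _ (hgb v hv hvδ)
    have h3 : |fderiv ℝ F (graphMap t x z v) (w 0 • t 0 + w 1 • t 1)| ≤ 2 * L * ‖v‖ * ‖w‖ := by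
      have h0 : fderiv ℝ F x (w 0 • t 0 + w 1 • t 1) = 0 := by
        rw [map_add, map_smul, map_smul, hF.fderiv_tangent_eq_zero (mem_ball_self hδ) hx ht.1,
          hF.fderiv_tangent_eq_zero (mem_ball_self hδ) hx ht.2]
        simp
      rw [← sub_zero (fderiv ℝ F _ _), ← h0, ← _root_.sub_apply]
      calc _ ≤ ‖fderiv ℝ F (graphMap t x z v) - fderiv ℝ F x‖ * ‖w 0 • t 0 + w 1 • t 1‖ :=
            ContinuousLinearMap.le_opNorm _ _
        _ ≤ (L * (2 * ‖v‖)) * ‖w‖ := by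
          gcongr
          · exact (hF.lipschitz _ (hgb v hv hvδ) x (mem_ball_self hδ)).trans
              (by gcongr; exact hgr v hv hvδ)
          · exact hwnorm w
        _ = _ := by ring
    have h4 : |fderiv ℝ z v w| * |fderiv ℝ F (graphMap t x z v) (t 2)|
        = |fderiv ℝ F (graphMap t x z v) (w 0 • t 0 + w 1 • t 1)| := by
      rw [← abs_mul, ← abs_neg]; congr 1; linarith
    rw [Real.norm_eq_abs]
    nlinarith [abs_nonneg (fderiv ℝ z v w)]
  refine ⟨hgrad v hv hvδ, ?_⟩
  -- The Hessian is bounded by a Lipschitz constant of the gradient, found by subtracting the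
  -- implicit equations at `v'` and `v`; second derivatives of `F` never enter.
  refine norm_fderiv_le_of_lip' ℝ (by positivity) ?_
  have hv4 : v ∈ ball (0 : E2) (δ / 4) := mem_ball_zero_iff.2 hvδ
  filter_upwards [isOpen_ball.mem_nhds hv, isOpen_ball.mem_nhds hv4] with v' hv' hv4'
  have hvδ' : ‖v'‖ < δ / 4 := mem_ball_zero_iff.1 hv4'
  refine ContinuousLinearMap.opNorm_le_bound _ (by positivity) fun w => ?_
  have h1 := hF.fderiv_height hv (hd v hv) hzM (hgb v hv hvδ) w
  have h1' := hF.fderiv_height hv' (hd v' hv') hzM (hgb v' hv' hvδ') w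
  have h2 := hnu _ (hgb v' hv' hvδ')
  have hyy : ‖graphMap t x z v' - graphMap t x z v‖ ≤ 2 * ‖v' - v‖ := by
    have := hF.norm_sub_le hL hδ hLδ hx ht (hgb v' hv' hvδ') (hzM v' hv') (hgb v hv hvδ) (hzM v hv)
    rwa [tangentCoord_graphMap, tangentCoord_graphMap] at this
  set y := graphMap t x z v
  set y' := graphMap t x z v'
  have hD : ‖fderiv ℝ F y' - fderiv ℝ F y‖ ≤ 2 * L * ‖v' - v‖ :=
    (hF.lipschitz _ (hgb v' hv' hvδ') _ (hgb v hv hvδ)).trans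
      ((mul_le_mul_of_nonneg_left hyy hL).trans_eq (by ring))
  have h5 : |(fderiv ℝ F y' - fderiv ℝ F y) (w 0 • t 0 + w 1 • t 1)|
      ≤ 2 * L * ‖v' - v‖ * ‖w‖ :=
    (ContinuousLinearMap.le_opNorm _ _).trans
      (mul_le_mul hD (hwnorm w) (norm_nonneg _) (by positivity))
  have h6 : |(fderiv ℝ F y' - fderiv ℝ F y) (t 2)| ≤ 2 * L * ‖v' - v‖ :=
    ((fderiv ℝ F y' - fderiv ℝ F y).le_opNorm (t 2)).trans
      (by rw [t.orthonormal.1 2, mul_one]; exact hD)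
  have h7 : |fderiv ℝ z v w| ≤ 1 / 4 * ‖w‖ := by
    refine ((fderiv ℝ z v).le_opNorm w).trans ?_
    gcongr
    refine (hgrad v hv hvδ).trans ?_
    nlinarith
  have h8 : |(fderiv ℝ z v' - fderiv ℝ z v) w| * |fderiv ℝ F y' (t 2)|
      ≤ 2 * L * ‖v' - v‖ * ‖w‖ + 1 / 4 * ‖w‖ * (2 * L * ‖v' - v‖) := by
    have : (fderiv ℝ z v' - fderiv ℝ z v) w * fderiv ℝ F y' (t 2)
        = -((fderiv ℝ F y' - fderiv ℝ F y) (w 0 • t 0 + w 1 • t 1)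
          + fderiv ℝ z v w * (fderiv ℝ F y' - fderiv ℝ F y) (t 2)) := by
      simp only [_root_.sub_apply]
      linear_combination h1' - h1
    rw [← abs_mul, this, abs_neg]
    refine (abs_add_le _ _).trans (add_le_add h5 ?_)
    rw [abs_mul]
    gcongr
  rw [Real.norm_eq_abs]
  have h9 : 0 ≤ L * ‖v' - v‖ * ‖w‖ := by positivity
  nlinarith [abs_nonneg ((fderiv ℝ z v' - fderiv ℝ z v) w)]

end Graph

end IsLocalDefining

end Surface

/-! ### Packing and covering by volume. -/

section Counting

open MeasureTheory

variable {E : Type*} [NormedAddCommGroup E] [NormedSpace ℝ E] [FiniteDimensional ℝ E]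
  [Nontrivial E] {ι : Type*}

/-- Volume bound for the number of separated points in a ball. -/
lemma card_mul_pow_le_of_separated (s : Finset ι) (p : ι → E) (c : E) {R q : ℝ} (hq : 0 < q)
    (hR : 0 ≤ R) (hp : ∀ i ∈ s, ‖p i - c‖ ≤ R)
    (hsep : ∀ i ∈ s, ∀ j ∈ s, i ≠ j → 2 * q ≤ ‖p i - p j‖) :
    (s.card : ℝ) * q ^ Module.finrank ℝ E ≤ (R + q) ^ Module.finrank ℝ E := by
  borelize E
  let μ : Measure E := Measure.addHaar
  have hμ : 0 < μ.real (ball 0 1) :=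
    ENNReal.toReal_pos (measure_ball_pos μ 0 one_pos).ne' measure_ball_lt_top.ne
  have hball : ∀ (x : E) {r : ℝ}, 0 ≤ r →
      μ.real (ball x r) = r ^ Module.finrank ℝ E * μ.real (ball 0 1) := fun x r hr => by
    rw [Measure.real, Measure.addHaar_ball μ x hr, ENNReal.toReal_mul,
      ENNReal.toReal_ofReal (by positivity), Measure.real]
  have hdisj : (s : Set ι).PairwiseDisjoint fun i => ball (p i) q := by
    intro i hi j hj hij
    refine ball_disjoint_ball ?_
    rw [dist_eq_norm]
    linarith [hsep i hi j hj hij]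
  have hsub : (⋃ i ∈ s, ball (p i) q) ⊆ ball c (R + q) := by
    refine Set.iUnion₂_subset fun i hi => ball_subset_ball' ?_
    rw [dist_eq_norm]
    linarith [hp i hi]
  have h1 := measureReal_mono (μ := μ) hsub measure_ball_lt_top.ne
  rw [measureReal_biUnion_finset hdisj (fun _ _ => measurableSet_ball)
    (fun _ _ => measure_ball_lt_top.ne), hball c (by positivity)] at h1
  simp only [hball _ hq.le, Finset.sum_const, nsmul_eq_mul, ← mul_assoc] at h1
  exact le_of_mul_le_mul_right h1 hμ

/-- Volume bound for the number of small balls covering a ball. -/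
lemma pow_le_card_mul_of_cover (s : Finset ι) (p : ι → E) (c : E) {r h : ℝ} (hr : 0 ≤ r)
    (hh : 0 ≤ h) (hcov : ∀ w, ‖w - c‖ < r → ∃ i ∈ s, ‖p i - w‖ ≤ h) :
    r ^ Module.finrank ℝ E ≤ (s.card : ℝ) * h ^ Module.finrank ℝ E := by
  borelize E
  let μ : Measure E := Measure.addHaar
  have hμ : 0 < μ.real (ball 0 1) :=
    ENNReal.toReal_pos (measure_ball_pos μ 0 one_pos).ne' measure_ball_lt_top.ne
  have hsub : ball c r ⊆ ⋃ i ∈ s, closedBall (p i) h := by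
    intro w hw
    obtain ⟨i, hi, hiw⟩ := hcov w (mem_ball_iff_norm.1 hw)
    exact Set.mem_iUnion₂.2 ⟨i, hi, by rwa [mem_closedBall_iff_norm, norm_sub_rev]⟩
  have hcl : ∀ x : E, μ.real (closedBall x h) = h ^ Module.finrank ℝ E * μ.real (ball 0 1) :=
    fun x => by
      rw [Measure.real, Measure.addHaar_closedBall μ x hh, ENNReal.toReal_mul,
        ENNReal.toReal_ofReal (by positivity), Measure.real]
  have hlt : μ (⋃ i ∈ s, closedBall (p i) h) ≠ ⊤ :=
    (measure_biUnion_lt_top s.finite_toSet fun _ _ => measure_closedBall_lt_top).ne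
  have h1 := (measureReal_mono (μ := μ) hsub hlt).trans (measureReal_biUnion_finset_le s _)
  simp only [hcl, Finset.sum_const, nsmul_eq_mul] at h1
  rw [Measure.real, Measure.addHaar_ball μ c hr, ENNReal.toReal_mul,
    ENNReal.toReal_ofReal (by positivity), ← Measure.real, ← mul_assoc] at h1
  exact le_of_mul_le_mul_right h1 hμ

end Counting

/-! ### Quadratic polynomials on scattered points. -/

section Quadratic

/-- Size of the coefficients of a quadratic polynomial at length scale `a`. -/
noncomputable def quadSize (a : ℝ) (c : Fin 6 → ℝ) : ℝ :=
  |c 5| + a * (|c 3| + |c 4|) + a ^ 2 * (|c 0| + |c 1| + |c 2|)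

lemma quadSize_nonneg {a : ℝ} (ha : 0 ≤ a) (c : Fin 6 → ℝ) : 0 ≤ quadSize a c := by
  unfold quadSize; positivity

/-- The values at `0`, `(±a, 0)`, `(0, ±a)` and `(a, a)` determine the coefficients. Recovering the
constant, two linear, two pure quadratic and mixed terms costs `1 + 1 + 1 + 2 + 2 + 4 = 11`. -/
lemma exists_quadSize_le {a : ℝ} (ha : 0 ≤ a) (c : Fin 6 → ℝ) :
    ∃ w : E2, |w 0| ≤ a ∧ |w 1| ≤ a ∧ quadSize a c ≤ 11 * |quadPoly c w| := by
  by_contra! hcon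
  have hP : ∀ s r : ℝ, |s| ≤ a → |r| ≤ a → 11 * |c 0 * s ^ 2 + c 1 * r ^ 2 + c 2 * (s * r)
      + c 3 * s + c 4 * r + c 5| < quadSize a c := fun s r hs hr => by
    simpa [quadPoly] using hcon !₂[s, r] (by simpa using hs) (by simpa using hr)
  have ha' : |a| ≤ a := (abs_of_nonneg ha).le
  have hna : |-a| ≤ a := by rwa [abs_neg]
  have h0 : |(0 : ℝ)| ≤ a := by simpa using ha
  obtain ⟨m, hm⟩ : ∃ m, quadSize a c = 11 * m := ⟨quadSize a c / 11, by ring⟩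
  have hP' : ∀ s r : ℝ, |s| ≤ a → |r| ≤ a → -m < c 0 * s ^ 2 + c 1 * r ^ 2 + c 2 * (s * r)
      + c 3 * s + c 4 * r + c 5 ∧ c 0 * s ^ 2 + c 1 * r ^ 2 + c 2 * (s * r)
      + c 3 * s + c 4 * r + c 5 < m := fun s r hs hr => by
    have := hP s r hs hr
    rw [hm] at this
    exact abs_lt.1 (by linarith)
  have p0 := hP' 0 0 h0 h0
  have p1 := hP' a 0 ha' h0
  have p2 := hP' (-a) 0 hna h0
  have p3 := hP' 0 a h0 ha'
  have p4 := hP' 0 (-a) h0 hna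
  have p5 := hP' a a ha' ha'
  ring_nf at p0 p1 p2 p3 p4 p5
  have e5 : |c 5| ≤ m := abs_le.2 ⟨by linarith, by linarith⟩
  have lin : ∀ y : ℝ, a * |y| = |a * y| := fun y => by rw [abs_mul, abs_of_nonneg ha]
  have e3 : a * |c 3| ≤ m := by
    rw [lin]
    exact abs_le.2 ⟨by linarith, by linarith⟩
  have e4 : a * |c 4| ≤ m := by
    rw [lin]
    exact abs_le.2 ⟨by linarith, by linarith⟩
  have sq : ∀ y : ℝ, a ^ 2 * |y| = |a ^ 2 * y| := fun y => by
    rw [abs_mul, abs_of_nonneg (sq_nonneg a)]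
  have e0 : a ^ 2 * |c 0| ≤ 2 * m := by
    rw [sq]; exact abs_le.2 ⟨by linarith, by linarith⟩
  have e1 : a ^ 2 * |c 1| ≤ 2 * m := by
    rw [sq]; exact abs_le.2 ⟨by linarith, by linarith⟩
  have e2 : a ^ 2 * |c 2| < 4 * m := by
    rw [sq]; exact abs_lt.2 ⟨by linarith, by linarith⟩
  have : quadSize a c < 11 * m := by
    unfold quadSize
    linarith
  linarith

lemma abs_quadPoly_sub_le {a η : ℝ} (ha : 0 < a) (hη : η ≤ a) (c : Fin 6 → ℝ) {v w : E2}
    (hw : ∀ i, |w i| ≤ a) (hvw : ‖v - w‖ ≤ η) :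
    |quadPoly c v - quadPoly c w| ≤ 4 * (η / a) * quadSize a c := by
  have hη0 : 0 ≤ η := (norm_nonneg _).trans hvw
  have hd : ∀ i, |v i - w i| ≤ η := fun i => (PiLp.norm_apply_le (v - w) i).trans hvw
  have hv : ∀ i, |v i| ≤ 2 * a := fun i => by
    have := abs_add_le (v i - w i) (w i)
    rw [sub_add_cancel] at this
    linarith [hd i, hw i]
  have hw' : ∀ i, |w i| ≤ 2 * a := fun i => (hw i).trans (by linarith)
  have prod : ∀ i j, |(v i - w i) * v j| ≤ η * (2 * a) ∧ |w i * (v j - w j)| ≤ η * (2 * a) :=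
    fun i j => by
      rw [abs_mul, abs_mul]
      exact ⟨mul_le_mul (hd i) (hv j) (abs_nonneg _) hη0, by
        rw [mul_comm]; exact mul_le_mul (hd j) (hw' i) (abs_nonneg _) hη0⟩
  have quad : ∀ i j, |v i * v j - w i * w j| ≤ 4 * a * η := fun i j => by
    rw [show v i * v j - w i * w j = (v i - w i) * v j + w i * (v j - w j) by ring]
    refine (abs_add_le _ _).trans ?_
    linarith [(prod i j).1, (prod i j).2]
  have hid : quadPoly c v - quadPoly c w = c 0 * (v 0 * v 0 - w 0 * w 0)
      + c 1 * (v 1 * v 1 - w 1 * w 1) + c 2 * (v 0 * v 1 - w 0 * w 1) + c 3 * (v 0 - w 0)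
      + c 4 * (v 1 - w 1) := by unfold quadPoly; ring
  have t : ∀ y z b : ℝ, |z| ≤ b → |y * z| ≤ |y| * b := fun y z b hz => by
    rw [abs_mul]; gcongr
  rw [hid]
  have hfin : 4 * (η / a) * quadSize a c = 4 * (η / a) * |c 5| + 4 * η * (|c 3| + |c 4|)
      + 4 * a * η * (|c 0| + |c 1| + |c 2|) := by
    unfold quadSize; field_simp
  rw [hfin]
  have k5 : 0 ≤ 4 * (η / a) * |c 5| := by positivity
  have k3 : 0 ≤ 3 * η * (|c 3| + |c 4|) := by positivity
  have l0 := t (c 0) _ _ (quad 0 0)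
  have l1 := t (c 1) _ _ (quad 1 1)
  have l2 := t (c 2) _ _ (quad 0 1)
  have l3 := t (c 3) _ _ (hd 0)
  have l4 := t (c 4) _ _ (hd 1)
  rw [abs_le] at l0 l1 l2 l3 l4 ⊢
  constructor <;> linarith [l0.1, l1.1, l2.1, l3.1, l4.1, l0.2, l1.2, l2.2, l3.2, l4.2]

/-- A quadratic polynomial is comparable to its coefficient size on a disc of comparable radius. -/
lemma exists_disc_quadSize_le {a : ℝ} (ha : 0 < a) (c : Fin 6 → ℝ) :
    ∃ w : E2, ‖w‖ ≤ 2 * a ∧ ∀ v : E2, ‖v - w‖ ≤ a / 88 → quadSize a c ≤ 22 * |quadPoly c v| := by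
  obtain ⟨w, h0, h1, hw⟩ := exists_quadSize_le ha.le c
  refine ⟨w, ?_, fun v hv => ?_⟩
  · refine abs_le_of_sq_le_sq' ?_ (by positivity) |>.2
    rw [norm_sq_E2]
    nlinarith [sq_abs (w 0), sq_abs (w 1), abs_nonneg (w 0), abs_nonneg (w 1)]
  · have h2 := abs_quadPoly_sub_le ha (by linarith) c
      (fun i => by fin_cases i; exacts [h0, h1]) hv
    -- A shift by `a / 88` changes the value by at most `1/22` of the size, half of the `1/11`
    -- guaranteed at `w`.
    rw [show 4 * (a / 88 / a) = 1 / 22 by field_simp; norm_num, abs_sub_comm] at h2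
    have h3 := abs_sub_abs_le_abs_sub (quadPoly c w) (quadPoly c v)
    linarith

/-- Discrete norm equivalence for quadratic polynomials on quasi-uniform points `v j` in a disc of
radius `D`. -/
lemma quadSize_le_of_sum_sq_le {ι : Type*} (K : Finset ι) (v : ι → E2) (c : Fin 6 → ℝ)
    {D h γ b : ℝ} (hh : 0 < h) (hγ : 1 ≤ γ) (hD : 2816 * h ≤ D) (hb : 0 ≤ b)
    (hv : ∀ j ∈ K, ‖v j‖ ≤ D)
    (hsep : ∀ i ∈ K, ∀ j ∈ K, i ≠ j → h / γ ≤ ‖v i - v j‖)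
    (hcov : ∀ w : E2, ‖w‖ ≤ D / 4 → ∃ j ∈ K, ‖v j - w‖ ≤ h)
    (hsum : ∑ j ∈ K, quadPoly c (v j) ^ 2 ≤ K.card * b ^ 2) :
    quadSize (D / 16) c ≤ 247808 * γ * b := by
  have hD0 : 0 < D := by linarith
  have hγ0 : 0 < γ := by linarith
  obtain ⟨w, hw, hwP⟩ := exists_disc_quadSize_le (a := D / 16) (by positivity) c
  set S := quadSize (D / 16) c with hS
  have hS0 : 0 ≤ S := quadSize_nonneg (by positivity) c
  classical
  set I := K.filter fun j => ‖v j - w‖ ≤ D / 16 / 88 with hI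
  -- `I` collects the points within `D / 1408` of `w`. As `h` is at most half of this radius, they
  -- cover the concentric disc of radius `D / 2816`.
  have hcard : (D / 2816) ^ 2 ≤ (I.card : ℝ) * h ^ 2 := by
    have := pow_le_card_mul_of_cover I v w (r := D / 2816) (h := h) (by positivity) hh.le
      (fun y hy => by
        have hyn : ‖y‖ ≤ D / 4 := by
          have := norm_add_le (y - w) w
          rw [sub_add_cancel] at this
          linarith
        obtain ⟨j, hj, hjy⟩ := hcov y hyn
        refine ⟨j, Finset.mem_filter.2 ⟨hj, ?_⟩, hjy⟩
        have := norm_sub_le_norm_sub_add_norm_sub (v j) y w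
        linarith)
    rwa [finrank_euclideanSpace_fin] at this
  have hK : (K.card : ℝ) * h ^ 2 ≤ 16 * γ ^ 2 * D ^ 2 := by
    have := card_mul_pow_le_of_separated K v 0 (R := D) (q := h / γ / 2) (by positivity) hD0.le
      (fun j hj => by simpa using hv j hj) (fun i hi j hj hij => by
        linarith [hsep i hi j hj hij])
    rw [finrank_euclideanSpace_fin] at this
    have h1 : h / γ ≤ D := (div_le_self hh.le hγ).trans (by linarith)
    have h2 : (D + h / γ / 2) ^ 2 ≤ (2 * D) ^ 2 := by
      gcongr
      linarith
    have h3 := this.trans h2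
    rw [show (h / γ / 2) ^ 2 = h ^ 2 / (4 * γ ^ 2) by field_simp; norm_num, mul_div_assoc',
      div_le_iff₀ (by positivity)] at h3
    linarith
  have hI2 : (I.card : ℝ) * S ^ 2 ≤ 484 * ((K.card : ℝ) * b ^ 2) := by
    calc (I.card : ℝ) * S ^ 2 = ∑ j ∈ I, S ^ 2 := by rw [Finset.sum_const, nsmul_eq_mul]
      _ ≤ ∑ j ∈ I, 484 * quadPoly c (v j) ^ 2 := by
        refine Finset.sum_le_sum fun j hj => ?_
        have := pow_le_pow_left₀ hS0 (hwP (v j) (Finset.mem_filter.1 hj).2) 2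
        rw [mul_pow, sq_abs] at this
        linarith
      _ ≤ ∑ j ∈ K, 484 * quadPoly c (v j) ^ 2 :=
        Finset.sum_le_sum_of_subset_of_nonneg (Finset.filter_subset _ _) fun _ _ _ => by positivity
      _ ≤ _ := by rw [← Finset.mul_sum]; gcongr
  refine abs_le_of_sq_le_sq' ?_ (by positivity) |>.2
  -- A fraction of order `1 / γ²` of all points sees values at least `S / 22`. The constant is `2816
  -- · 88`, with `88² = 484 · 16`.
  have hfin : (D / 2816) ^ 2 * S ^ 2 ≤ (D / 2816) ^ 2 * (247808 * γ * b) ^ 2 := by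
    calc (D / 2816) ^ 2 * S ^ 2 ≤ (I.card : ℝ) * h ^ 2 * S ^ 2 := by gcongr
      _ = h ^ 2 * ((I.card : ℝ) * S ^ 2) := by ring
      _ ≤ h ^ 2 * (484 * ((K.card : ℝ) * b ^ 2)) := by gcongr
      _ = 484 * ((K.card : ℝ) * h ^ 2) * b ^ 2 := by ring
      _ ≤ 484 * (16 * γ ^ 2 * D ^ 2) * b ^ 2 := by gcongr
      _ = _ := by ring
  exact le_of_mul_le_mul_left hfin (by positivity)

/-- The differential of a quadratic polynomial. -/
noncomputable def quadDeriv (c : Fin 6 → ℝ) (v : E2) : E2 →L[ℝ] ℝ :=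
  (2 * c 0 * v 0 + c 2 * v 1 + c 3) • (EuclideanSpace.proj 0 : E2 →L[ℝ] ℝ)
    + (2 * c 1 * v 1 + c 2 * v 0 + c 4) • (EuclideanSpace.proj 1 : E2 →L[ℝ] ℝ)

lemma contDiff_quadPoly (c : Fin 6 → ℝ) {n : WithTop ℕ∞} : ContDiff ℝ n (quadPoly c) := by
  unfold quadPoly; fun_prop

lemma fderiv_quadPoly (c : Fin 6 → ℝ) : fderiv ℝ (quadPoly c) = quadDeriv c := by
  funext v
  refine HasFDerivAt.fderiv ?_
  have h : ∀ i, HasFDerivAt (fun v : E2 => v i) (EuclideanSpace.proj i : E2 →L[ℝ] ℝ) v := fun i =>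
    (EuclideanSpace.proj i : E2 →L[ℝ] ℝ).hasFDerivAt
  unfold quadPoly
  refine ((((((h 0).pow 2).const_mul (c 0)).add (((h 1).pow 2).const_mul (c 1))).add
    (((h 0).fun_mul (h 1)).const_mul (c 2))).add ((h 0).const_mul (c 3))).add
    ((h 1).const_mul (c 4)) |>.add_const (c 5) |>.congr_fderiv ?_
  ext w
  simp [quadDeriv]
  ring

lemma norm_smul_proj_add_le (a b : ℝ) : ‖a • (EuclideanSpace.proj 0 : E2 →L[ℝ] ℝ)
    + b • (EuclideanSpace.proj 1 : E2 →L[ℝ] ℝ)‖ ≤ |a| + |b| := by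
  refine ContinuousLinearMap.opNorm_le_bound _ (by positivity) fun w => ?_
  have h : ∀ (y : ℝ) i, |y * w i| ≤ |y| * ‖w‖ := fun y i => by
    rw [abs_mul]; gcongr; exact PiLp.norm_apply_le w i
  refine (abs_add_le _ _).trans ?_
  rw [add_mul]
  exact add_le_add (h a 0) (h b 1)

lemma norm_fderiv_quadPoly_le (c : Fin 6 → ℝ) (v : E2) : ‖fderiv ℝ (quadPoly c) v‖
    ≤ |c 3| + |c 4| + 2 * (|c 0| + |c 1| + |c 2|) * ‖v‖ := by
  rw [fderiv_quadPoly]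
  refine (norm_smul_proj_add_le _ _).trans ?_
  have h : ∀ (y : ℝ) i, |y * v i| ≤ |y| * ‖v‖ := fun y i => by
    rw [abs_mul]; gcongr; exact PiLp.norm_apply_le v i
  have t : ∀ x y z : ℝ, |x + y + z| ≤ |x| + |y| + |z| := abs_add_three
  have h1 := t (2 * c 0 * v 0) (c 2 * v 1) (c 3)
  have h2 := t (2 * c 1 * v 1) (c 2 * v 0) (c 4)
  have e0 := h (2 * c 0) 0
  have e1 := h (2 * c 1) 1
  rw [abs_mul 2, abs_two] at e0 e1
  linarith [h (c 2) 0, h (c 2) 1]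

lemma norm_fderiv_fderiv_quadPoly_le (c : Fin 6 → ℝ) (v : E2) :
    ‖fderiv ℝ (fderiv ℝ (quadPoly c)) v‖ ≤ 2 * (|c 0| + |c 1| + |c 2|) := by
  rw [fderiv_quadPoly]
  refine norm_fderiv_le_of_lip' ℝ (by positivity) (Filter.Eventually.of_forall fun w => ?_)
  have hid : quadDeriv c w - quadDeriv c v
      = (2 * c 0 * (w - v) 0 + c 2 * (w - v) 1) • (EuclideanSpace.proj 0 : E2 →L[ℝ] ℝ)
        + (2 * c 1 * (w - v) 1 + c 2 * (w - v) 0) • (EuclideanSpace.proj 1 : E2 →L[ℝ] ℝ) := by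
    ext y
    simp [quadDeriv]
    ring
  rw [hid]
  refine (norm_smul_proj_add_le _ _).trans ?_
  have h : ∀ (y : ℝ) i, |y * (w - v) i| ≤ |y| * ‖w - v‖ := fun y i => by
    rw [abs_mul]; gcongr; exact PiLp.norm_apply_le (w - v) i
  have h1 := abs_add_le (2 * c 0 * (w - v) 0) (c 2 * (w - v) 1)
  have h2 := abs_add_le (2 * c 1 * (w - v) 1) (c 2 * (w - v) 0)
  have e0 := h (2 * c 0) 0
  have e1 := h (2 * c 1) 1
  rw [abs_mul 2, abs_two] at e0 e1
  linarith [h (c 2) 0, h (c 2) 1]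

end Quadratic

/-- Twice the squared area of a triangle `0, a, b` times the squared circumradius. -/
lemma circumradius_identity {a b c : E2} (ha : dist a c = ‖c‖) (hb : dist b c = ‖c‖) :
    ‖a‖ ^ 2 * ‖b‖ ^ 2 * ‖a - b‖ ^ 2 = 4 * ‖c‖ ^ 2 * (a 0 * b 1 - a 1 * b 0) ^ 2 := by
  have h1 : ‖a - c‖ ^ 2 = ‖c‖ ^ 2 := by rw [← dist_eq_norm, ha]
  have h2 : ‖b - c‖ ^ 2 = ‖c‖ ^ 2 := by rw [← dist_eq_norm, hb]
  simp only [norm_sq_E2, PiLp.sub_apply] at h1 h2 ⊢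
  have e1 : a 0 ^ 2 + a 1 ^ 2 = 2 * (a 0 * c 0 + a 1 * c 1) := by linarith
  have e2 : b 0 ^ 2 + b 1 ^ 2 = 2 * (b 0 * c 0 + b 1 * c 1) := by linarith
  -- Cramer's rule for the two perpendicular-bisector equations of the centre `c`.
  have f0 : 2 * (a 0 * b 1 - a 1 * b 0) * c 0
      = (a 0 ^ 2 + a 1 ^ 2) * b 1 - (b 0 ^ 2 + b 1 ^ 2) * a 1 := by rw [e1, e2]; ring
  have f1 : 2 * (a 0 * b 1 - a 1 * b 0) * c 1
      = (b 0 ^ 2 + b 1 ^ 2) * a 0 - (a 0 ^ 2 + a 1 ^ 2) * b 0 := by rw [e1, e2]; ring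
  calc _ = ((a 0 ^ 2 + a 1 ^ 2) * b 1 - (b 0 ^ 2 + b 1 ^ 2) * a 1) ^ 2
        + ((b 0 ^ 2 + b 1 ^ 2) * a 0 - (a 0 ^ 2 + a 1 ^ 2) * b 0) ^ 2 := by ring
    _ = _ := by rw [← f0, ← f1]; ring

/-! ### Neighbourhoods, fits and first rings of fine meshes. -/

namespace CurvedMesh

variable {M : Set E3} {N k : ℕ}

/-- A mesh whose fill distance is small, whose neighbourhoods are large at the scale of the fill
distance but small at the scale of the surface. -/
structure IsFine (δ L γ σ : ℝ) (X : CurvedMesh M N k) : Prop where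
  δ_pos : 0 < δ
  one_le_L : 1 ≤ L
  L_mul_δ : L * δ ≤ 1 / 4
  localDefining : ∀ x ∈ M, ∃ F, IsLocalDefining M δ L x F
  one_le_γ : 1 ≤ γ
  fill_pos : 0 < X.fill
  fill_le_one : X.fill ≤ 1
  fill_lt : 32 * X.fill < δ
  rad_lt : ∀ i, X.rad i < 3 * δ / 16
  rad_le : ∀ i, X.rad i ≤ σ * Real.sqrt X.fill
  cover : ∀ y ∈ M, ∃ j, ‖X.x j - y‖ ≤ X.fill
  sep_le : ∀ i j, i ≠ j → 2 * (X.fill / γ) ≤ ‖X.x i - X.x j‖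
  lt_k : (2816 * γ + 1) ^ 3 < k

/-- The radius of the ambient neighbourhood of `x_i`. -/
noncomputable def reach (X : CurvedMesh M N k) (i : Fin N) : ℝ :=
  (X.K i).sup' ⟨i, X.self_mem i⟩ fun j => ‖X.x j - X.x i‖

variable {X : CurvedMesh M N k} {δ L γ σ : ℝ}

lemma norm_le_reach {i j : Fin N} (hj : j ∈ X.K i) : ‖X.x j - X.x i‖ ≤ X.reach i :=
  Finset.le_sup' (fun j => ‖X.x j - X.x i‖) hj

lemma exists_eq_reach (X : CurvedMesh M N k) (i : Fin N) :
    ∃ j ∈ X.K i, X.reach i = ‖X.x j - X.x i‖ :=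
  Finset.exists_mem_eq_sup' _ _

lemma norm_v_le_rad {i j : Fin N} (hj : j ∈ X.K i) : ‖X.v i j‖ ≤ X.rad i :=
  Finset.le_sup' (fun j => ‖X.v i j‖) hj

lemma v_self (X : CurvedMesh M N k) (i : Fin N) : X.v i i = 0 := tangentCoord_self _ _

lemma mem_K_of_lt {i j m : Fin N} (hj : j ∈ X.K i) (h : ‖X.x m - X.x i‖ < ‖X.x j - X.x i‖) :
    m ∈ X.K i := by
  by_contra hm
  have := X.K_nearest i j hj m hm
  rw [dist_comm, dist_comm (X.x i), dist_eq_norm, dist_eq_norm] at this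
  linarith

namespace IsFine

lemma L_nonneg (hX : X.IsFine δ L γ σ) : 0 ≤ L := zero_le_one.trans hX.one_le_L

lemma γ_pos (hX : X.IsFine δ L γ σ) : 0 < γ := zero_lt_one.trans_le hX.one_le_γ

/-- If a neighbour were at distance `δ` or more, a sample point near a surface point at distance `δ
/ 2` would also be a neighbour, and its projection would be longer than the radius `3 δ / 16`
allows. -/
lemma mem_ball (hX : X.IsFine δ L γ σ) {i j : Fin N} (hj : j ∈ X.K i) : X.x j ∈ ball (X.x i) δ := by
  rw [mem_ball_iff_norm]
  by_contra! hge
  obtain ⟨F, hF⟩ := hX.localDefining _ (X.x_mem i)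
  have hδ := hX.δ_pos
  have hh := hX.fill_lt
  obtain ⟨y, hyM, hy⟩ := hF.exists_mem_dist_eq hX.L_nonneg hX.L_mul_δ (X.x_mem i) (X.t_tangent i)
    (s := δ / 2) (by positivity) (by linarith)
  obtain ⟨m, hm⟩ := hX.cover y hyM
  rw [dist_eq_norm] at hy
  have h1 : ‖X.x m - X.x i‖ ≤ ‖X.x m - y‖ + ‖y - X.x i‖ := norm_sub_le_norm_sub_add_norm_sub _ _ _
  have h2 : ‖y - X.x i‖ ≤ ‖y - X.x m‖ + ‖X.x m - X.x i‖ := norm_sub_le_norm_sub_add_norm_sub _ _ _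
  rw [norm_sub_rev y (X.x m)] at h2
  have hmK : m ∈ X.K i := mem_K_of_lt hj (by linarith)
  have h3 := hF.norm_sub_le hX.L_nonneg hδ hX.L_mul_δ (X.x_mem i) (X.t_tangent i)
    (mem_ball_iff_norm.2 (by linarith)) (X.x_mem m) (mem_ball_self hδ) (X.x_mem i)
  rw [tangentCoord_self, sub_zero] at h3
  have h4 := norm_v_le_rad hmK
  have h5 := hX.rad_lt i
  rw [v] at h4
  linarith

lemma norm_sub_le (hX : X.IsFine δ L γ σ) {i j m : Fin N} (hj : j ∈ X.K i) (hm : m ∈ X.K i) :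
    ‖X.x j - X.x m‖ ≤ 2 * ‖X.v i j - X.v i m‖ := by
  obtain ⟨F, hF⟩ := hX.localDefining _ (X.x_mem i)
  exact hF.norm_sub_le hX.L_nonneg hX.δ_pos hX.L_mul_δ (X.x_mem i) (X.t_tangent i)
    (hX.mem_ball hj) (X.x_mem j) (hX.mem_ball hm) (X.x_mem m)

lemma norm_sub_self_le (hX : X.IsFine δ L γ σ) {i j : Fin N} (hj : j ∈ X.K i) :
    ‖X.x j - X.x i‖ ≤ 2 * ‖X.v i j‖ := by
  simpa [v_self] using hX.norm_sub_le hj (X.self_mem i)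

lemma v_sep (hX : X.IsFine δ L γ σ) {i j m : Fin N} (hj : j ∈ X.K i) (hm : m ∈ X.K i)
    (hjm : j ≠ m) : X.fill / γ ≤ ‖X.v i j - X.v i m‖ := by
  linarith [hX.norm_sub_le hj hm, hX.sep_le j m hjm]

lemma reach_le (hX : X.IsFine δ L γ σ) (i : Fin N) : X.reach i ≤ 2 * σ * Real.sqrt X.fill := by
  obtain ⟨j, hj, h⟩ := X.exists_eq_reach i
  rw [h]
  linarith [hX.norm_sub_self_le hj, norm_v_le_rad hj, hX.rad_le i]

lemma reach_lt (hX : X.IsFine δ L γ σ) (i : Fin N) : X.reach i < δ := by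
  obtain ⟨j, hj, h⟩ := X.exists_eq_reach i
  rw [h]
  exact mem_ball_iff_norm.1 (hX.mem_ball hj)

lemma card_near_le (hX : X.IsFine δ L γ σ) (s : Finset (Fin N)) (i : Fin N) {R : ℝ} (hR : 0 ≤ R)
    (hs : ∀ j ∈ s, ‖X.x j - X.x i‖ ≤ R * X.fill) : (s.card : ℝ) ≤ (R * γ + 1) ^ 3 := by
  have hh := hX.fill_pos
  have hγ := hX.γ_pos
  have := card_mul_pow_le_of_separated s X.x (X.x i) (R := R * X.fill) (q := X.fill / γ)
    (by positivity) (by positivity) hs (fun a _ b _ hab => hX.sep_le a b hab)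
  rw [finrank_euclideanSpace_fin] at this
  rw [show R * X.fill + X.fill / γ = (R * γ + 1) * (X.fill / γ) by field_simp, mul_pow] at this
  exact le_of_mul_le_mul_right this (by positivity)

/-- Packing in `ℝ³`: a ball of radius `2816 h` is too small for `k` separated points. -/
lemma le_reach (hX : X.IsFine δ L γ σ) (i : Fin N) : 2816 * X.fill ≤ X.reach i := by
  by_contra! hlt
  have := hX.card_near_le (X.K i) i (R := 2816) (by norm_num)
    fun j hj => (norm_le_reach hj).trans hlt.le
  rw [X.K_card] at this
  linarith [hX.lt_k]

/-- The exact chart at `x_i` over the disc of radius a quarter of the reach. -/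
lemma exists_chart (hX : X.IsFine δ L γ σ) (i : Fin N) : ∃ ρ, X.reach i / 4 < ρ ∧
    ContDiffOn ℝ 3 (X.z i) (ball 0 ρ) ∧
    ∀ v ∈ ball (0 : E2) ρ, graphMap (X.t i) (X.x i) (X.z i) v ∈ M := by
  obtain ⟨ρ, hρ, hz, hzM⟩ := X.z_chart i
  refine ⟨ρ, ?_, hz, hzM⟩
  obtain ⟨j, hj, h⟩ := X.exists_eq_reach i
  have h1 : ‖X.v i j‖ < ρ := hρ j hj
  linarith [hX.norm_sub_self_le hj, norm_nonneg (X.v i j)]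

/-- Lift `w` to the surface, where it is within half the reach of `x_i`. A sample point within the
fill distance of the lift is still closer than the farthest neighbour, hence a neighbour; projection
does not increase distances. -/
lemma exists_near (hX : X.IsFine δ L γ σ) (i : Fin N) {w : E2} (hw : ‖w‖ ≤ X.reach i / 4) :
    ∃ j ∈ X.K i, ‖X.v i j - w‖ ≤ X.fill := by
  obtain ⟨ρ, hρ, hz, hzM⟩ := hX.exists_chart i
  obtain ⟨F, hF⟩ := hX.localDefining _ (X.x_mem i)
  have hwρ : w ∈ ball (0 : E2) ρ := mem_ball_zero_iff.2 (hw.trans_lt hρ)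
  have h1 := hF.norm_graphMap_sub_le hX.L_nonneg hX.δ_pos hX.L_mul_δ (X.x_mem i) (X.t_tangent i)
    (X.z_zero i) hz.continuousOn hzM hwρ (by linarith [hX.reach_lt i])
  obtain ⟨m, hm⟩ := hX.cover _ (hzM w hwρ)
  have h2 : ‖X.x m - X.x i‖ ≤ ‖X.x m - graphMap (X.t i) (X.x i) (X.z i) w‖
      + ‖graphMap (X.t i) (X.x i) (X.z i) w - X.x i‖ := norm_sub_le_norm_sub_add_norm_sub _ _ _
  obtain ⟨j, hj, hjr⟩ := X.exists_eq_reach i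
  have h3 := hX.le_reach i
  have h4 := hX.fill_pos
  refine ⟨m, mem_K_of_lt hj (by linarith), ?_⟩
  have h5 := norm_tangentCoord_sub_le (X.t i) (X.x i) (X.x m)
    (graphMap (X.t i) (X.x i) (X.z i) w)
  rw [tangentCoord_graphMap] at h5
  exact h5.trans hm

/-! ### The least-squares fit -/

lemma abs_height_le (hX : X.IsFine δ L γ σ) {i j : Fin N} (hj : j ∈ X.K i) :
    |inner ℝ (X.t i 2) (X.x j - X.x i)| ≤ L * ‖X.x j - X.x i‖ ^ 2 := by
  obtain ⟨F, hF⟩ := hX.localDefining _ (X.x_mem i)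
  exact hF.abs_normal_le hX.L_nonneg hX.δ_pos (X.x_mem i) (X.t_tangent i) (hX.mem_ball hj)
    (X.x_mem j)

lemma k_pos (hX : X.IsFine δ L γ σ) : (0 : ℝ) < k := by
  have := hX.γ_pos
  exact lt_trans (by positivity) hX.lt_k

/-- The zero polynomial competes with residuals equal to the heights, `O(reach²)`. At the base point
the height is zero, so its weight `1` costs nothing; every weight is at least `1/k`, so the weighted
bound controls the unweighted mean. -/
lemma sum_fit_sq_le (hX : X.IsFine δ L γ σ) (i : Fin N) :
    ∑ j ∈ X.K i, quadPoly (X.coef i) (X.v i j) ^ 2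
      ≤ (X.K i).card * (2 * L * X.reach i ^ 2) ^ 2 := by
  have hk := hX.k_pos
  have hk1 : (1 : ℝ) ≤ k := by exact_mod_cast Nat.one_le_iff_ne_zero.2 (by
    rintro rfl; simp at hk)
  have hL := hX.L_nonneg
  set s : Fin N → ℝ := fun j => inner ℝ (X.t i 2) (X.x j - X.x i) with hs
  have hreach : ∀ j ∈ X.K i, s j ^ 2 ≤ (L * X.reach i ^ 2) ^ 2 := fun j hj => by
    rw [← sq_abs]
    refine pow_le_pow_left₀ (abs_nonneg _) ((hX.abs_height_le hj).trans ?_) 2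
    have := norm_le_reach hj
    gcongr
  have hw : ∀ r : ℝ, 1 / (k : ℝ) ≤ lsWeight k r := fun r => by
    unfold lsWeight
    split_ifs
    · rw [div_le_one hk]; exact hk1
    · exact le_rfl
  have hmin := X.coef_min i 0
  have hR : ∑ j ∈ X.K i, lsWeight k ‖X.x i - X.x j‖ *
      (quadPoly 0 (tangentCoord (X.t i) (X.x i) (X.x j)) - s j) ^ 2
      ≤ (L * X.reach i ^ 2) ^ 2 := by
    calc _ ≤ ∑ j ∈ X.K i, 1 / (k : ℝ) * (L * X.reach i ^ 2) ^ 2 := by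
          refine Finset.sum_le_sum fun j hj => ?_
          have h0 : quadPoly 0 (tangentCoord (X.t i) (X.x i) (X.x j)) = 0 := by simp [quadPoly]
          rw [h0, zero_sub, neg_sq]
          unfold lsWeight
          split_ifs with h
          · have : s j = 0 := by
              have h' : X.x j - X.x i = 0 := by rw [← norm_eq_zero, norm_sub_rev, h]
              simp [hs, h']
            rw [this, zero_pow two_ne_zero, mul_zero]
            exact mul_nonneg (by positivity) (sq_nonneg _)
          · exact mul_le_mul_of_nonneg_left (hreach j hj) (by positivity)
      _ = _ := by rw [Finset.sum_const, X.K_card, nsmul_eq_mul]; field_simp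
  have hA : ∑ j ∈ X.K i, 1 / (k : ℝ) * (quadPoly (X.coef i) (X.v i j) - s j) ^ 2
      ≤ (L * X.reach i ^ 2) ^ 2 := by
    refine le_trans (Finset.sum_le_sum fun j _ => ?_) (hmin.trans hR)
    exact mul_le_mul_of_nonneg_right (hw _) (sq_nonneg _)
  rw [← Finset.mul_sum, one_div, inv_mul_le_iff₀ hk] at hA
  have hB : ∑ j ∈ X.K i, s j ^ 2 ≤ k * (L * X.reach i ^ 2) ^ 2 := by
    refine (Finset.sum_le_sum hreach).trans_eq ?_
    rw [Finset.sum_const, X.K_card, nsmul_eq_mul]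
  rw [X.K_card]
  calc _ ≤ ∑ j ∈ X.K i, (2 * (quadPoly (X.coef i) (X.v i j) - s j) ^ 2 + 2 * s j ^ 2) := by
        refine Finset.sum_le_sum fun j _ => ?_
        nlinarith [sq_nonneg (quadPoly (X.coef i) (X.v i j) - 2 * s j)]
    _ ≤ 2 * (k * (L * X.reach i ^ 2) ^ 2) + 2 * (k * (L * X.reach i ^ 2) ^ 2) := by
        rw [Finset.sum_add_distrib, ← Finset.mul_sum, ← Finset.mul_sum]
        gcongr
    _ = _ := by ring

lemma quadSize_coef_le (hX : X.IsFine δ L γ σ) (i : Fin N) :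
    quadSize (X.reach i / 16) (X.coef i) ≤ 495616 * γ * L * X.reach i ^ 2 := by
  have hL := hX.L_nonneg
  refine (quadSize_le_of_sum_sq_le (X.K i) (X.v i) (X.coef i) hX.fill_pos hX.one_le_γ
    (hX.le_reach i) (by positivity) (fun j hj => ?_) (fun a ha b hb hab => hX.v_sep ha hb hab)
    (fun w hw => hX.exists_near i hw) (hX.sum_fit_sq_le i)).trans_eq (by ring)
  exact (norm_tangentCoord_le _ _ _).trans (norm_le_reach hj)

/-- At the scale of the reach, the coefficient bound makes linear coefficients `O(reach)` and
quadratic ones `O(1)`; finally `reach = O(√h)`. -/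
lemma fit_bounds (hX : X.IsFine δ L γ σ) (i : Fin N) {v : E2} (hv : ‖v‖ ≤ 4 * X.fill) :
    ‖fderiv ℝ (X.fit i) v‖ ≤ 10 ^ 9 * γ * L * σ * Real.sqrt X.fill ∧
      ‖fderiv ℝ (fderiv ℝ (X.fit i)) v‖ ≤ 10 ^ 9 * γ * L := by
  have hL := hX.L_nonneg
  have hγ := hX.γ_pos
  have hh := hX.fill_pos
  have hD := hX.le_reach i
  have hD0 : 0 < X.reach i := by linarith
  have hS := hX.quadSize_coef_le i
  have hDle := hX.reach_le i
  unfold quadSize at hS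
  set c := X.coef i
  set D := X.reach i
  have h3 : |c 3| + |c 4| ≤ 16 * (495616 * γ * L) * D := by
    have : D / 16 * (|c 3| + |c 4|) ≤ D / 16 * (16 * (495616 * γ * L) * D) := by
      have : 0 ≤ |c 5| + (D / 16) ^ 2 * (|c 0| + |c 1| + |c 2|) := by positivity
      linarith
    exact le_of_mul_le_mul_left this (by positivity)
  have h0 : |c 0| + |c 1| + |c 2| ≤ 256 * (495616 * γ * L) := by
    have : (D / 16) ^ 2 * (|c 0| + |c 1| + |c 2|) ≤ (D / 16) ^ 2 * (256 * (495616 * γ * L)) := by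
      have : 0 ≤ |c 5| + D / 16 * (|c 3| + |c 4|) := by positivity
      linarith
    exact le_of_mul_le_mul_left this (by positivity)
  have hγL : 0 ≤ γ * L := by positivity
  constructor
  · refine (norm_fderiv_quadPoly_le c v).trans ?_
    have hvD : ‖v‖ ≤ D := by linarith
    calc _ ≤ 16 * (495616 * γ * L) * D + 2 * (256 * (495616 * γ * L)) * D := by gcongr
      _ ≤ 5 * 10 ^ 8 * (γ * L) * D := by nlinarith [mul_nonneg hγL hD0.le]
      _ ≤ 5 * 10 ^ 8 * (γ * L) * (2 * σ * Real.sqrt X.fill) := by gcongr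
      _ = _ := by ring
  · refine (norm_fderiv_fderiv_quadPoly_le c v).trans ?_
    linarith

lemma height_bounds (hX : X.IsFine δ L γ σ) (i : Fin N) {v : E2} (hv : ‖v‖ ≤ 4 * X.fill) :
    ContDiffAt ℝ 2 (X.z i) v ∧ ‖fderiv ℝ (X.z i) v‖ ≤ 16 * L * Real.sqrt X.fill ∧
      ‖fderiv ℝ (fderiv ℝ (X.z i)) v‖ ≤ 4 * L := by
  obtain ⟨ρ, hρ, hz, hzM⟩ := hX.exists_chart i
  obtain ⟨F, hF⟩ := hX.localDefining _ (X.x_mem i)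
  have hL := hX.L_nonneg
  have hh := hX.fill_pos
  have hD := hX.le_reach i
  have hvρ : v ∈ ball (0 : E2) ρ := mem_ball_zero_iff.2 (by linarith)
  have hb := hF.height_bounds hL hX.δ_pos hX.L_mul_δ (X.x_mem i) (X.t_tangent i)
    (X.z_zero i) hz hzM hvρ (by linarith [hX.fill_lt])
  refine ⟨(hz.contDiffAt (isOpen_ball.mem_nhds hvρ)).of_le (by norm_num), hb.1.trans ?_, hb.2⟩
  have hsq : X.fill ≤ Real.sqrt X.fill :=
    Real.le_sqrt_of_sq_le (by nlinarith [hX.fill_le_one])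
  calc 4 * L * ‖v‖ ≤ 4 * L * (4 * Real.sqrt X.fill) := by gcongr; linarith
    _ = _ := by ring

/-! ### The first ring -/

lemma mem_ring_iff {i : Fin N} {p : Fin N × Fin N} :
    p ∈ X.ring i ↔ p.1 < p.2 ∧ ({i, p.1, p.2} : Finset (Fin N)) ∈ X.tri i := by
  simp [ring]

lemma _root_.CurvedMesh.ring_distinct {i : Fin N} {p : Fin N × Fin N} (hp : p ∈ X.ring i) :
    p.1 ≠ i ∧ p.2 ≠ i ∧ p.1 ≠ p.2 := by
  obtain ⟨hlt, htri⟩ := mem_ring_iff.1 hp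
  have hc := (X.tri_delaunay i).card _ htri
  refine ⟨?_, ?_, hlt.ne⟩
  · intro h
    rw [h, Finset.insert_eq_of_mem (Finset.mem_insert_self _ _)] at hc
    have := Finset.card_le_two (a := i) (b := p.2)
    omega
  · intro h
    rw [h, Finset.insert_eq_of_mem (by simp)] at hc
    have := Finset.card_le_two (a := p.1) (b := i)
    omega

lemma _root_.CurvedMesh.ring_mem_K {i m : Fin N} {p : Fin N × Fin N} (hp : p ∈ X.ring i)
    (hm : m = i ∨ m = p.1 ∨ m = p.2) : m ∈ X.K i :=
  (X.tri_delaunay i).subset _ (mem_ring_iff.1 hp).2 (by simpa using hm)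

/-- A circle through the origin with radius at least `2h` contains the point at distance `2h` from
the origin towards its centre. A projected neighbour within `h` of that point lies strictly inside,
against the empty-circle property. -/
lemma ring_circumcenter (hX : X.IsFine δ L γ σ) {i : Fin N} {p : Fin N × Fin N}
    (hp : p ∈ X.ring i) : ∃ c : E2, ‖c‖ < 2 * X.fill ∧ dist (X.v i p.1) c = ‖c‖ ∧
      dist (X.v i p.2) c = ‖c‖ := by
  obtain ⟨hlt, htri⟩ := mem_ring_iff.1 hp
  obtain ⟨c, ρ, hon, hempty⟩ := (X.tri_delaunay i).emptyCircle _ htri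
  have hρ : ‖c‖ = ρ := by
    have : dist (X.v i i) c = ρ := hon i (by simp)
    rwa [v_self, dist_zero_left] at this
  subst hρ
  refine ⟨c, ?_, hon p.1 (by simp), hon p.2 (by simp)⟩
  by_contra! hge
  have hh := hX.fill_pos
  have hc : 0 < ‖c‖ := by linarith
  have hw : ‖(2 * X.fill / ‖c‖) • c‖ = 2 * X.fill := by
    rw [norm_smul, Real.norm_of_nonneg (by positivity)]
    field_simp
  obtain ⟨j, hj, hjw⟩ := hX.exists_near i (w := (2 * X.fill / ‖c‖) • c)
    (by rw [hw]; linarith [hX.le_reach i])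
  have h1 : ‖c‖ ≤ dist (X.v i j) c := hempty j hj
  have h2 : ‖(2 * X.fill / ‖c‖) • c - c‖ = ‖c‖ - 2 * X.fill := by
    have : (2 * X.fill / ‖c‖) • c - c = (2 * X.fill / ‖c‖ - 1) • c := by rw [sub_smul, one_smul]
    rw [this, norm_smul, Real.norm_of_nonpos (by rw [sub_nonpos, div_le_one hc]; exact hge)]
    field_simp
    ring
  have h3 := norm_sub_le_norm_sub_add_norm_sub (X.v i j) ((2 * X.fill / ‖c‖) • c) c
  rw [dist_eq_norm] at h1
  linarith

lemma norm_ring_le (hX : X.IsFine δ L γ σ) {i : Fin N} {p : Fin N × Fin N} (hp : p ∈ X.ring i) :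
    ‖X.v i p.1‖ ≤ 4 * X.fill ∧ ‖X.v i p.2‖ ≤ 4 * X.fill := by
  obtain ⟨c, hc, h1, h2⟩ := hX.ring_circumcenter hp
  have key : ∀ a : E2, dist a c = ‖c‖ → ‖a‖ ≤ 4 * X.fill := fun a ha => by
    have := norm_add_le (a - c) c
    rw [sub_add_cancel, ← dist_eq_norm, ha] at this
    linarith
  exact ⟨key _ h1, key _ h2⟩

lemma norm_sub_ring_le (hX : X.IsFine δ L γ σ) {i m : Fin N} {p : Fin N × Fin N}
    (hp : p ∈ X.ring i) (hm : m = i ∨ m = p.1 ∨ m = p.2) :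
    ‖X.x m - X.x i‖ ≤ 8 * X.fill := by
  have hmv : ‖X.v i m‖ ≤ 4 * X.fill := by
    rcases hm with rfl | rfl | rfl
    · rw [v_self, norm_zero]; linarith [hX.fill_pos]
    · exact (hX.norm_ring_le hp).1
    · exact (hX.norm_ring_le hp).2
  linarith [hX.norm_sub_self_le (ring_mem_K hp hm)]

/-- All sides are at least `h / γ` and the circumradius is below `2h`, so the circumradius formula
bounds the area from below. -/
lemma le_det_ring (hX : X.IsFine δ L γ σ) {i : Fin N} {p : Fin N × Fin N} (hp : p ∈ X.ring i) :
    1 / (16 * γ ^ 6) * X.fill ^ 4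
      ≤ (X.v i p.1 0 * X.v i p.2 1 - X.v i p.1 1 * X.v i p.2 0) ^ 2 := by
  obtain ⟨c, hc, h1, h2⟩ := hX.ring_circumcenter hp
  obtain ⟨d1, d2, d3⟩ := ring_distinct hp
  have k0 := ring_mem_K hp (m := i) (by simp)
  have k1 := ring_mem_K hp (m := p.1) (by simp)
  have k2 := ring_mem_K hp (m := p.2) (by simp)
  have s1 := hX.v_sep k1 k0 d1
  have s2 := hX.v_sep k2 k0 d2
  have s3 := hX.v_sep k1 k2 d3
  rw [v_self, sub_zero] at s1 s2
  have hid := circumradius_identity h1 h2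
  have hh := hX.fill_pos
  have hγ := hX.γ_pos
  set q := X.fill / γ with hq
  have hq0 : 0 < q := by positivity
  have hlow : q ^ 2 * q ^ 2 * q ^ 2 ≤ ‖X.v i p.1‖ ^ 2 * ‖X.v i p.2‖ ^ 2
      * ‖X.v i p.1 - X.v i p.2‖ ^ 2 := by gcongr
  rw [hid] at hlow
  have hup : 4 * ‖c‖ ^ 2 ≤ 16 * X.fill ^ 2 := by nlinarith [norm_nonneg c]
  have hfin := hlow.trans (mul_le_mul_of_nonneg_right hup (sq_nonneg _))
  refine le_of_mul_le_mul_left (le_trans (le_of_eq ?_) hfin)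
    (by positivity : 0 < 16 * X.fill ^ 2)
  rw [hq]
  field_simp

lemma card_ring_le (hX : X.IsFine δ L γ σ) (i : Fin N) :
    ((X.ring i).card : ℝ) ≤ ((16 * γ + 1) ^ 3) ^ 2 := by
  classical
  set s := Finset.univ.filter fun j => ‖X.x j - X.x i‖ ≤ 16 * X.fill with hs
  have hh := hX.fill_pos
  have hsub : X.ring i ⊆ s ×ˢ s := fun p hp => by
    simp only [hs, Finset.mem_product, Finset.mem_filter, Finset.mem_univ, true_and]
    exact ⟨(hX.norm_sub_ring_le hp (by simp)).trans (by linarith),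
      (hX.norm_sub_ring_le hp (by simp)).trans (by linarith)⟩
  have h1 : ((X.ring i).card : ℝ) ≤ (s.card : ℝ) ^ 2 := by
    rw [sq]; exact_mod_cast (Finset.card_le_card hsub).trans_eq (Finset.card_product _ _)
  refine h1.trans ?_
  gcongr
  exact hX.card_near_le s i (by norm_num) fun j hj => (Finset.mem_filter.1 hj).2

end IsFine

end CurvedMesh

/-! ### From elements to matrices. -/

namespace CurvedMesh

open Param MeasureTheory

variable {M : Set E3} {N k : ℕ} {X : CurvedMesh M N k} {δ L γ σ : ℝ}

/-- The triangle `p` of the first ring at `x_i` with the height function `f i`. -/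
noncomputable def elementData (X : CurvedMesh M N k) (f : Fin N → E2 → ℝ) (i : Fin N)
    (p : Fin N × Fin N) : ElementData :=
  ⟨X.t i, X.x i, f i, ![X.v i p.1, X.v i p.2], X.fill⟩

/-- The nodal field of the vertex `m` on the triangle `p`. -/
noncomputable def nodalData (X : CurvedMesh M N k) (i : Fin N) (p : Fin N × Fin N) (m : Fin N)
    (κ : Fin 2) : NodalData :=
  ⟨hat i p m, vertexParam i p m, X.t m (Fin.castSucc κ)⟩

lemma massMatrix_apply (X : CurvedMesh M N k) (f : Fin N → E2 → ℝ) (a b : Fin N × Fin 2) :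
    X.massMatrix f a b = ∑ p ∈ X.ring a.1, massIntegral (X.elementData f a.1 p).map
      (X.nodalData a.1 p a.1 a.2) (X.nodalData a.1 p b.1 b.2) := rfl

lemma stiffnessMatrix_apply (X : CurvedMesh M N k) (f : Fin N → E2 → ℝ) (a b : Fin N × Fin 2) :
    X.stiffnessMatrix f a b = ∑ p ∈ X.ring a.1, stiffnessIntegral (X.elementData f a.1 p).map
      (X.nodalData a.1 p a.1 a.2) (X.nodalData a.1 p b.1 b.2) := rfl

lemma field_eq_zero {i m : Fin N} {p : Fin N × Fin N} (hm : ¬ (m = i ∨ m = p.1 ∨ m = p.2))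
    (κ : Fin 2) (Φ : E2 → E3) (q : Fin 2) :
    (X.nodalData i p m κ).field Φ q = fun _ => 0 := by
  push Not at hm
  funext u
  simp [NodalData.field, nodalData, hat, hm.1, hm.2.1, hm.2.2]

lemma massIntegral_eq_zero {i m : Fin N} {p : Fin N × Fin N}
    (hm : ¬ (m = i ∨ m = p.1 ∨ m = p.2)) (κ : Fin 2) (Φ : E2 → E3) (n : NodalData) :
    massIntegral Φ n (X.nodalData i p m κ) = 0 := by
  simp [massIntegral, massIntegrand, vecInner, field_eq_zero hm]

lemma stiffnessIntegral_eq_zero {i m : Fin N} {p : Fin N × Fin N}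
    (hm : ¬ (m = i ∨ m = p.1 ∨ m = p.2)) (κ : Fin 2) (Φ : E2 → E3) (n : NodalData) :
    stiffnessIntegral Φ n (X.nodalData i p m κ) = 0 := by
  have h : ∀ u, gradVec Φ ((X.nodalData i p m κ).field Φ) u = 0 := fun u => by
    ext a b
    simp [gradVec, pd, field_eq_zero hm]
  simp [stiffnessIntegral, stiffnessIntegrand, tensorInner, h]

lemma hat_eq (i : Fin N) (p : Fin N × Fin N) (m : Fin N) : ∃ a b c : ℝ,
    (hat i p m = fun u => a + b * u 0 + c * u 1) ∧ |b| ≤ 1 ∧ |c| ≤ 1 := by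
  by_cases h1 : m = i
  · exact ⟨1, -1, -1, by funext u; simp [hat, h1]; ring, by simp, by simp⟩
  by_cases h2 : m = p.1
  · exact ⟨0, 1, 0, by funext u; simp only [hat, if_neg h1, if_pos h2]; ring, by simp, by simp⟩
  by_cases h3 : m = p.2
  · exact ⟨0, 0, 1, by
      funext u; simp only [hat, if_neg h1, if_neg h2, if_pos h3]; ring, by simp, by simp⟩
  exact ⟨0, 0, 0, by funext u; simp [hat, h1, h2, h3], by simp, by simp⟩

lemma abs_hat_le (i : Fin N) (p : Fin N × Fin N) (m : Fin N) {u : E2} (hu : u ∈ refTriangle) :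
    |hat i p m u| ≤ 1 := by
  obtain ⟨h0, h1, h2⟩ := hu
  unfold hat
  split_ifs <;> rw [abs_le] <;> constructor <;> linarith

lemma vertexParam_mem (i : Fin N) (p : Fin N × Fin N) (m : Fin N) :
    vertexParam i p m ∈ refTriangle := by
  unfold vertexParam refTriangle
  split_ifs <;> simp

namespace IsFine

/-- Height functions that are flat at the scale of the mesh. -/
def _root_.CurvedMesh.IsFlat (K : ℝ) (X : CurvedMesh M N k) (f : Fin N → E2 → ℝ) : Prop :=
  ∀ i v, ‖v‖ ≤ 4 * X.fill → ContDiffAt ℝ 2 (f i) v ∧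
    ‖fderiv ℝ (f i) v‖ ≤ K * Real.sqrt X.fill ∧ ‖fderiv ℝ (fderiv ℝ (f i)) v‖ ≤ K

lemma elementData_admissible (hX : X.IsFine δ L γ σ) {K : ℝ} (hK : 4 ≤ K)
    {f : Fin N → E2 → ℝ} (hf : X.IsFlat K f) {i : Fin N} {p : Fin N × Fin N}
    (hp : p ∈ X.ring i) : (X.elementData f i p).Admissible K (1 / (16 * γ ^ 6)) := by
  have hh := hX.fill_pos
  obtain ⟨n1, n2⟩ := hX.norm_ring_le hp
  -- By convexity the whole triangle lies in the disc where flatness is known.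
  have hw : ∀ u ∈ refTriangle, ‖edgeMap (X.elementData f i p).J u‖ ≤ 4 * X.fill := by
    rintro u ⟨h0, h1, h2⟩
    rw [edgeMap_apply]
    refine (norm_add_le _ _).trans ?_
    rw [norm_smul, norm_smul, Real.norm_of_nonneg h0, Real.norm_of_nonneg h1]
    change u 0 * ‖X.v i p.1‖ + u 1 * ‖X.v i p.2‖ ≤ _
    nlinarith
  have hKf : 4 * X.fill ≤ K * X.fill := by gcongr
  exact {
    h_pos := hh
    h_le := hX.fill_le_one
    edge_le := fun m => by
      fin_cases m
      exacts [n1.trans hKf, n2.trans hKf]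
    le_det := hX.le_det_ring hp
    contDiffAt := fun u hu => (hf i _ (hw u hu)).1
    grad_le := fun u hu => (hf i _ (hw u hu)).2.1
    hess_le := fun u hu => (hf i _ (hw u hu)).2.2 }

/-- Vertices of the ring are within `8h`, so their tangent vectors have normal component `O(h)` in
the frame at `x_i`; as `h ≤ 1`, this is below the required `O(√h)`. -/
lemma nodalData_admissible (hX : X.IsFine δ L γ σ) {K : ℝ} (hK : 8 * L ≤ K)
    (f : Fin N → E2 → ℝ) {i m : Fin N} {p : Fin N × Fin N} (hp : p ∈ X.ring i)
    (hm : m = i ∨ m = p.1 ∨ m = p.2) (κ : Fin 2) :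
    (X.nodalData i p m κ).Admissible K (X.elementData f i p) := by
  obtain ⟨a, b, c, hhat, hb, hc⟩ := hat_eq i p m
  have hL := hX.L_nonneg
  have hderiv : ∀ u, HasFDerivAt (hat i p m) (b • (EuclideanSpace.proj 0 : E2 →L[ℝ] ℝ)
      + c • (EuclideanSpace.proj 1 : E2 →L[ℝ] ℝ)) u := fun u => by
    have h : ∀ j, HasFDerivAt (fun v : E2 => v j) (EuclideanSpace.proj j : E2 →L[ℝ] ℝ) u :=
      fun j => (EuclideanSpace.proj j : E2 →L[ℝ] ℝ).hasFDerivAt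
    rw [hhat]
    exact (((h 0).const_mul b).const_add a).add ((h 1).const_mul c)
  refine ⟨vertexParam_mem i p m, ((X.t m).orthonormal.1 _).le, ?_, ?_,
    fun u _ => (hderiv u).differentiableAt, fun u hu => abs_hat_le i p m hu, fun u _ j => ?_⟩
  · obtain ⟨F, hF⟩ := hX.localDefining _ (X.x_mem i)
    have hτ : X.t m (Fin.castSucc κ) ∈ tangentConeAt ℝ M (X.x m) := by
      fin_cases κ
      exacts [(X.t_tangent m).1, (X.t_tangent m).2]
    have h1 := hF.abs_normal_tangent_le hX.δ_pos (X.x_mem i) (X.t_tangent i)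
      (hX.mem_ball (ring_mem_K hp hm)) (X.x_mem m) hτ ((X.t m).orthonormal.1 _).le hL
    refine h1.trans ?_
    have hsq : X.fill ≤ Real.sqrt X.fill :=
      Real.le_sqrt_of_sq_le (by nlinarith [hX.fill_le_one, hX.fill_pos])
    calc L * ‖X.x m - X.x i‖ ≤ L * (8 * X.fill) := by
          gcongr; exact hX.norm_sub_ring_le hp hm
      _ = 8 * L * X.fill := by ring
      _ ≤ K * Real.sqrt X.fill := mul_le_mul hK hsq hX.fill_pos.le (by linarith)
  · change Measurable (hat i p m)
    exact (continuous_iff_continuousAt.2 fun u => (hderiv u).continuousAt).measurable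
  · change |fderiv ℝ (hat i p m) u _| ≤ 1
    rw [(hderiv u).fderiv]
    fin_cases j
    · simpa using hb
    · simpa using hc

/-- The flat comparison height. -/
def _root_.CurvedMesh.flatHeight (N : ℕ) : Fin N → E2 → ℝ := fun _ _ => 0

/-- Closeness of a matrix built from flat height functions to the one of the flat patches. -/
structure _root_.CurvedMesh.MatrixClose (X : CurvedMesh M N k) (r C : ℝ)
    (S S₀ : Matrix (Fin N × Fin 2) (Fin N × Fin 2) ℝ) : Prop where
  entry_le : ∀ a b, |S a b| ≤ r * C
  sub_le : ∀ a b, |S a b - S₀ a b| ≤ r * (C * X.fill)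
  far : ∀ a b, 16 * X.fill < ‖X.x a.1 - X.x b.1‖ → S a b = 0 ∧ S₀ a b = 0

/-- The number of triangles in a ring is bounded by packing, and only vertices of the ring
contribute; they are within `8h`, well inside the cut-off `16h`. -/
lemma matrixClose_of_integrals (hX : X.IsFine δ L γ σ) {C : ℝ} (hC : 0 ≤ C)
    {S S₀ : Matrix (Fin N × Fin 2) (Fin N × Fin 2) ℝ}
    {I I₀ : Fin N × Fin 2 → Fin N × Fin 2 → Fin N × Fin N → ℝ}
    (hS : ∀ a b, S a b = ∑ p ∈ X.ring a.1, I a b p)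
    (hS₀ : ∀ a b, S₀ a b = ∑ p ∈ X.ring a.1, I₀ a b p)
    (hI : ∀ a b, ∀ p ∈ X.ring a.1, (b.1 = a.1 ∨ b.1 = p.1 ∨ b.1 = p.2) →
      |I a b p - I₀ a b p| ≤ C * X.fill ∧ |I a b p| ≤ C)
    (hI0 : ∀ a b p, ¬ (b.1 = a.1 ∨ b.1 = p.1 ∨ b.1 = p.2) → I a b p = 0 ∧ I₀ a b p = 0) :
    X.MatrixClose (((16 * γ + 1) ^ 3) ^ 2) C S S₀ := by
  have hh := hX.fill_pos
  have hsum : ∀ (a : Fin N × Fin 2) (g : Fin N × Fin N → ℝ) (B : ℝ), 0 ≤ B →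
      (∀ p ∈ X.ring a.1, |g p| ≤ B) →
      |∑ p ∈ X.ring a.1, g p| ≤ ((16 * γ + 1) ^ 3) ^ 2 * B := fun a g B hB hg => by
    refine (Finset.abs_sum_le_sum_abs _ _).trans ((Finset.sum_le_sum hg).trans ?_)
    rw [Finset.sum_const, nsmul_eq_mul]
    gcongr
    exact hX.card_ring_le a.1
  refine ⟨fun a b => ?_, fun a b => ?_, fun a b hab => ?_⟩
  · rw [hS]
    refine hsum a _ C hC fun p hp => ?_
    by_cases h : b.1 = a.1 ∨ b.1 = p.1 ∨ b.1 = p.2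
    · exact (hI a b p hp h).2
    · rw [(hI0 a b p h).1, abs_zero]; exact hC
  · rw [hS, hS₀, ← Finset.sum_sub_distrib]
    refine hsum a _ _ (by positivity) fun p hp => ?_
    by_cases h : b.1 = a.1 ∨ b.1 = p.1 ∨ b.1 = p.2
    · exact (hI a b p hp h).1
    · rw [(hI0 a b p h).1, (hI0 a b p h).2, sub_zero, abs_zero]; positivity
  · have h : ∀ p ∈ X.ring a.1, ¬ (b.1 = a.1 ∨ b.1 = p.1 ∨ b.1 = p.2) := fun p hp hb => by
      have := hX.norm_sub_ring_le hp hb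
      rw [norm_sub_rev] at this
      linarith
    rw [hS, hS₀]
    exact ⟨Finset.sum_eq_zero fun p hp => (hI0 a b p (h p hp)).1,
      Finset.sum_eq_zero fun p hp => (hI0 a b p (h p hp)).2⟩

/-- `K` and `γ` are fixed before the mesh, so `C` is uniform. With zero height the curved patch is
the flat one by definition. -/
lemma matrices_close {K γ : ℝ} (hK : 0 ≤ K) (hγ : 0 < γ) : ∃ C, 0 ≤ C ∧
    ∀ {M : Set E3} {N k : ℕ} {X : CurvedMesh M N k} {δ L σ : ℝ}, X.IsFine δ L γ σ →
      16 * L ≤ K → ∀ f : Fin N → E2 → ℝ, X.IsFlat K f →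
      X.MatrixClose (((16 * γ + 1) ^ 3) ^ 2) C (X.stiffnessMatrix f)
        (X.stiffnessMatrix (flatHeight N)) ∧
      X.MatrixClose (((16 * γ + 1) ^ 3) ^ 2) C (X.massMatrix f) (X.massMatrix (flatHeight N)) := by
  obtain ⟨C, hC, H⟩ := element_integrals_close hK (by positivity : 0 < 1 / (16 * γ ^ 6))
  refine ⟨C, hC, fun {M N k X δ L σ} hX hLK f hf => ?_⟩
  have hL := hX.one_le_L
  have key := fun (a b : Fin N × Fin 2) (p : Fin N × Fin N) (hp : p ∈ X.ring a.1)
      (hb : b.1 = a.1 ∨ b.1 = p.1 ∨ b.1 = p.2) =>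
    H _ _ _ (hX.elementData_admissible (by linarith) hf hp)
      (hX.nodalData_admissible (by linarith) f hp (m := a.1) (by simp) a.2)
      (hX.nodalData_admissible (by linarith) f hp hb b.2)
  exact ⟨hX.matrixClose_of_integrals hC (X.stiffnessMatrix_apply f)
      (X.stiffnessMatrix_apply (flatHeight N)) (fun a b p hp hb => (key a b p hp hb).1)
      (fun a b p hb => ⟨stiffnessIntegral_eq_zero hb _ _ _, stiffnessIntegral_eq_zero hb _ _ _⟩),
    hX.matrixClose_of_integrals hC (X.massMatrix_apply f)
      (X.massMatrix_apply (flatHeight N)) (fun a b p hp hb => (key a b p hp hb).2)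
      (fun a b p hb => ⟨massIntegral_eq_zero hb _ _ _, massIntegral_eq_zero hb _ _ _⟩)⟩

/-- Matrices close to the same flat matrix are close in spectral norm after symmetrization. -/
lemma specNorm_symm_sub_le (hX : X.IsFine δ L γ σ) {r C : ℝ} (hr : 0 ≤ r) (hC : 0 ≤ C)
    {S S' S₀ : Matrix (Fin N × Fin 2) (Fin N × Fin 2) ℝ} (hS : X.MatrixClose r C S S₀)
    (hS' : X.MatrixClose r C S' S₀) :
    specNorm ((1 / 2 : ℝ) • (S' + S'.transpose) - (1 / 2 : ℝ) • (S + S.transpose))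
      ≤ (2 * (16 * γ + 1) ^ 3) * (2 * r * C * X.fill) := by
  classical
  have hh := hX.fill_pos
  have hγ := hX.γ_pos
  have hent : ∀ a b, |S' a b - S a b| ≤ 2 * r * C * X.fill := fun a b => by
    have h1 := hS.sub_le a b
    have h2 := hS'.sub_le a b
    rw [show S' a b - S a b = (S' a b - S₀ a b) - (S a b - S₀ a b) by ring]
    refine (abs_sub _ _).trans ?_
    linarith
  -- Packing bounds the nodes within `16h`; each carries two components, whence the factor `2`.
  refine specNorm_le_of_sparse _ (fun a b => ‖X.x a.1 - X.x b.1‖ ≤ 16 * X.fill)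
    (fun a b h => by rwa [norm_sub_rev]) (by positivity) (by positivity) (fun a => ?_)
    (fun a b => ?_) (fun a b hab => ?_)
  · set s := Finset.univ.filter fun j => ‖X.x j - X.x a.1‖ ≤ 16 * X.fill with hs
    have h1 : (Finset.univ.filter fun b : Fin N × Fin 2 => ‖X.x a.1 - X.x b.1‖ ≤ 16 * X.fill)
        ⊆ s ×ˢ Finset.univ := fun b hb => by
      simp only [Finset.mem_filter, Finset.mem_univ, true_and] at hb
      simp only [hs, Finset.mem_product, Finset.mem_filter, Finset.mem_univ, true_and, and_true]
      rwa [norm_sub_rev]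
    have h2 := Finset.card_le_card h1
    rw [Finset.card_product, Finset.card_univ, Fintype.card_fin] at h2
    have h3 := hX.card_near_le s a.1 (R := 16) (by norm_num) fun j hj => (Finset.mem_filter.1 hj).2
    have h4 : ((Finset.univ.filter fun b : Fin N × Fin 2 =>
      ‖X.x a.1 - X.x b.1‖ ≤ 16 * X.fill).card : ℝ) ≤ s.card * 2 := by exact_mod_cast h2
    linarith
  · simp only [Matrix.sub_apply, Matrix.smul_apply, Matrix.add_apply, Matrix.transpose_apply,
      smul_eq_mul]
    rw [show 1 / 2 * (S' a b + S' b a) - 1 / 2 * (S a b + S b a)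
      = 1 / 2 * (S' a b - S a b) + 1 / 2 * (S' b a - S b a) by ring]
    refine (abs_add_le _ _).trans ?_
    rw [abs_mul, abs_mul, abs_of_pos (by norm_num : (0 : ℝ) < 1 / 2)]
    linarith [hent a b, hent b a]
  · push Not at hab
    simp only [Matrix.sub_apply, Matrix.smul_apply, Matrix.add_apply, Matrix.transpose_apply,
      smul_eq_mul]
    have hba : 16 * X.fill < ‖X.x b.1 - X.x a.1‖ := by rwa [norm_sub_rev]
    rw [(hS.far a b hab).1, (hS.far b a hba).1, (hS'.far a b hab).1, (hS'.far b a hba).1]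
    ring

end IsFine

lemma Ahat_transpose (X : CurvedMesh M N k) : X.Ahat.transpose = X.Ahat := by
  simp [Ahat, add_comm]

lemma fill_nonneg (X : CurvedMesh M N k) : 0 ≤ X.fill := by
  refine Real.sSup_nonneg ?_
  rintro _ ⟨y, -, rfl⟩
  exact infDist_nonneg

lemma sep_nonneg (X : CurvedMesh M N k) : 0 ≤ X.sep := by
  refine mul_nonneg (by norm_num) (Real.sInf_nonneg ?_)
  rintro _ ⟨i, j, -, rfl⟩
  exact norm_nonneg _

lemma two_sep_le (X : CurvedMesh M N k) {i j : Fin N} (hij : i ≠ j) :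
    2 * X.sep ≤ ‖X.x i - X.x j‖ := by
  have : sInf {d | ∃ i j, i ≠ j ∧ d = ‖X.x i - X.x j‖} ≤ ‖X.x i - X.x j‖ := by
    refine csInf_le ⟨0, ?_⟩ ⟨i, j, hij, rfl⟩
    rintro _ ⟨i, j, -, rfl⟩
    exact norm_nonneg _
  unfold sep
  linarith

lemma exists_near_fill (X : CurvedMesh M N k) (hM : IsCompact M) (i : Fin N) {y : E3}
    (hy : y ∈ M) : ∃ j, ‖X.x j - y‖ ≤ X.fill := by
  obtain ⟨_, ⟨j, rfl⟩, hj⟩ := (Set.finite_range X.x).isCompact.exists_infDist_eq_dist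
    ⟨X.x i, i, rfl⟩ y
  refine ⟨j, ?_⟩
  rw [← dist_eq_norm, dist_comm, ← hj]
  exact le_csSup (hM.image (continuous_infDist_pt _)).bddAbove ⟨y, hy, rfl⟩

/-- With fill distance zero every point of `M` would be a sample point, yet distances from `x_i` to
points of `M` take all values in `(0, δ)`. -/
lemma fill_pos_of_index (X : CurvedMesh M N k) (hM : IsCompact M) (i : Fin N) {δ L : ℝ}
    (hδ : 0 < δ) (hL : 0 ≤ L) (hLδ : L * δ ≤ 1 / 4)
    (hF : ∀ x ∈ M, ∃ F, IsLocalDefining M δ L x F) : 0 < X.fill := by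
  refine X.fill_nonneg.lt_of_ne' fun h0 => ?_
  obtain ⟨F, hF⟩ := hF _ (X.x_mem i)
  have hsub : Set.Ioo 0 δ ⊆ Set.range fun j => dist (X.x j) (X.x i) := fun s hs => by
    obtain ⟨y, hy, hys⟩ := hF.exists_mem_dist_eq hL hLδ (X.x_mem i) (X.t_tangent i) hs.1 hs.2
    obtain ⟨j, hj⟩ := X.exists_near_fill hM i hy
    rw [h0] at hj
    have : X.x j = y := sub_eq_zero.1 (norm_le_zero_iff.1 hj)
    exact ⟨j, by simp only [this, hys]⟩
  exact Set.Ioo_infinite hδ ((Set.finite_range _).subset hsub)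

end CurvedMesh

/-! ### Uniform constants and assembly. -/

lemma pencilDist_le {n : Type*} [Fintype n] [DecidableEq n] (A B A' B' : Matrix n n ℝ) :
    pencilDist A B A' B' ≤ specNorm (A' - A) + specNorm (B' - B) := by
  have h1 := specNorm_nonneg (A' - A)
  have h2 := specNorm_nonneg (B' - B)
  exact Real.sqrt_le_iff.2 ⟨by positivity, by nlinarith⟩

lemma half_smul_add_transpose_apply {n : Type*} (S : Matrix n n ℝ) (e : n) :
    ((1 / 2 : ℝ) • (S + S.transpose)) e e = S e e := by
  simp only [Matrix.smul_apply, Matrix.add_apply, Matrix.transpose_apply, smul_eq_mul]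
  ring

lemma crawford_le_diag {n : Type*} [Fintype n] [DecidableEq n] (A B : Matrix n n ℝ) (e : n) :
    crawford A B ≤ A e e ^ 2 + B e e ^ 2 := by
  have := crawford_le A B (x := EuclideanSpace.single e (1 : ℝ)) (by simp)
  simpa using this

namespace CurvedMesh

variable {M : Set E3} {N k : ℕ} {X : CurvedMesh M N k} {δ L γ σ : ℝ}

/-- The third smallness condition turns `rad ≤ √|cr| √h` into `rad < 3 δ / 16`. The absolute value
and the `+ 1` allow `cr` of any sign. -/
lemma isFine_of_fill_le (X : CurvedMesh M N k) (hM : IsCompact M) (i : Fin N) {cq cr : ℝ}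
    (hδ : 0 < δ) (hL : 1 ≤ L) (hLδ : L * δ ≤ 1 / 4)
    (hF : ∀ x ∈ M, ∃ F, IsLocalDefining M δ L x F) (h1 : X.fill ≤ 1) (h2 : X.fill ≤ δ / 33)
    (h3 : X.fill ≤ (3 * δ / 16 / (Real.sqrt |cr| + 1)) ^ 2) (hquasi : X.fill ≤ cq * X.sep)
    (hrad : ∀ i, X.rad i ^ 2 ≤ cr * X.fill) (hγ : 1 ≤ γ) (hcq : cq ≤ γ)
    (hk : (2816 * γ + 1) ^ 3 < k) : X.IsFine δ L γ (Real.sqrt |cr|) := by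
  have hσ0 : 0 ≤ Real.sqrt |cr| := Real.sqrt_nonneg _
  have hγ0 : 0 < γ := by linarith
  have hrad' : ∀ i, X.rad i ≤ Real.sqrt |cr| * Real.sqrt X.fill := fun i => by
    rw [← Real.sqrt_mul (abs_nonneg _)]
    exact Real.le_sqrt_of_sq_le ((hrad i).trans
      (mul_le_mul_of_nonneg_right (le_abs_self _) X.fill_nonneg))
  exact {
    δ_pos := hδ
    one_le_L := hL
    L_mul_δ := hLδ
    localDefining := hF
    one_le_γ := hγ
    fill_pos := X.fill_pos_of_index hM i hδ (by linarith) hLδ hF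
    fill_le_one := h1
    fill_lt := by linarith
    rad_lt := fun i => by
      refine (hrad' i).trans_lt ?_
      set τ := 3 * δ / 16 / (Real.sqrt |cr| + 1) with hτ
      have hτ0 : 0 < τ := by positivity
      have h4 : Real.sqrt X.fill ≤ τ := (Real.sqrt_le_left hτ0.le).2 h3
      calc Real.sqrt |cr| * Real.sqrt X.fill ≤ Real.sqrt |cr| * τ := by gcongr
        _ < (Real.sqrt |cr| + 1) * τ := by linarith
        _ = 3 * δ / 16 := by rw [hτ]; field_simp
    rad_le := hrad'
    cover := fun y hy => X.exists_near_fill hM i hy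
    sep_le := fun i j hij => by
      refine le_trans ?_ (X.two_sep_le hij)
      have : X.fill / γ ≤ X.sep := by
        rw [div_le_iff₀ hγ0, mul_comm]
        exact hquasi.trans (mul_le_mul_of_nonneg_right hcq X.sep_nonneg)
      linarith
    lt_k := hk }

lemma IsFine.isFlat_z (hX : X.IsFine δ L γ σ) {K : ℝ} (hK : 16 * L ≤ K) : X.IsFlat K X.z := by
  intro i v hv
  obtain ⟨h1, h2, h3⟩ := hX.height_bounds i hv
  exact ⟨h1, h2.trans (mul_le_mul_of_nonneg_right hK (Real.sqrt_nonneg _)),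
    h3.trans (by linarith [hX.one_le_L])⟩

lemma IsFine.isFlat_fit (hX : X.IsFine δ L γ σ) {K : ℝ} (hK : 10 ^ 9 * γ * L * σ ≤ K)
    (hK' : 10 ^ 9 * γ * L ≤ K) : X.IsFlat K X.fit := by
  intro i v hv
  obtain ⟨h2, h3⟩ := hX.fit_bounds i hv
  exact ⟨(contDiff_quadPoly _).contDiffAt,
    h2.trans (mul_le_mul_of_nonneg_right hK (Real.sqrt_nonneg _)), h3.trans hK'⟩

/-- A coordinate vector bounds the Crawford number by bounded diagonal entries, so that `κ` can be
chosen before the mesh. -/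
lemma crawford_le_of_matrixClose (X : CurvedMesh M N k) (e : Fin N × Fin 2) {r C : ℝ}
    {S₀ M₀ : Matrix (Fin N × Fin 2) (Fin N × Fin 2) ℝ}
    (hS : X.MatrixClose r C (X.stiffnessMatrix X.z) S₀)
    (hM : X.MatrixClose r C (X.massMatrix X.z) M₀) :
    crawford X.A X.B ≤ 2 * (r * C) ^ 2 := by
  have h := crawford_le_diag X.A X.B e
  have hA : X.A e e = X.stiffnessMatrix X.z e e := half_smul_add_transpose_apply _ e
  have hB : X.B e e = X.massMatrix X.z e e := half_smul_add_transpose_apply _ e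
  have h1 : X.A e e ^ 2 ≤ (r * C) ^ 2 := by
    rw [hA, ← sq_abs]
    exact pow_le_pow_left₀ (abs_nonneg _) (hS.entry_le e e) 2
  have h2 : X.B e e ^ 2 ≤ (r * C) ^ 2 := by
    rw [hB, ← sq_abs]
    exact pow_le_pow_left₀ (abs_nonneg _) (hM.entry_le e e) 2
  exact h.trans ((add_le_add h1 h2).trans_eq (two_mul _).symm)

lemma pencilDist_le_of_matrixClose (hX : X.IsFine δ L γ σ) {r C : ℝ} (hr : 0 ≤ r) (hC : 0 ≤ C)
    {S₀ M₀ : Matrix (Fin N × Fin 2) (Fin N × Fin 2) ℝ}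
    (hS : X.MatrixClose r C (X.stiffnessMatrix X.z) S₀)
    (hS' : X.MatrixClose r C (X.stiffnessMatrix X.fit) S₀)
    (hM : X.MatrixClose r C (X.massMatrix X.z) M₀)
    (hM' : X.MatrixClose r C (X.massMatrix X.fit) M₀) :
    pencilDist X.A X.B X.Ahat X.Bhat
      ≤ 2 * ((2 * (16 * γ + 1) ^ 3) * (2 * r * C)) * X.fill := by
  refine (pencilDist_le _ _ _ _).trans ?_
  have e1 := hX.specNorm_symm_sub_le hr hC hS hS'
  have e2 := hX.specNorm_symm_sub_le hr hC hM hM'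
  exact (add_le_add e1 e2).trans_eq (by ring)

lemma pencilDist_of_isEmpty (X : CurvedMesh M 0 k) : pencilDist X.A X.B X.Ahat X.Bhat = 0 := by
  have h0 : ∀ E : Matrix (Fin 0 × Fin 2) (Fin 0 × Fin 2) ℝ, specNorm E = 0 := fun E => by
    rw [Subsingleton.elim E 0, specNorm, map_zero, norm_zero]
  rw [pencilDist, h0, h0]
  simp

end CurvedMesh

theorem mainTheorem3 (M : Set E3) (hMc : IsCompact M) (hM : IsC3Surface M) (cq cr : ℝ) :
    ∃ (h₀ : ℝ) (k₀ : ℕ) (C₀ κ : ℝ), 0 < h₀ ∧ 0 < C₀ ∧ 1 ≤ κ ∧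
      ∀ (N k : ℕ) (X : CurvedMesh M N k), k₀ ≤ k → X.fill ≤ h₀ →
        X.sep ≤ X.fill → X.fill ≤ cq * X.sep → (∀ i, X.rad i ^ 2 ≤ cr * X.fill) →
        κ * pencilDist X.A X.B X.Ahat X.Bhat ≤ C₀ * X.fill ∧
        (X.A.PosDef → X.B.PosDef → X.Bhat.PosDef →
          ∀ a b lam lamHat : Fin (2 * N) → ℝ,
            IsPencilSpectrum X.A 1 a → IsPencilSpectrum X.B 1 b →
            IsPencilSpectrum X.A X.B lam → IsPencilSpectrum X.Ahat X.Bhat lamHat →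
            ∀ C : ℝ, κ * pencilDist X.A X.B X.Ahat X.Bhat ≤ C * X.fill →
              (∀ l, C ^ 2 * X.fill ^ 2 < a l ^ 2 + b l ^ 2) →
              ∀ l, |lam l - lamHat l| ≤
                C * X.fill / crawford X.A X.B * |1 + lam l * lamHat l|) := by
  obtain ⟨δ, hδ, L, hL, hLδ, hdef⟩ := hM.exists_uniform_localDefining hMc
  obtain ⟨γ, hγ, hcq⟩ : ∃ γ, 1 ≤ γ ∧ cq ≤ γ := ⟨max 1 cq, le_max_left _ _, le_max_right _ _⟩
  have hL0 : 0 ≤ L := zero_le_one.trans hL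
  have hγ0 : 0 < γ := zero_lt_one.trans_le hγ
  obtain ⟨K, hK1, hK2, hK3⟩ : ∃ K, 16 * L ≤ K ∧ 10 ^ 9 * γ * L * Real.sqrt |cr| ≤ K ∧
      10 ^ 9 * γ * L ≤ K :=
    ⟨max (16 * L) (max (10 ^ 9 * γ * L * Real.sqrt |cr|) (10 ^ 9 * γ * L)), le_max_left _ _,
      (le_max_left _ _).trans (le_max_right _ _), (le_max_right _ _).trans (le_max_right _ _)⟩
  have hK : 0 ≤ K := le_trans (by positivity) hK1
  obtain ⟨C, hC, hclose⟩ := CurvedMesh.IsFine.matrices_close hK hγ0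
  obtain ⟨r, hr, hr0⟩ : ∃ r, r = ((16 * γ + 1) ^ 3) ^ 2 ∧ 0 ≤ r := ⟨_, rfl, by positivity⟩
  rw [← hr] at hclose
  -- Chosen so that `κ² - 1` dominates the Crawford number of every mesh considered.
  obtain ⟨κ, hκ, hκ2⟩ : ∃ κ : ℝ, 1 ≤ κ ∧ 2 * (r * C) ^ 2 ≤ κ ^ 2 - 1 :=
    ⟨Real.sqrt (1 + 2 * (r * C) ^ 2), Real.one_le_sqrt.2 (by nlinarith [sq_nonneg (r * C)]), by
      rw [Real.sq_sqrt (by positivity)]; linarith⟩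
  obtain ⟨B, hB, hB0⟩ : ∃ B, B = 2 * ((2 * (16 * γ + 1) ^ 3) * (2 * r * C)) ∧ 0 ≤ B :=
    ⟨_, rfl, by positivity⟩
  obtain ⟨k₀, hk₀⟩ := exists_nat_gt ((2816 * γ + 1) ^ 3)
  -- `δ / 33` makes `32 h < δ` strict, and the `+ 1` keeps `C₀` positive even if `B = 0`.
  refine ⟨min (min 1 (δ / 33)) ((3 * δ / 16 / (Real.sqrt |cr| + 1)) ^ 2), k₀, κ * B + 1, κ,
    by positivity, by positivity, hκ, ?_⟩
  intro N k X hk hfill _ hquasi hrad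
  -- A sample point is needed for the fill distance to be positive; for `N = 0` the matrices are
  -- empty and the bound is trivial.
  have hmat : ∀ _ : Fin N, ∃ S₀ M₀, X.IsFine δ L γ (Real.sqrt |cr|) ∧
      X.MatrixClose r C (X.stiffnessMatrix X.z) S₀ ∧
      X.MatrixClose r C (X.stiffnessMatrix X.fit) S₀ ∧
      X.MatrixClose r C (X.massMatrix X.z) M₀ ∧
      X.MatrixClose r C (X.massMatrix X.fit) M₀ := fun i => by
    have hX := X.isFine_of_fill_le hMc i hδ hL hLδ hdef
      (hfill.trans ((min_le_left _ _).trans (min_le_left _ _)))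
      (hfill.trans ((min_le_left _ _).trans (min_le_right _ _)))
      (hfill.trans (min_le_right _ _)) hquasi hrad hγ hcq
      (hk₀.trans_le (Nat.cast_le.2 hk))
    obtain ⟨z1, z2⟩ := hclose hX hK1 X.z (hX.isFlat_z hK1)
    obtain ⟨f1, f2⟩ := hclose hX hK1 X.fit (hX.isFlat_fit hK2 hK3)
    exact ⟨_, _, hX, z1, f1, z2, f2⟩
  constructor
  · have hdist : pencilDist X.A X.B X.Ahat X.Bhat ≤ B * X.fill := by
      rcases Nat.eq_zero_or_pos N with rfl | hN
      · rw [X.pencilDist_of_isEmpty]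
        exact mul_nonneg hB0 X.fill_nonneg
      · obtain ⟨S₀, M₀, hX, z1, f1, z2, f2⟩ := hmat ⟨0, hN⟩
        rw [hB]
        exact CurvedMesh.pencilDist_le_of_matrixClose hX hr0 hC z1 f1 z2 f2
    calc κ * pencilDist X.A X.B X.Ahat X.Bhat ≤ κ * (B * X.fill) := by gcongr
      _ ≤ (κ * B + 1) * X.fill := by linarith [X.fill_nonneg]
  · intro hA hB' hBhat a b lam lamHat ha hb hlam hlamHat C' hC' hgap l
    have hN : 0 < N := by have := l.pos; omega
    obtain ⟨S₀, M₀, hX, z1, f1, z2, f2⟩ := hmat ⟨0, hN⟩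
    exact pencil_perturbation_of_gap hA hB' X.Ahat_transpose hBhat ha hb hlam hlamHat hκ
      ((X.crawford_le_of_matrixClose (⟨0, hN⟩, 0) z1 z2).trans hκ2) hC'
      (fun l => by rw [mul_pow]; exact hgap l) l
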